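/- Let $\gamma>-1$, let $f(x)=|x|^\gamma$ be the shape of the limit order book, and put $F(y)=\int_0^y f(x)\,dx$, $\tilde F(x)=\int_0^x yf(y)\,dy$ and $G=\tilde F\circ F^{-1}$. Let $\rho:[0,\infty)\to(0,\infty)$ (resilience) be $\mathcal C^1$, let $\lambda:[0,\infty)\to(0,\infty)$ (depth) be $\mathcal C^2$, and set $\eta_t=\lambda'(t)/\lambda(t)$. Let $(S^0_t)_{t\ge0}$ (unaffected price) be a right-continuous martingale on a filtered probability space $(\Omega,\mathcal F,(\mathcal F_t)_{t\ge0},\mathbb P)$. For a horizon $T>0$ and $q\in\mathbb R$, an admissible strategy liquidating $q$ shares on $[0,T]$ is an adapted, left-continuous process $X$ with $X_0=q$ and $X_{T+}=0$ (we put $X_t=0$ for $t>T$), whose total variation is finite and a.s. bounded by a constant. In model $V$ its volume impact $E$ is the solution of $dE_t=dX_t-\rho_tE_t\,dt$, $E_0=0$, its price impact is $D_t=F^{-1}(E_t/\lambda(t))$, and, with $\Delta X_t=X_{t+}-X_t$, its expected cost is $$\mathcal C(X)=\mathbb E\Big[\int_{[0,T]}(S^0_t+D_t)\,dX_t+\sum_{0\le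 t\le T}\Big(\lambda(t)\Big[G\Big(\tfrac{E_t+\Delta X_t}{\lambda(t)}\Big)-G\Big(\tfrac{E_t}{\lambda(t)}\Big)\Big]-D_t\,\Delta X_t\Big)\Big].$$ A price manipulation strategy (PMS) on $[0,T]$ is an admissible strategy $X$ for $q=0$ with $\mathcal C(X)<0$. There is a transaction-triggered price manipulation (TTPM) on $[0,T]$ if for some $q\in\mathbb R$ there is an admissible strategy $X$ liquidating $q$ shares such that $\mathcal C(X)<\inf\mathcal C(\tilde X)$, where the infimum is over all admissible strategies $\tilde X$ liquidating $q$ shares that are nonincreasing or nondecreasing. Then: 1. There is no PMS on $[0,T]$ for any $T>0$ if and only if $\rho_t(2+\gamma)+\eta_t\ge 0$ for all $t\ge0$. 2. There is no TTPM on $[0,T]$ for any $T>0$ if and only if, for all $t\ge0$, $$\rho_t+\eta_t\ge0\quad\text{and}\quad\left(\frac{\rho_t(1+\gamma)}{\rho_t(2+\gamma)+\eta_t}\right)'+\rho_t\,\frac{\rho_t+\eta_t}{\rho_t(2+\gamma)+\eta_t}\ge0.$$ 3. For each fixed $T>0$, there is no PMS on $[0,T]$ if and only if the condition in 1 holds for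 all $t\in[0,T]$, and there is no TTPM on $[0,T]$ if and only if the two conditions in 2 hold for all $t\in[0,T]$. (Derivatives at $t=0$ are right derivatives.) -/

import Mathlib

open MeasureTheory ProbabilityTheory Set Filter
open scoped NNReal ENNReal Topology

namespace OrderBook

noncomputable section

/-! ### Shape of the limit order book -/

/-- Antiderivative `F(y) = ∫₀^y f(x) dx` of the shape function. -/
def antideriv (f : ℝ → ℝ) (y : ℝ) : ℝ := ∫ x in (0 : ℝ)..y, f x

/-- The inverse function `F⁻¹`. -/
def antiderivInv (f : ℝ → ℝ) : ℝ → ℝ := Function.invFun (antideriv f)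

/-- `F̃(x) = ∫₀^x y f(y) dy`. -/
def moment (f : ℝ → ℝ) (x : ℝ) : ℝ := ∫ y in (0 : ℝ)..x, y * f y

/-- `G(x) = F̃(F⁻¹(x))`. -/
def costPotential (f : ℝ → ℝ) (x : ℝ) : ℝ := moment f (antiderivInv f x)

/-- Power-law shape `f(x) = |x|^γ`. -/
def powerLaw (γ : ℝ) (x : ℝ) : ℝ := |x| ^ γ

/-! ### Impact of one path of a strategy -/

/-- Volume impact `E` of the path `x` of a strategy: the solution of
`dE_t = dx_t - ρ_t E_t dt`, `E_0 = 0`. See `volumeImpact_eq` for the integrated equation. -/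
def volumeImpact (ρ : ℝ → ℝ) (x : ℝ≥0 → ℝ) (t : ℝ≥0) : ℝ :=
  (x t - x 0) -
    ∫ s in (0 : ℝ)..t, ρ s * Real.exp (-∫ u in s..t, ρ u) * (x s.toNNReal - x 0)

/-- Price impact `D_t = F⁻¹(E_t / λ(t))`. -/
def priceImpact (f ρ lam : ℝ → ℝ) (x : ℝ≥0 → ℝ) (t : ℝ≥0) : ℝ :=
  antiderivInv f (volumeImpact ρ x t / lam t)

/-- Jump `Δx_t = x_{t+} - x_t` of a left-continuous path. -/
def jump (x : ℝ≥0 → ℝ) (t : ℝ≥0) : ℝ := Function.rightLim x t - x t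

open Classical in
/-- The signed measure `dx` on `[0, ∞)` of a path of bounded variation; it gives the mass
`x_{t+} - x_{t-}` to `{t}` for `t > 0` and the mass `x_{0+} - x_0` to `{0}`. -/
def pathMeasure (x : ℝ≥0 → ℝ) : SignedMeasure ℝ≥0 :=
  if h : BoundedVariationOn x univ then h.vectorMeasure else 0

/-- Cost of trading along the path `x` on `[0, T]` when the unaffected price is `s`:
`∫_{[0,T]} (s_t + D_t) dx_t + ∑_{t ≤ T} (λ(t) (G((E_t + Δx_t)/λ(t)) - G(E_t/λ(t))) - D_t Δx_t)`. -/
def pathCost (f ρ lam : ℝ → ℝ) (T : ℝ≥0) (s x : ℝ≥0 → ℝ) : ℝ :=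
  (∫ᵛ t in Icc 0 T, (s t + priceImpact f ρ lam x t) ∂•(pathMeasure x)) +
    ∑' t : Icc (0 : ℝ≥0) T,
      (lam (t : ℝ≥0) *
          (costPotential f ((volumeImpact ρ x t + jump x t) / lam (t : ℝ≥0)) -
            costPotential f (volumeImpact ρ x t / lam (t : ℝ≥0))) -
        priceImpact f ρ lam x t * jump x t)

/-! ### Strategies and manipulations -/

variable {Ω : Type*} [mΩ : MeasurableSpace Ω]

/-- `X` is an admissible strategy that liquidates `q` shares on `[0, T]`: the process `X_t` of
the number of shares still to be liquidated is adapted, left-continuous, of a.s. bounded total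
variation, starts at `q` and is `0` after `T` (in particular `X_{T+} = 0`). -/
structure IsAdmissible (P : Measure Ω) (ℱ : Filtration ℝ≥0 mΩ) (T : ℝ≥0) (q : ℝ)
    (X : ℝ≥0 → Ω → ℝ) : Prop where
  adapted : StronglyAdapted ℱ X
  leftContinuous : ∀ᵐ ω ∂P, ∀ t, ContinuousWithinAt (fun s => X s ω) (Iic t) t
  initial : ∀ᵐ ω ∂P, X 0 ω = q
  terminal : ∀ᵐ ω ∂P, ∀ t, T < t → X t ω = 0
  boundedVariation : ∃ M : ℝ≥0, ∀ᵐ ω ∂P, eVariationOn (fun t => X t ω) univ ≤ M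

/-- `X` is a.s. nonincreasing or a.s. nondecreasing. -/
def IsMonotoneStrategy (P : Measure Ω) (X : ℝ≥0 → Ω → ℝ) : Prop :=
  (∀ᵐ ω ∂P, Antitone fun t => X t ω) ∨ (∀ᵐ ω ∂P, Monotone fun t => X t ω)

/-- Expected cost `𝒞(X)` in model `V` with unaffected price `S`. -/
def expectedCost (P : Measure Ω) (S : ℝ≥0 → Ω → ℝ) (f ρ lam : ℝ → ℝ) (T : ℝ≥0)
    (X : ℝ≥0 → Ω → ℝ) : ℝ :=
  ∫ ω, pathCost f ρ lam T (fun t => S t ω) (fun t => X t ω) ∂P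

/-- Existence of a price manipulation strategy on `[0, T]`: a round trip with negative
expected cost. -/
def HasPMS (P : Measure Ω) (ℱ : Filtration ℝ≥0 mΩ) (S : ℝ≥0 → Ω → ℝ) (f ρ lam : ℝ → ℝ)
    (T : ℝ≥0) : Prop :=
  ∃ X, IsAdmissible P ℱ T 0 X ∧ expectedCost P S f ρ lam T X < 0

/-- Existence of a transaction-triggered price manipulation on `[0, T]`: for some number `q` of
shares, an admissible strategy is strictly cheaper than the infimum of the expected costs of the
nonincreasing or nondecreasing admissible strategies for the same `q`. The infimum is taken in
the extended reals. -/
def HasTTPM (P : Measure Ω) (ℱ : Filtration ℝ≥0 mΩ) (S : ℝ≥0 → Ω → ℝ) (f ρ lam : ℝ → ℝ)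
    (T : ℝ≥0) : Prop :=
  ∃ (q : ℝ) (X : ℝ≥0 → Ω → ℝ), IsAdmissible P ℱ T q X ∧
    (expectedCost P S f ρ lam T X : EReal) <
      sInf {c : EReal | ∃ Y, IsAdmissible P ℱ T q Y ∧ IsMonotoneStrategy P Y ∧
        c = (expectedCost P S f ρ lam T Y : EReal)}

/-! ### The volume impact solves its equation -/

theorem intervalIntegrable_path {x : ℝ≥0 → ℝ} (hx : BoundedVariationOn x univ) (a b : ℝ) :
    IntervalIntegrable (fun s : ℝ => x s.toNNReal) volume a b := by
  obtain ⟨p, q, hp, hq, rfl⟩ :=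
    hx.locallyBoundedVariationOn.exists_monotoneOn_sub_monotoneOn
  have mono : ∀ {r : ℝ≥0 → ℝ}, MonotoneOn r univ →
      IntervalIntegrable (fun s : ℝ => r s.toNNReal) volume a b := by
    intro r hr
    refine Monotone.intervalIntegrable ?_
    intro u v huv
    exact hr (mem_univ _) (mem_univ _) (Real.toNNReal_le_toNNReal huv)
  exact (mono hp).sub (mono hq)

/-- The integrated form of `dE_t = dx_t - ρ_t E_t dt`, `E_0 = 0`. -/
theorem volumeImpact_eq {ρ : ℝ → ℝ} (hρ : ContinuousOn ρ (Ici 0)) {x : ℝ≥0 → ℝ}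
    (hx : BoundedVariationOn x univ) (t : ℝ≥0) :
    volumeImpact ρ x t =
      (x t - x 0) - ∫ s in (0 : ℝ)..t, ρ s * volumeImpact ρ x s.toNNReal := by
  have hint : ∀ a b : ℝ, 0 ≤ a → 0 ≤ b → IntervalIntegrable ρ volume a b := by
    intro a b ha hb
    refine (hρ.mono ?_).intervalIntegrable
    intro s hs
    exact le_trans (le_min ha hb) hs.1
  set R : ℝ → ℝ := fun s => ∫ u in (0 : ℝ)..s, ρ u with hR
  set Y : ℝ → ℝ := fun s => x s.toNNReal - x 0 with hY
  have hYi : ∀ a b : ℝ, IntervalIntegrable Y volume a b := fun a b =>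
    (intervalIntegrable_path hx a b).sub intervalIntegrable_const
  have hRcont : ContinuousOn R (Ici 0) := by
    intro s hs
    have h := intervalIntegral.continuousOn_primitive_interval' (hint 0 (s + 1) le_rfl
      (by have : (0 : ℝ) ≤ s := hs; linarith)) left_mem_uIcc
    have hs0 : (0 : ℝ) ≤ s := hs
    rw [uIcc_of_le (by linarith)] at h
    refine (h s ⟨hs0, by linarith⟩).mono_of_mem_nhdsWithin ?_
    rw [← Ici_inter_Iic]
    exact inter_mem self_mem_nhdsWithin (mem_nhdsWithin_of_mem_nhds (Iic_mem_nhds (by linarith)))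
  set g : ℝ → ℝ := fun s => ρ s * Real.exp (R s) * Y s with hg
  have hgi : ∀ b : ℝ, 0 ≤ b → IntervalIntegrable g volume 0 b := by
    intro b hb
    refine (hYi 0 b).continuousOn_mul ?_
    have hsub : uIcc 0 b ⊆ Ici 0 := by
      rw [uIcc_of_le hb]; exact Icc_subset_Ici_self
    exact (hρ.mono hsub).mul (Real.continuous_exp.comp_continuousOn (hRcont.mono hsub))
  set W : ℝ → ℝ := fun s => ∫ u in (0 : ℝ)..s, g u with hW
  set V : ℝ → ℝ := fun s => Real.exp (-R s) with hV
  have key : ∀ b : ℝ, 0 ≤ b →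
      volumeImpact ρ x b.toNNReal = Y b - V b * W b := by
    intro b hb
    simp only [volumeImpact, hY, hW, hV, Real.coe_toNNReal b hb]
    congr 1
    rw [← intervalIntegral.integral_const_mul]
    refine intervalIntegral.integral_congr ?_
    intro s hs
    rw [uIcc_of_le hb] at hs
    have h1 : ∫ u in s..b, ρ u = R b - R s := by
      rw [hR]
      exact (intervalIntegral.integral_interval_sub_left (hint 0 b le_rfl hb)
        (hint 0 s le_rfl hs.1)).symm
    simp only [hg, h1]
    rw [show -(R b - R s) = -R b + R s by ring, Real.exp_add]
    ring
  have hb : (0 : ℝ) ≤ t := t.2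
  have hVd : ∀ s ∈ Ioo (0 : ℝ) t, HasDerivAt V (-(ρ s * V s)) s := by
    intro s hs
    have hc : ContinuousAt ρ s := hρ.continuousAt (Ici_mem_nhds hs.1)
    have hRd : HasDerivAt R (ρ s) s := by
      refine intervalIntegral.integral_hasDerivAt_right (hint 0 s le_rfl hs.1.le) ?_ hc
      exact (hρ.mono Ioi_subset_Ici_self).stronglyMeasurableAtFilter isOpen_Ioi s hs.1
    have h : HasDerivAt V (Real.exp (-R s) * -ρ s) s := hRd.neg.exp
    have he : -(ρ s * V s) = Real.exp (-R s) * -ρ s := by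
      change -(ρ s * Real.exp (-R s)) = _
      ring
    rw [he]
    exact h
  have hWac : AbsolutelyContinuousOnInterval W 0 t :=
    (hgi t hb).absolutelyContinuousOnInterval_intervalIntegral left_mem_uIcc
  have hsub : Icc (0 : ℝ) t ⊆ Ici 0 := Icc_subset_Ici_self
  have hVcont : ContinuousOn V (Icc 0 t) :=
    Real.continuous_exp.comp_continuousOn (hRcont.mono hsub).neg
  have hVi : IntervalIntegrable (fun s => -(ρ s * V s)) volume 0 t := by
    refine ContinuousOn.intervalIntegrable ?_
    rw [uIcc_of_le hb]
    exact ((hρ.mono hsub).mul hVcont).neg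
  set U : ℝ → ℝ := fun s => (∫ u in (0 : ℝ)..s, -(ρ u * V u)) + V 0 with hU
  have hUV : ∀ s ∈ Icc (0 : ℝ) t, U s = V s := by
    intro s hs
    have h := intervalIntegral.integral_eq_sub_of_hasDerivAt_of_le hs.1
      (hVcont.mono (Icc_subset_Icc_right hs.2))
      (fun r hr => hVd r ⟨hr.1, hr.2.trans_le hs.2⟩)
      (hVi.mono_set (by
        rw [uIcc_of_le hs.1, uIcc_of_le hb]; exact Icc_subset_Icc_right hs.2))
    simp only [hU, h]
    ring
  have hUd : ∀ s ∈ Ioo (0 : ℝ) t, HasDerivAt U (-(ρ s * V s)) s := by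
    intro s hs
    refine (hVd s hs).congr_of_eventuallyEq ?_
    filter_upwards [Ioo_mem_nhds hs.1 hs.2] with r hr
    exact hUV r ⟨hr.1.le, hr.2.le⟩
  have hUac : AbsolutelyContinuousOnInterval U 0 t :=
    (hVi.absolutelyContinuousOnInterval_intervalIntegral left_mem_uIcc).fun_add
      (LipschitzOnWith.absolutelyContinuousOnInterval
        (LipschitzWith.const (V 0)).lipschitzOnWith)
  have hprod := hUac.integral_deriv_mul_eq_sub hWac
  have hW0 : W 0 = 0 := by simp [hW]
  rw [hW0, mul_zero, sub_zero] at hprod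
  have hk := key t hb
  rw [Real.toNNReal_coe] at hk
  rw [hk, ← hUV t ⟨hb, le_rfl⟩, ← hprod]
  have hYt : Y t = x t - x 0 := by simp [hY]
  rw [hYt]
  congr 1
  refine intervalIntegral.integral_congr_ae ?_
  have hne : ∀ᵐ s : ℝ, s ≠ t := by simp [ae_iff, measure_singleton]
  filter_upwards [(hgi t hb).ae_hasDerivAt_integral, hne] with s hs hst hmem
  have hmem' := uIoc_subset_uIcc hmem
  rw [uIoc_of_le hb] at hmem
  have hs' := hs hmem' 0 left_mem_uIcc
  have hlt : s < t := lt_of_le_of_ne hmem.2 hst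
  rw [(hUd s ⟨hmem.1, hlt⟩).deriv, hs'.deriv, hUV s ⟨hmem.1.le, hmem.2⟩, key s hmem.1.le]
  have hVe : V s * Real.exp (R s) = 1 := by
    simp only [hV]
    rw [← Real.exp_add]; simp
  simp only [hg]
  linear_combination (ρ s * Y s) * hVe

end

end OrderBook

namespace OrderBook

/-! ### Signed powers and the potential of a power-law book -/

/-- The odd power `sgn(x) |x|^s`. -/
noncomputable def signedRPow (s x : ℝ) : ℝ := |x| ^ (s - 1) * x

theorem signedRPow_one (x : ℝ) : signedRPow 1 x = x := by simp [signedRPow]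

theorem signedRPow_neg (s x : ℝ) : signedRPow s (-x) = -signedRPow s x := by simp [signedRPow]

theorem signedRPow_of_nonneg {s x : ℝ} (hs : s ≠ 0) (hx : 0 ≤ x) : signedRPow s x = x ^ s := by
  rcases hx.eq_or_lt with rfl | hx
  · simp [signedRPow, Real.zero_rpow hs]
  · rw [signedRPow, abs_of_pos hx, Real.rpow_sub_one hx.ne', div_mul_cancel₀ _ hx.ne']

theorem abs_signedRPow {s : ℝ} (hs : s ≠ 0) (x : ℝ) : |signedRPow s x| = |x| ^ s := by
  rw [← signedRPow_of_nonneg hs (abs_nonneg x), signedRPow, signedRPow, abs_mul, abs_abs,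
    abs_of_nonneg (Real.rpow_nonneg (abs_nonneg x) _)]

theorem signedRPow_mul {s c : ℝ} (hc : 0 < c) (x : ℝ) :
    signedRPow s (c * x) = c ^ s * signedRPow s x := by
  rw [signedRPow, signedRPow, abs_mul, abs_of_pos hc, Real.mul_rpow hc.le (abs_nonneg x),
    Real.rpow_sub_one hc.ne']
  field_simp

theorem signedRPow_signedRPow {r s : ℝ} (hr : r ≠ 0) (hs : s ≠ 0) (x : ℝ) :
    signedRPow r (signedRPow s x) = signedRPow (s * r) x := by
  rcases le_total 0 x with hx | hx
  · rw [signedRPow_of_nonneg hs hx, signedRPow_of_nonneg hr (Real.rpow_nonneg hx _),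
      signedRPow_of_nonneg (mul_ne_zero hs hr) hx, Real.rpow_mul hx]
  · obtain ⟨y, rfl⟩ : ∃ y, x = -y := ⟨-x, by simp⟩
    have hy : 0 ≤ y := by linarith
    rw [signedRPow_neg, signedRPow_neg, signedRPow_neg, signedRPow_of_nonneg hs hy,
      signedRPow_of_nonneg hr (Real.rpow_nonneg hy _), signedRPow_of_nonneg (mul_ne_zero hs hr) hy,
      Real.rpow_mul hy]

theorem mul_signedRPow {s : ℝ} (hs : 0 < s) (x : ℝ) : x * signedRPow s x = |x| ^ (s + 1) := by
  have h : signedRPow s x = |x| ^ (s - 1) * x := rfl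
  rw [h]
  rcases eq_or_ne x 0 with rfl | hx
  · simp [Real.zero_rpow (show s + 1 ≠ 0 by linarith)]
  · have h2 : |x| ^ (s + 1) = |x| ^ (s - 1) * |x| ^ (2 : ℝ) := by
      rw [← Real.rpow_add (abs_pos.2 hx)]; ring_nf
    rw [h2, Real.rpow_two, sq_abs]; ring

theorem hasDerivAt_abs_rpow_signedRPow {p : ℝ} (hp : 1 < p) (x : ℝ) :
    HasDerivAt (fun x : ℝ => |x| ^ p) (p * signedRPow (p - 1) x) x := by
  have h := hasDerivAt_abs_rpow x hp
  have e : p * signedRPow (p - 1) x = p * |x| ^ (p - 2) * x := by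
    rw [signedRPow, mul_assoc, show p - 1 - 1 = p - 2 by ring]
  rwa [e]

/-- For s < 1 the factor |x|^{s-1} in the definition is singular at 0; writing the function as the
difference of the s-th powers of the positive and negative parts removes the singularity. -/
theorem continuous_signedRPow {s : ℝ} (hs : 0 < s) : Continuous (signedRPow s) := by
  have h1 : Continuous fun x : ℝ => (max x 0) ^ s - (max (-x) 0) ^ s :=
    ((continuous_id.max continuous_const).rpow_const fun _ => Or.inr hs.le).sub
      ((continuous_neg.max continuous_const).rpow_const fun _ => Or.inr hs.le)
  convert h1 using 1
  ext x
  rcases le_total 0 x with hx | hx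
  · rw [signedRPow_of_nonneg hs.ne' hx, max_eq_left hx, max_eq_right (by linarith),
      Real.zero_rpow hs.ne', sub_zero]
  · obtain ⟨y, rfl⟩ : ∃ y, x = -y := ⟨-x, by simp⟩
    have hy : 0 ≤ y := by linarith
    rw [signedRPow_neg, signedRPow_of_nonneg hs.ne' hy, max_eq_right hx, neg_neg, max_eq_left hy,
      Real.zero_rpow hs.ne', zero_sub]

theorem convexOn_abs_rpow {p : ℝ} (hp : 1 ≤ p) : ConvexOn ℝ univ fun x : ℝ => |x| ^ p := by
  refine ⟨convex_univ, fun x _ y _ a b ha hb hab => ?_⟩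
  have h := (convexOn_rpow hp).2 (abs_nonneg x) (abs_nonneg y) ha hb hab
  refine le_trans (Real.rpow_le_rpow (abs_nonneg _) ?_ (by linarith)) h
  refine (abs_add_le _ _).trans ?_
  simp [abs_mul, abs_of_nonneg ha, abs_of_nonneg hb]

/-- The graph of `|x|^p` lies above its tangents. -/
theorem tangent_le_abs_rpow {p : ℝ} (hp : 1 < p) (x y : ℝ) :
    |x| ^ p + p * signedRPow (p - 1) x * (y - x) ≤ |y| ^ p := by
  have hc := convexOn_abs_rpow hp.le
  have hd := hasDerivAt_abs_rpow_signedRPow hp x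
  rcases lt_trichotomy x y with h | h | h
  · have := hc.le_slope_of_hasDerivAt (mem_univ x) (mem_univ y) h hd
    rw [slope_def_field, le_div_iff₀ (sub_pos.2 h)] at this
    linarith
  · subst h; simp
  · have := hc.slope_le_of_hasDerivAt (mem_univ y) (mem_univ x) h hd
    rw [slope_def_field, div_le_iff₀ (sub_pos.2 h)] at this
    linarith

theorem antideriv_powerLaw {γ : ℝ} (hγ : -1 < γ) (y : ℝ) :
    antideriv (powerLaw γ) y = signedRPow (1 + γ) y / (1 + γ) := by
  have h0 : (1 + γ) ≠ 0 := by linarith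
  have pos : ∀ z : ℝ, 0 ≤ z → antideriv (powerLaw γ) z = z ^ (1 + γ) / (1 + γ) := by
    intro z hz
    have : antideriv (powerLaw γ) z = ∫ x in (0 : ℝ)..z, x ^ γ := by
      refine intervalIntegral.integral_congr fun x hx => ?_
      rw [uIcc_of_le hz] at hx
      simp [powerLaw, abs_of_nonneg hx.1]
    rw [this, integral_rpow (Or.inl hγ), show γ + 1 = 1 + γ by ring, Real.zero_rpow h0, sub_zero]
  rcases le_total 0 y with hy | hy
  · rw [pos y hy, signedRPow_of_nonneg h0 hy]
  · obtain ⟨z, rfl⟩ : ∃ z, y = -z := ⟨-y, by simp⟩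
    have hz : 0 ≤ z := by linarith
    have : antideriv (powerLaw γ) (-z) = -antideriv (powerLaw γ) z := by
      have h := intervalIntegral.integral_comp_neg (a := 0) (b := z) (powerLaw γ)
      rw [neg_zero] at h
      rw [antideriv, antideriv, intervalIntegral.integral_symm, ← h]
      simp [powerLaw]
    rw [this, pos z hz, signedRPow_neg, signedRPow_of_nonneg h0 hz, neg_div]

theorem moment_powerLaw {γ : ℝ} (hγ : -1 < γ) (y : ℝ) :
    moment (powerLaw γ) y = |y| ^ (2 + γ) / (2 + γ) := by
  have h0 : (2 + γ) ≠ 0 := by linarith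
  have pos : ∀ z : ℝ, 0 ≤ z → moment (powerLaw γ) z = z ^ (2 + γ) / (2 + γ) := by
    intro z hz
    have : moment (powerLaw γ) z = ∫ x in (0 : ℝ)..z, x ^ (1 + γ) := by
      refine intervalIntegral.integral_congr fun x hx => ?_
      rw [uIcc_of_le hz] at hx
      simp only [powerLaw]
      rw [abs_of_nonneg hx.1, add_comm, Real.rpow_add_one' hx.1 (by linarith), mul_comm]
    rw [this, integral_rpow (Or.inl (by linarith)), show 1 + γ + 1 = 2 + γ by ring,
      Real.zero_rpow h0, sub_zero]
  rcases le_total 0 y with hy | hy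
  · rw [pos y hy, abs_of_nonneg hy]
  · obtain ⟨z, rfl⟩ : ∃ z, y = -z := ⟨-y, by simp⟩
    have hz : 0 ≤ z := by linarith
    have : moment (powerLaw γ) (-z) = moment (powerLaw γ) z := by
      have h := intervalIntegral.integral_comp_neg (a := 0) (b := z) (fun y => y * powerLaw γ y)
      rw [neg_zero] at h
      rw [moment, moment, intervalIntegral.integral_symm, ← h]
      simp [powerLaw]
    rw [this, pos z hz, abs_neg, abs_of_nonneg hz]

/-- The homogeneity degree `(2 + γ) / (1 + γ)` of the cost potential. -/
noncomputable def costExponent (γ : ℝ) : ℝ := (2 + γ) / (1 + γ)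

theorem costExponent_sub_one {γ : ℝ} (hγ : -1 < γ) : costExponent γ - 1 = (1 + γ)⁻¹ := by
  have : 1 + γ ≠ 0 := by linarith
  rw [costExponent]; field_simp; ring

theorem one_lt_costExponent {γ : ℝ} (hγ : -1 < γ) : 1 < costExponent γ := by
  have h := costExponent_sub_one hγ
  have : 0 < (1 + γ)⁻¹ := inv_pos.2 (by linarith)
  linarith

/-- `Function.invFun` only picks some preimage, so F must be seen to be a bijection; the explicit
two-sided inverse provides this. -/
theorem antiderivInv_powerLaw {γ : ℝ} (hγ : -1 < γ) (z : ℝ) :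
    antiderivInv (powerLaw γ) z = signedRPow (costExponent γ - 1) ((1 + γ) * z) := by
  have h1 : 0 < 1 + γ := by linarith
  rw [costExponent_sub_one hγ]
  have hinv : (1 + γ)⁻¹ ≠ 0 := inv_ne_zero h1.ne'
  have hleft : Function.LeftInverse (fun z => signedRPow (1 + γ)⁻¹ ((1 + γ) * z))
      (antideriv (powerLaw γ)) := by
    intro y
    simp only
    rw [antideriv_powerLaw hγ, mul_div_cancel₀ _ h1.ne', signedRPow_signedRPow hinv h1.ne',
      mul_inv_cancel₀ h1.ne', signedRPow_one]
  have hright : antideriv (powerLaw γ) (signedRPow (1 + γ)⁻¹ ((1 + γ) * z)) = z := by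
    rw [antideriv_powerLaw hγ, signedRPow_signedRPow h1.ne' hinv, inv_mul_cancel₀ h1.ne',
      signedRPow_one, mul_div_cancel_left₀ _ h1.ne']
  conv_lhs => rw [← hright]
  exact Function.leftInverse_invFun hleft.injective _

theorem costPotential_powerLaw {γ : ℝ} (hγ : -1 < γ) (z : ℝ) :
    costPotential (powerLaw γ) z = ((1 + γ) * |z|) ^ costExponent γ / (2 + γ) := by
  have h1 : 0 < 1 + γ := by linarith
  have hinv : (1 + γ)⁻¹ ≠ 0 := inv_ne_zero h1.ne'
  rw [costPotential, moment_powerLaw hγ, antiderivInv_powerLaw hγ, costExponent_sub_one hγ,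
    abs_signedRPow hinv, ← Real.rpow_mul (abs_nonneg _), abs_mul, abs_of_pos h1, costExponent]
  congr 2
  ring

/-- The weight `w_t` for which `λ_t G(E/λ_t) = w_t |E|^p`. -/
noncomputable def costWeight (γ l : ℝ) : ℝ :=
  (1 + γ) ^ costExponent γ / (2 + γ) * l ^ (1 - costExponent γ)

theorem costWeight_pos {γ l : ℝ} (hγ : -1 < γ) (hl : 0 < l) : 0 < costWeight γ l := by
  have h1 : 0 < 1 + γ := by linarith
  have h2 : 0 < 2 + γ := by linarith
  unfold costWeight; positivity

/-- Homogeneity of the potential is what separates depth from impact. This is the only place where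
the power-law shape makes the problem explicit, together with its derivative in `antiderivInv_div`.
-/
theorem mul_costPotential {γ l : ℝ} (hγ : -1 < γ) (hl : 0 < l) (e : ℝ) :
    l * costPotential (powerLaw γ) (e / l) = costWeight γ l * |e| ^ costExponent γ := by
  have h1 : 0 < 1 + γ := by linarith
  rw [costPotential_powerLaw hγ, costWeight, abs_div, abs_of_pos hl,
    Real.mul_rpow h1.le (by positivity), Real.div_rpow (abs_nonneg _) hl.le,
    Real.rpow_sub hl, Real.rpow_one]
  field_simp

theorem antiderivInv_div {γ l : ℝ} (hγ : -1 < γ) (hl : 0 < l) (e : ℝ) :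
    antiderivInv (powerLaw γ) (e / l) =
      costWeight γ l * (costExponent γ * signedRPow (costExponent γ - 1) e) := by
  have h1 : 0 < 1 + γ := by linarith
  have h2 : 0 < 2 + γ := by linarith
  rw [antiderivInv_powerLaw hγ, show (1 + γ) * (e / l) = ((1 + γ) * l⁻¹) * e by ring,
    signedRPow_mul (by positivity), costWeight, Real.mul_rpow h1.le (by positivity),
    Real.rpow_sub_one h1.ne', Real.inv_rpow hl.le, ← Real.rpow_neg hl.le, neg_sub]
  have : costExponent γ * (1 + γ) = 2 + γ := by
    rw [costExponent]; field_simp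
  field_simp
  linear_combination (-signedRPow (costExponent γ - 1) e) * this

/-! ### Dyadic grids -/

/-- The grid points `k T / 2^n` of `[0, T]`. -/
noncomputable def grid (T : ℝ≥0) (n k : ℕ) : ℝ≥0 := T * k / 2 ^ n

/-- The index `k` with `t ∈ [k T / 2^n, (k + 1) T / 2^n)`. -/
noncomputable def gridIndex (T : ℝ≥0) (n : ℕ) (t : ℝ≥0) : ℕ := ⌊t * 2 ^ n / T⌋₊

theorem grid_zero (T : ℝ≥0) (n : ℕ) : grid T n 0 = 0 := by simp [grid]

theorem grid_last (T : ℝ≥0) (n : ℕ) : grid T n (2 ^ n) = T := by simp [grid]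

theorem grid_mono (T : ℝ≥0) (n : ℕ) : Monotone (grid T n) := by
  intro i j hij
  unfold grid
  gcongr

theorem grid_le {T : ℝ≥0} {n k : ℕ} (hk : k ≤ 2 ^ n) : grid T n k ≤ T := by
  simpa [grid_last] using grid_mono T n hk

theorem gridIndex_eq_iff {T : ℝ≥0} (hT : 0 < T) (n k : ℕ) (t : ℝ≥0) :
    gridIndex T n t = k ↔ t ∈ Ico (grid T n k) (grid T n (k + 1)) := by
  have h2 : (0 : ℝ≥0) < 2 ^ n := by positivity
  rw [gridIndex, Nat.floor_eq_iff (by positivity), mem_Ico, grid, grid, le_div_iff₀ hT,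
    div_lt_iff₀ hT, div_le_iff₀ h2, lt_div_iff₀ h2]
  push_cast
  rw [mul_comm (k : ℝ≥0) T, mul_comm T ((k : ℝ≥0) + 1)]

theorem mem_Ico_grid_gridIndex {T : ℝ≥0} (hT : 0 < T) (n : ℕ) (t : ℝ≥0) :
    t ∈ Ico (grid T n (gridIndex T n t)) (grid T n (gridIndex T n t + 1)) :=
  (gridIndex_eq_iff hT n _ t).1 rfl

theorem gridIndex_lt {T : ℝ≥0} (hT : 0 < T) (n : ℕ) {t : ℝ≥0} (ht : t < T) :
    gridIndex T n t < 2 ^ n := by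
  by_contra h
  have h1 := (mem_Ico_grid_gridIndex hT n t).1
  have h2 := grid_mono T n (not_lt.1 h)
  rw [grid_last] at h2
  exact absurd (h2.trans h1) (not_le.2 ht)

theorem grid_succ (T : ℝ≥0) (n k : ℕ) : grid T n (k + 1) = grid T n k + T / 2 ^ n := by
  simp only [grid]; push_cast; ring

theorem tendsto_div_two_pow (T : ℝ≥0) : Tendsto (fun n : ℕ => T / 2 ^ n) atTop (𝓝 0) := by
  have h := (tendsto_pow_atTop_nhds_zero_of_lt_one (r := (2⁻¹ : ℝ≥0)) zero_le
    (by rw [← NNReal.coe_lt_coe]; push_cast; norm_num)).const_mul T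
  simpa [div_eq_mul_inv] using h

/-- Left end points of cells may equal t, which is harmless for left-continuous functions. Right end
points, treated next, lie strictly to the right of t because cells are closed on the left, so they
see the jump at t. -/
theorem tendsto_grid_gridIndex {T : ℝ≥0} (hT : 0 < T) (t : ℝ≥0) :
    Tendsto (fun n => grid T n (gridIndex T n t)) atTop (𝓝[≤] t) := by
  refine tendsto_nhdsWithin_iff.2 ⟨?_, Eventually.of_forall fun n =>
    (mem_Ico_grid_gridIndex hT n t).1⟩
  have h : Tendsto (fun n : ℕ => t - T / 2 ^ n) atTop (𝓝 (t - 0)) :=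
    (tendsto_const_nhds).sub (tendsto_div_two_pow T)
  rw [tsub_zero] at h
  refine tendsto_of_tendsto_of_tendsto_of_le_of_le h tendsto_const_nhds (fun n => ?_)
    fun n => (mem_Ico_grid_gridIndex hT n t).1
  have := (mem_Ico_grid_gridIndex hT n t).2
  rw [grid_succ] at this
  exact tsub_le_iff_right.2 this.le

theorem tendsto_grid_gridIndex_succ {T : ℝ≥0} (hT : 0 < T) (t : ℝ≥0) :
    Tendsto (fun n => grid T n (gridIndex T n t + 1)) atTop (𝓝[>] t) := by
  refine tendsto_nhdsWithin_iff.2 ⟨?_, Eventually.of_forall fun n =>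
    (mem_Ico_grid_gridIndex hT n t).2⟩
  have h : Tendsto (fun n : ℕ => t + T / 2 ^ n) atTop (𝓝 (t + 0)) :=
    (tendsto_const_nhds).add (tendsto_div_two_pow T)
  rw [add_zero] at h
  refine tendsto_of_tendsto_of_tendsto_of_le_of_le tendsto_const_nhds h
    (fun n => (mem_Ico_grid_gridIndex hT n t).2.le) fun n => ?_
  simp only [grid_succ]
  gcongr
  exact (mem_Ico_grid_gridIndex hT n t).1

theorem measurable_gridIndex (T : ℝ≥0) (n : ℕ) : Measurable (gridIndex T n) :=
  Nat.measurable_floor.comp ((measurable_id.mul_const _).div_const _)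

theorem Ico_eq_biUnion_grid {T : ℝ≥0} (hT : 0 < T) (n : ℕ) :
    Ico 0 T = ⋃ k ∈ Finset.range (2 ^ n), Ico (grid T n k) (grid T n (k + 1)) := by
  ext t
  simp only [mem_iUnion, Finset.mem_range, exists_prop]
  constructor
  · exact fun ht => ⟨_, gridIndex_lt hT n ht.2, mem_Ico_grid_gridIndex hT n t⟩
  · rintro ⟨k, hk, ht⟩
    exact ⟨zero_le, ht.2.trans_le (grid_le hk)⟩

/-! ### The measure of a left-continuous path of bounded variation -/

section PathMeasure

variable {x : ℝ≥0 → ℝ}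

instance (μ : SignedMeasure ℝ≥0) : IsFiniteMeasure μ.variation := by
  rw [← SignedMeasure.totalVariation_eq_variation]
  unfold SignedMeasure.totalVariation
  infer_instance

theorem leftLim_eq_of_leftContinuous (hl : ∀ t, ContinuousWithinAt x (Iic t) t) (t : ℝ≥0) :
    Function.leftLim x t = x t := by
  rcases eq_or_ne t 0 with rfl | ht
  · exact leftLim_eq_of_isBot (fun a => zero_le)
  · exact (hl t).leftLim_eq

theorem pathMeasure_Ico (hx : BoundedVariationOn x univ)
    (hl : ∀ t, ContinuousWithinAt x (Iic t) t) {a b : ℝ≥0} (hab : a ≤ b) :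
    pathMeasure x (Ico a b) = x b - x a := by
  rw [pathMeasure, dif_pos hx, hx.vectorMeasure_Ico hab, leftLim_eq_of_leftContinuous hl,
    leftLim_eq_of_leftContinuous hl]

theorem pathMeasure_singleton (hx : BoundedVariationOn x univ)
    (hl : ∀ t, ContinuousWithinAt x (Iic t) t) (a : ℝ≥0) :
    pathMeasure x {a} = jump x a := by
  rw [pathMeasure, dif_pos hx, hx.vectorMeasure_singleton, leftLim_eq_of_leftContinuous hl, jump]

/-- Cells [a, b) match left-continuity: the mass of such a cell is exactly x b - x a, with the jump
at a included and the one at b left to the next cell. -/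
theorem setIntegral_gridIndex (hx : BoundedVariationOn x univ)
    (hl : ∀ t, ContinuousWithinAt x (Iic t) t) {T : ℝ≥0} (hT : 0 < T) (n : ℕ) (a : ℕ → ℝ) :
    ∫ᵛ t in Ico 0 T, a (gridIndex T n t) ∂•(pathMeasure x) =
      ∑ k ∈ Finset.range (2 ^ n), a k * (x (grid T n (k + 1)) - x (grid T n k)) := by
  have hcongr : ∀ k, EqOn (fun t => a (gridIndex T n t)) (fun _ => a k)
      (Ico (grid T n k) (grid T n (k + 1))) := fun k t ht => by
    simp only [(gridIndex_eq_iff hT n k t).2 ht]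
  rw [Ico_eq_biUnion_grid hT n, VectorMeasure.setIntegral_biUnion_finset]
  · refine Finset.sum_congr rfl fun k _ => ?_
    rw [VectorMeasure.setIntegral_congr_fun (hcongr k), VectorMeasure.setIntegral_const,
      pathMeasure_Ico hx hl (grid_mono T n k.le_succ)]
    simp
  · exact fun _ _ => measurableSet_Ico
  · intro i _ j _ hij
    refine Set.disjoint_left.2 fun t hi hj => hij ?_
    rw [← (gridIndex_eq_iff hT n i t).2 hi, (gridIndex_eq_iff hT n j t).2 hj]
  · intro k _
    rw [VectorMeasure.IntegrableOn, VectorMeasure.Integrable,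
      VectorMeasure.variation_restrict measurableSet_Ico]
    exact (integrableOn_congr_fun (hcongr k) measurableSet_Ico).2 (integrableOn_const (by simp))

/-- Dominated convergence for the finite variation measure. The limit must be identified at every t
< T, since the measure may charge points. -/
theorem tendsto_sum_grid (hx : BoundedVariationOn x univ)
    (hl : ∀ t, ContinuousWithinAt x (Iic t) t) {T : ℝ≥0} (hT : 0 < T) {a : ℕ → ℕ → ℝ} {C : ℝ}
    (hC : ∀ n, ∀ k < 2 ^ n, |a n k| ≤ C) {g : ℝ≥0 → ℝ}
    (hg : ∀ t < T, Tendsto (fun n => a n (gridIndex T n t)) atTop (𝓝 (g t))) :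
    Tendsto (fun n => ∑ k ∈ Finset.range (2 ^ n),
      a n k * (x (grid T n (k + 1)) - x (grid T n k))) atTop
      (𝓝 (∫ᵛ t in Ico 0 T, g t ∂•(pathMeasure x))) := by
  simp_rw [← setIntegral_gridIndex hx hl hT]
  refine VectorMeasure.tendsto_integral_of_dominated_convergence (fun _ => C) (fun n => ?_)
    (integrable_const C) (fun n => ?_) ?_
  · exact ((measurable_from_nat).comp (measurable_gridIndex T n)).aestronglyMeasurable
  all_goals
    rw [VectorMeasure.variation_restrict measurableSet_Ico]
    refine (ae_restrict_iff' measurableSet_Ico).2 (Eventually.of_forall fun t ht => ?_)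
  · exact hC n _ (gridIndex_lt hT n ht.2)
  · exact hg t ht.2

theorem tendsto_sum_grid_intervalIntegral {T : ℝ≥0} (hT : 0 < T) {a : ℕ → ℕ → ℝ} {C : ℝ}
    (hC : ∀ n, ∀ k < 2 ^ n, |a n k| ≤ C) {g : ℝ → ℝ} {φ : ℝ → ℝ}
    (hφ : IntervalIntegrable φ volume 0 T)
    (hg : ∀ᵐ t : ℝ, t ∈ Ioo 0 (T : ℝ) →
      Tendsto (fun n => a n (gridIndex T n t.toNNReal)) atTop (𝓝 (g t))) :
    Tendsto (fun n => ∑ k ∈ Finset.range (2 ^ n),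
      a n k * ∫ s in (grid T n k : ℝ)..(grid T n (k + 1)), φ s) atTop
      (𝓝 (∫ t in (0 : ℝ)..T, g t * φ t)) := by
  have hsub : ∀ n k, k < 2 ^ n → Ioc (grid T n k : ℝ) (grid T n (k + 1)) ⊆ Ioc 0 (T : ℝ) := by
    intro n k hk
    refine Ioc_subset_Ioc (NNReal.coe_nonneg _) (NNReal.coe_le_coe.2 (grid_le hk))
  -- Interval integrals use cells open on the left, `gridIndex` uses cells closed on the left; they
  -- differ only at grid points, a null set.
  have hae : ∀ᵐ t : ℝ, ∀ n k, t ≠ grid T n k := by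
    rw [ae_all_iff]; intro n; rw [ae_all_iff]; intro k
    simp [ae_iff, measure_singleton]
  have heq : ∀ n, ∑ k ∈ Finset.range (2 ^ n),
      a n k * ∫ s in (grid T n k : ℝ)..(grid T n (k + 1)), φ s =
      ∫ t in (0 : ℝ)..T, a n (gridIndex T n t.toNNReal) * φ t := by
    intro n
    have hcongr : ∀ k, ∀ᵐ s : ℝ, s ∈ uIoc (grid T n k : ℝ) (grid T n (k + 1)) →
        a n k * φ s = a n (gridIndex T n s.toNNReal) * φ s := by
      intro k
      filter_upwards [hae] with s hs hmem
      rw [uIoc_of_le (NNReal.coe_le_coe.2 (grid_mono T n k.le_succ))] at hmem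
      have : gridIndex T n s.toNNReal = k := by
        refine (gridIndex_eq_iff hT n k _).2 ⟨?_, ?_⟩
        · exact NNReal.le_toNNReal_of_coe_le hmem.1.le
        · rw [← NNReal.coe_lt_coe, Real.coe_toNNReal _ ((NNReal.coe_nonneg _).trans hmem.1.le)]
          exact lt_of_le_of_ne hmem.2 (hs n (k + 1))
      rw [this]
    have hint : ∀ k < 2 ^ n, IntervalIntegrable
        (fun s => a n (gridIndex T n s.toNNReal) * φ s) volume (grid T n k)
        (grid T n (k + 1)) := by
      intro k hk
      have h1 : IntervalIntegrable (fun s => a n k * φ s) volume (grid T n k)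
          (grid T n (k + 1)) := by
        refine (hφ.mono_set' ?_).const_mul _
        rw [uIoc_of_le (NNReal.coe_le_coe.2 (grid_mono T n k.le_succ)),
          uIoc_of_le T.coe_nonneg]
        exact hsub n k hk
      exact h1.congr_ae ((ae_restrict_iff' measurableSet_uIoc).2 (hcongr k))
    have := intervalIntegral.sum_integral_adjacent_intervals (n := 2 ^ n)
      (a := fun k => (grid T n k : ℝ)) hint
    rw [grid_last, grid_zero, NNReal.coe_zero] at this
    rw [← this]
    refine Finset.sum_congr rfl fun k _ => ?_
    rw [← intervalIntegral.integral_const_mul]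
    exact intervalIntegral.integral_congr_ae (hcongr k)
  simp_rw [heq]
  refine intervalIntegral.tendsto_integral_filter_of_dominated_convergence (fun t => C * |φ t|)
    (Eventually.of_forall fun n => ?_) (Eventually.of_forall fun n => ?_) (hφ.abs.const_mul C) ?_
  · refine AEStronglyMeasurable.mul ?_ hφ.aestronglyMeasurable_restrict_uIoc
    exact ((measurable_from_nat (f := a n)).comp ((measurable_gridIndex T n).comp
      measurable_real_toNNReal)).aestronglyMeasurable
  · have : ∀ᵐ t : ℝ, t ≠ T := by simp [ae_iff, measure_singleton]
    filter_upwards [this] with t htT ht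
    rw [uIoc_of_le T.coe_nonneg] at ht
    rw [norm_mul, Real.norm_eq_abs, Real.norm_eq_abs]
    gcongr
    refine hC n _ (gridIndex_lt hT n ?_)
    rw [← NNReal.coe_lt_coe, Real.coe_toNNReal _ ht.1.le]
    exact lt_of_le_of_ne ht.2 htT
  · have : ∀ᵐ t : ℝ, t ≠ T := by simp [ae_iff, measure_singleton]
    filter_upwards [this, hg] with t htT hgt ht
    rw [uIoc_of_le T.coe_nonneg] at ht
    exact (hgt ⟨ht.1, lt_of_le_of_ne ht.2 htT⟩).mul_const _

end PathMeasure

/-! ### Paths of bounded variation -/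

/-- A left-continuous path of bounded variation from `q` that vanishes after `T`. -/
structure IsLiquidationPath (T : ℝ≥0) (q : ℝ) (x : ℝ≥0 → ℝ) : Prop where
  boundedVariation : BoundedVariationOn x univ
  leftContinuous : ∀ t, ContinuousWithinAt x (Iic t) t
  initial : x 0 = q
  terminal : ∀ t, T < t → x t = 0

section Path

variable {x : ℝ≥0 → ℝ}

theorem measurable_of_boundedVariationOn (hx : BoundedVariationOn x univ) : Measurable x := by
  obtain ⟨p, q, hp, hq, rfl⟩ := hx.locallyBoundedVariationOn.exists_monotoneOn_sub_monotoneOn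
  exact (monotoneOn_univ.1 hp).measurable.sub (monotoneOn_univ.1 hq).measurable

theorem measurable_jump (hx : BoundedVariationOn x univ) : Measurable (jump x) :=
  (measurable_of_boundedVariationOn hx.rightLim).sub (measurable_of_boundedVariationOn hx)

theorem tendsto_right_jump (hx : BoundedVariationOn x univ) (t : ℝ≥0) :
    Tendsto x (𝓝[>] t) (𝓝 (x t + jump x t)) := by
  rw [jump, add_sub_cancel]
  exact hx.tendsto_rightLim t

theorem countable_jump (hx : BoundedVariationOn x univ) : {t | jump x t ≠ 0}.Countable := by
  obtain ⟨p, q, hp, hq, hpq⟩ := hx.locallyBoundedVariationOn.exists_monotoneOn_sub_monotoneOn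
  refine ((monotoneOn_univ.1 hp).countable_not_continuousAt.union
    (monotoneOn_univ.1 hq).countable_not_continuousAt).mono fun t ht => ?_
  by_contra h
  simp only [mem_union, mem_ofPred_eq, not_or, not_not] at h
  have hc : ContinuousAt x t := by rw [hpq]; exact h.1.sub h.2
  have : Tendsto x (𝓝[>] t) (𝓝 (x t)) := hc.mono_left nhdsWithin_le_nhds
  have := tendsto_nhds_unique this (tendsto_right_jump hx t)
  exact ht (by linarith)

theorem IsLiquidationPath.jump_last {T : ℝ≥0} {q : ℝ} (hx : IsLiquidationPath T q x) :
    x T + jump x T = 0 := by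
  refine tendsto_nhds_unique (tendsto_right_jump hx.boundedVariation T) ?_
  refine tendsto_const_nhds.congr' ?_
  filter_upwards [self_mem_nhdsWithin] with t ht using (hx.terminal t ht).symm

theorem abs_sub_le_of_eVariationOn_le {M : ℝ≥0} (h : eVariationOn x univ ≤ M) (s t : ℝ≥0) :
    |x s - x t| ≤ M := by
  have := (eVariationOn.edist_le x (mem_univ s) (mem_univ t)).trans h
  rw [edist_dist, Real.dist_eq] at this
  exact Real.toNNReal_le_iff_le_coe.1 (ENNReal.coe_le_coe.1 this)

end Path

/-! ### The volume impact -/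

/-- The integrated resilience `∫₀^t ρ`. -/
noncomputable def cumRate (ρ : ℝ → ℝ) (t : ℝ) : ℝ := ∫ s in (0 : ℝ)..t, ρ s

section Impact

variable {ρ : ℝ → ℝ} {x : ℝ≥0 → ℝ}

theorem hasDerivAt_cumRate (hρ : Continuous ρ) (t : ℝ) : HasDerivAt (cumRate ρ) (ρ t) t :=
  hρ.integral_hasStrictDerivAt 0 t |>.hasDerivAt

theorem continuous_cumRate (hρ : Continuous ρ) : Continuous (cumRate ρ) :=
  continuous_iff_continuousAt.2 fun t => (hasDerivAt_cumRate hρ t).continuousAt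

theorem integral_eq_cumRate_sub (hρ : Continuous ρ) (a b : ℝ) :
    ∫ s in a..b, ρ s = cumRate ρ b - cumRate ρ a :=
  (intervalIntegral.integral_interval_sub_left (hρ.intervalIntegrable _ _)
    (hρ.intervalIntegrable _ _)).symm

theorem volumeImpact_eq_exp (hρ : Continuous ρ) (x : ℝ≥0 → ℝ) (t : ℝ≥0) :
    volumeImpact ρ x t = (x t - x 0) - Real.exp (-cumRate ρ t) *
      ∫ s in (0 : ℝ)..t, ρ s * Real.exp (cumRate ρ s) * (x s.toNNReal - x 0) := by
  rw [volumeImpact, ← intervalIntegral.integral_const_mul]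
  congr 1
  refine intervalIntegral.integral_congr fun s _ => ?_
  simp only [integral_eq_cumRate_sub hρ]
  rw [show -(cumRate ρ t - cumRate ρ s) = -cumRate ρ t + cumRate ρ s by ring, Real.exp_add]
  ring

/-- The impact differs from the path by a continuous function, so it inherits measurability,
left-continuity and exactly the jumps of the path. -/
theorem exists_continuous_volumeImpact (hρ : Continuous ρ) (hx : BoundedVariationOn x univ) :
    ∃ φ : ℝ≥0 → ℝ, Continuous φ ∧ ∀ t, volumeImpact ρ x t = x t - x 0 - φ t := by
  refine ⟨fun t => Real.exp (-cumRate ρ t) *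
      ∫ s in (0 : ℝ)..t, ρ s * Real.exp (cumRate ρ s) * (x s.toNNReal - x 0), ?_,
    fun t => volumeImpact_eq_exp hρ x t⟩
  have h1 : Continuous fun t : ℝ =>
      ∫ s in (0 : ℝ)..t, ρ s * Real.exp (cumRate ρ s) * (x s.toNNReal - x 0) := by
    refine intervalIntegral.continuous_primitive (fun a b => ?_) 0
    exact ((intervalIntegrable_path hx a b).sub intervalIntegrable_const).continuousOn_mul
      (hρ.mul (Real.continuous_exp.comp (continuous_cumRate hρ))).continuousOn
  exact (Real.continuous_exp.comp ((continuous_cumRate hρ).comp NNReal.continuous_coe).neg).mul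
    (h1.comp NNReal.continuous_coe)

theorem measurable_volumeImpact (hρ : Continuous ρ) (hx : BoundedVariationOn x univ) :
    Measurable (volumeImpact ρ x) := by
  obtain ⟨φ, hφ, h⟩ := exists_continuous_volumeImpact hρ hx
  rw [funext h]
  exact ((measurable_of_boundedVariationOn hx).sub_const _).sub hφ.measurable

theorem leftContinuous_volumeImpact (hρ : Continuous ρ) (hx : BoundedVariationOn x univ)
    (hl : ∀ t, ContinuousWithinAt x (Iic t) t) (t : ℝ≥0) :
    ContinuousWithinAt (volumeImpact ρ x) (Iic t) t := by
  obtain ⟨φ, hφ, h⟩ := exists_continuous_volumeImpact hρ hx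
  rw [funext h]
  exact ((hl t).sub continuousWithinAt_const).sub hφ.continuousWithinAt

theorem tendsto_right_volumeImpact (hρ : Continuous ρ) (hx : BoundedVariationOn x univ)
    (t : ℝ≥0) :
    Tendsto (volumeImpact ρ x) (𝓝[>] t) (𝓝 (volumeImpact ρ x t + jump x t)) := by
  obtain ⟨φ, hφ, h⟩ := exists_continuous_volumeImpact hρ hx
  rw [funext h]
  have := ((tendsto_right_jump hx t).sub_const (x 0)).sub
    (hφ.continuousAt.mono_left (nhdsWithin_le_nhds (a := t) (s := Ioi t)))
  convert this using 2
  ring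

theorem volumeImpact_zero (ρ : ℝ → ℝ) (x : ℝ≥0 → ℝ) : volumeImpact ρ x 0 = 0 := by
  simp [volumeImpact]

/-- The bound depends on the path only through its variation. It is therefore uniform over almost
all paths of a strategy, which later gives integrability. -/
theorem abs_volumeImpact_le (hρ : Continuous ρ) (hρ0 : ∀ t, 0 ≤ ρ t) {M : ℝ≥0}
    (hM : eVariationOn x univ ≤ M) {t T : ℝ≥0} (ht : t ≤ T) :
    |volumeImpact ρ x t| ≤ M * (1 + cumRate ρ T) := by
  have hmono : cumRate ρ t ≤ cumRate ρ T :=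
    monotone_of_hasDerivAt_nonneg (hasDerivAt_cumRate hρ) hρ0 (NNReal.coe_le_coe.2 ht)
  have h2 : |∫ s in (0 : ℝ)..t, ρ s * Real.exp (-∫ u in s..t, ρ u) * (x s.toNNReal - x 0)| ≤
      ∫ s in (0 : ℝ)..t, M * ρ s := by
    rw [← Real.norm_eq_abs]
    refine intervalIntegral.norm_integral_le_of_norm_le t.coe_nonneg
      (Eventually.of_forall fun s hs => ?_) ((hρ.const_mul _).intervalIntegrable _ _)
    have h3 : 0 ≤ ∫ u in s..t, ρ u := intervalIntegral.integral_nonneg hs.2 fun u _ => hρ0 u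
    have h4 : Real.exp (-∫ u in s..t, ρ u) ≤ 1 := Real.exp_le_one_iff.2 (by linarith)
    rw [norm_mul, norm_mul, Real.norm_eq_abs, Real.norm_eq_abs, Real.norm_eq_abs,
      abs_of_nonneg (hρ0 s), abs_of_pos (Real.exp_pos _)]
    have h5 := abs_sub_le_of_eVariationOn_le hM s.toNNReal 0
    calc ρ s * Real.exp (-∫ u in s..t, ρ u) * |x s.toNNReal - x 0|
        ≤ ρ s * 1 * M := by gcongr; exact mul_nonneg (hρ0 s) zero_le_one; exact hρ0 s
      _ = M * ρ s := by ring
  rw [intervalIntegral.integral_const_mul] at h2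
  have h1 := abs_sub_le_of_eVariationOn_le hM t 0
  rw [volumeImpact]
  refine (abs_sub _ _).trans ?_
  have h6 : (M : ℝ) * (∫ s in (0 : ℝ)..t, ρ s) ≤ M * cumRate ρ T :=
    mul_le_mul_of_nonneg_left hmono M.coe_nonneg
  linarith

theorem exists_eVariationOn_le (hx : BoundedVariationOn x univ) :
    ∃ M : ℝ≥0, eVariationOn x univ ≤ M :=
  ⟨(eVariationOn x univ).toNNReal, (ENNReal.coe_toNNReal hx).ge⟩

theorem intervalIntegrable_comp_volumeImpact (hρ : Continuous ρ) (hρ0 : ∀ t, 0 ≤ ρ t)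
    (hx : BoundedVariationOn x univ) {f : ℝ → ℝ} (hf : Continuous f) (a b : ℝ) :
    IntervalIntegrable (fun s => f (volumeImpact ρ x s.toNNReal)) volume a b := by
  obtain ⟨M, hM⟩ := exists_eVariationOn_le hx
  set T := (max a b).toNNReal
  obtain ⟨C, hC⟩ := (isCompact_Icc (a := -(M * (1 + cumRate ρ T)))
    (b := M * (1 + cumRate ρ T))).exists_bound_of_continuousOn hf.continuousOn
  rw [intervalIntegrable_iff]
  refine Measure.integrableOn_of_bounded (M := C) (by simp) ?_ ?_
  · exact (hf.measurable.comp ((measurable_volumeImpact hρ hx).comp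
      measurable_real_toNNReal)).aestronglyMeasurable
  · refine (ae_restrict_iff' measurableSet_uIoc).2 (Eventually.of_forall fun s hs => ?_)
    refine hC _ (abs_le.1 (abs_volumeImpact_le hρ hρ0 hM ?_))
    exact Real.toNNReal_le_toNNReal hs.2

end Impact

/-! ### The chain rule -/

/-- The mean of `h` over the segment from `a` to `b`. -/
noncomputable def segmentMean (h : ℝ → ℝ) (a b : ℝ) : ℝ := ∫ θ in (0 : ℝ)..1, h (a + θ * (b - a))

theorem segmentMean_self (h : ℝ → ℝ) (a : ℝ) : segmentMean h a a = h a := by simp [segmentMean]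

theorem continuous_segmentMean {h : ℝ → ℝ} (hh : Continuous h) :
    Continuous fun z : ℝ × ℝ => segmentMean h z.1 z.2 := by
  unfold segmentMean
  exact intervalIntegral.continuous_parametric_intervalIntegral_of_continuous' (by fun_prop) 0 1

/-- Using the mean of h over a segment treats jumps and continuous motion alike: increments of H are
the mean times the increment of the argument, and without a jump the mean is just h. -/
theorem segmentMean_mul {H h : ℝ → ℝ} (hH : ∀ x, HasDerivAt H (h x) x) (hh : Continuous h)
    (a b : ℝ) : segmentMean h a b * (b - a) = H b - H a := by
  have h1 : ∀ θ : ℝ, HasDerivAt (fun θ => H (a + θ * (b - a))) (h (a + θ * (b - a)) * (b - a)) θ := by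
    intro θ
    refine (hH _).comp θ ?_
    simpa using ((hasDerivAt_id θ).mul_const (b - a)).const_add a
  have h2 := intervalIntegral.integral_eq_sub_of_hasDerivAt (a := 0) (b := 1) (fun θ _ => h1 θ)
    (by apply Continuous.intervalIntegrable; fun_prop)
  rw [intervalIntegral.integral_mul_const] at h2
  simpa [segmentMean] using h2

section ChainRule

variable {ρ : ℝ → ℝ} {x : ℝ≥0 → ℝ} {H h w w' : ℝ → ℝ} {T : ℝ≥0}

theorem exists_bound_segmentMean (hh : Continuous h) (C : ℝ) :
    ∃ B, ∀ a b : ℝ, |a| ≤ C → |b| ≤ C → |segmentMean h a b| ≤ B := by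
  obtain ⟨B, hB⟩ := ((isCompact_Icc (a := -C) (b := C)).prod
    (isCompact_Icc (a := -C) (b := C))).exists_bound_of_continuousOn
    (continuous_segmentMean hh).continuousOn
  exact ⟨B, fun a b ha hb => hB (a, b) ⟨abs_le.1 ha, abs_le.1 hb⟩⟩

/-- Chain rule for w H(E) along a path with jumps. On each dyadic grid it is an exact telescoping
identity, and each sum converges by dominated convergence. The value at T is that before the jump at
T. -/
theorem integral_segmentMean_Ico (hρ : Continuous ρ) (hρ0 : ∀ t, 0 ≤ ρ t)
    (hx : BoundedVariationOn x univ) (hl : ∀ t, ContinuousWithinAt x (Iic t) t) (hT : 0 < T)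
    (hH : ∀ x, HasDerivAt H (h x) x) (hh : Continuous h) (hH0 : H 0 = 0)
    (hw : Continuous w) (hw' : Continuous w') (hww' : ∀ t, 0 < t → HasDerivAt w (w' t) t) :
    ∫ᵛ t in Ico 0 T, w t * segmentMean h (volumeImpact ρ x t) (volumeImpact ρ x t + jump x t)
        ∂•(pathMeasure x) =
      w T * H (volumeImpact ρ x T) +
        ∫ s in (0 : ℝ)..T, (w s * ρ s * (volumeImpact ρ x s.toNNReal *
          h (volumeImpact ρ x s.toNNReal)) - w' s * H (volumeImpact ρ x s.toNNReal)) := by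
  set E := volumeImpact ρ x with hE
  have hHc : Continuous H := continuous_iff_continuousAt.2 fun t => (hH t).continuousAt
  obtain ⟨M, hM⟩ := exists_eVariationOn_le hx
  have hEb : ∀ t ≤ T, |E t| ≤ M * (1 + cumRate ρ T) := fun t ht =>
    abs_volumeImpact_le hρ hρ0 hM ht
  set C := M * (1 + cumRate ρ T)
  obtain ⟨B, hB⟩ := exists_bound_segmentMean hh C
  obtain ⟨BH, hBH⟩ := (isCompact_Icc (a := -C) (b := C)).exists_bound_of_continuousOn
    hHc.continuousOn
  obtain ⟨Bw, hBw⟩ := (isCompact_Icc (a := (0 : ℝ)) (b := T)).exists_bound_of_continuousOn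
    hw.continuousOn
  have hBw0 : 0 ≤ Bw := (norm_nonneg _).trans (hBw 0 ⟨le_rfl, T.coe_nonneg⟩)
  have hρE : ∀ a b : ℝ,
      IntervalIntegrable (fun s : ℝ => ρ s * E s.toNNReal) volume a b := fun a b =>
    (intervalIntegrable_comp_volumeImpact hρ hρ0 hx continuous_id a b).continuousOn_mul
      hρ.continuousOn
  have hL : ∀ t, Tendsto (fun n => E (grid T n (gridIndex T n t))) atTop (𝓝 (E t)) := fun t =>
    (leftContinuous_volumeImpact hρ hx hl t).tendsto.comp (tendsto_grid_gridIndex hT t)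
  have hR : ∀ t, Tendsto (fun n => E (grid T n (gridIndex T n t + 1))) atTop
      (𝓝 (E t + jump x t)) := fun t =>
    (tendsto_right_volumeImpact hρ hx t).comp (tendsto_grid_gridIndex_succ hT t)
  have hW : ∀ t : ℝ≥0, Tendsto (fun n => w (grid T n (gridIndex T n t))) atTop (𝓝 (w t)) := fun t =>
    ((hw.comp NNReal.continuous_coe).continuousAt (x := t)).tendsto.comp
      ((tendsto_grid_gridIndex hT t).mono_right nhdsWithin_le_nhds)
  set a : ℕ → ℕ → ℝ := fun n k =>
    w (grid T n k) * segmentMean h (E (grid T n k)) (E (grid T n (k + 1))) with ha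
  have haC : ∀ n, ∀ k < 2 ^ n, |a n k| ≤ Bw * B := by
    intro n k hk
    rw [ha, abs_mul]
    have h1 := hBw (grid T n k) ⟨NNReal.coe_nonneg _, NNReal.coe_le_coe.2 (grid_le hk.le)⟩
    have h2 := hB _ _ (hEb _ (grid_le hk.le)) (hEb _ (grid_le (Nat.succ_le_of_lt hk)))
    exact mul_le_mul h1 h2 (abs_nonneg _) hBw0
  have hlim : ∀ t, Tendsto (fun n => a n (gridIndex T n t)) atTop
      (𝓝 (w t * segmentMean h (E t) (E t + jump x t))) := fun t =>
    (hW t).mul (((continuous_segmentMean hh).tendsto (E t, E t + jump x t)).comp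
      ((hL t).prodMk_nhds (hR t)))
  -- For the two Lebesgue integrals the countably many jumps are negligible, so there the mean
  -- collapses to h(E) and the right limit to H(E).
  have hnojump : ∀ᵐ t : ℝ, t ∈ Ioo 0 (T : ℝ) → jump x t.toNNReal = 0 := by
    have h1 : ((fun t : ℝ≥0 => (t : ℝ)) '' {t | jump x t ≠ 0}).Countable :=
      (countable_jump hx).image _
    filter_upwards [h1.ae_notMem volume] with t ht hmem
    by_contra hj
    exact ht ⟨t.toNNReal, hj, Real.coe_toNNReal t hmem.1.le⟩
  have lim1 := tendsto_sum_grid hx hl hT haC fun t _ => hlim t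
  have lim2 := tendsto_sum_grid_intervalIntegral (a := a) hT haC (φ := fun s => ρ s * E s.toNNReal)
    (g := fun s => w s * h (E s.toNNReal)) (hρE 0 T) (by
      filter_upwards [hnojump] with t ht hmem
      have := hlim t.toNNReal
      rwa [ht hmem, add_zero, segmentMean_self, Real.coe_toNNReal t hmem.1.le] at this)
  have lim3 := tendsto_sum_grid_intervalIntegral (a := fun n k => H (E (grid T n (k + 1)))) hT
    (C := BH) (fun n k hk => hBH _ (abs_le.1 (hEb _ (grid_le (Nat.succ_le_of_lt hk)))))
    (φ := w') (g := fun s => H (E s.toNNReal)) (hw'.intervalIntegrable _ _) (by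
      filter_upwards [hnojump] with t ht hmem
      have := (hHc.tendsto _).comp (hR t.toNNReal)
      rwa [ht hmem, add_zero] at this)
  -- Discrete product rule: the increment of H(E) is weighted by w at the left end point and the
  -- increment of w by H(E) at the right end point, so no error term appears.
  have key : ∀ n, (∑ k ∈ Finset.range (2 ^ n), a n k * (x (grid T n (k + 1)) - x (grid T n k))) -
      (∑ k ∈ Finset.range (2 ^ n), a n k *
        ∫ s in (grid T n k : ℝ)..(grid T n (k + 1)), ρ s * E s.toNNReal) +
      ∑ k ∈ Finset.range (2 ^ n), H (E (grid T n (k + 1))) *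
        ∫ s in (grid T n k : ℝ)..(grid T n (k + 1)), w' s = w T * H (E T) := by
    intro n
    rw [← Finset.sum_sub_distrib, ← Finset.sum_add_distrib]
    have tele := Finset.sum_range_sub
      (fun k => w (grid T n k) * H (E (grid T n k))) (2 ^ n)
    rw [grid_last, grid_zero, hE, volumeImpact_zero, hH0, mul_zero, sub_zero] at tele
    rw [← tele]
    refine Finset.sum_congr rfl fun k _ => ?_
    have e1 : E (grid T n (k + 1)) - E (grid T n k) = (x (grid T n (k + 1)) - x (grid T n k)) -
        ∫ s in (grid T n k : ℝ)..(grid T n (k + 1)), ρ s * E s.toNNReal := by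
      have h1 := volumeImpact_eq hρ.continuousOn hx (grid T n k)
      have h2 := volumeImpact_eq hρ.continuousOn hx (grid T n (k + 1))
      rw [← intervalIntegral.integral_interval_sub_left
        (hρE 0 _) (hρE 0 _), hE, h1, h2]
      ring
    have e2 : ∫ s in (grid T n k : ℝ)..(grid T n (k + 1)), w' s =
        w (grid T n (k + 1)) - w (grid T n k) := by
      refine intervalIntegral.integral_eq_sub_of_hasDerivAt_of_le
        (NNReal.coe_le_coe.2 (grid_mono T n k.le_succ)) hw.continuousOn
        (fun s hs => hww' s ((NNReal.coe_nonneg _).trans_lt hs.1)) (hw'.intervalIntegrable _ _)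
    have e3 := segmentMean_mul hH hh (E (grid T n k)) (E (grid T n (k + 1)))
    rw [e2]
    simp only [ha]
    linear_combination w (grid T n k) * e3 - w (grid T n k) *
      segmentMean h (E (grid T n k)) (E (grid T n (k + 1))) * e1
  have lim := (lim1.sub lim2).add lim3
  simp_rw [key] at lim
  have hconst := tendsto_nhds_unique tendsto_const_nhds lim
  have i1 : IntervalIntegrable (fun s : ℝ => w s * h (E s.toNNReal) * (ρ s * E s.toNNReal))
      volume 0 T := by
    have := (intervalIntegrable_comp_volumeImpact hρ hρ0 hx (f := fun e => h e * e)
      (hh.mul continuous_id) 0 T).continuousOn_mul (hw.mul hρ).continuousOn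
    refine this.congr fun s _ => ?_
    simp only [Pi.mul_apply, hE]; ring
  have i2 : IntervalIntegrable (fun s : ℝ => H (E s.toNNReal) * w' s) volume 0 T :=
    (intervalIntegrable_comp_volumeImpact hρ hρ0 hx hHc 0 T).mul_continuousOn
      hw'.continuousOn
  have e4 : ∫ s in (0 : ℝ)..T, (w s * ρ s * (E s.toNNReal * h (E s.toNNReal)) -
      w' s * H (E s.toNNReal)) =
      (∫ s in (0 : ℝ)..T, w s * h (E s.toNNReal) * (ρ s * E s.toNNReal)) -
        ∫ s in (0 : ℝ)..T, H (E s.toNNReal) * w' s := by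
    rw [← intervalIntegral.integral_sub i1 i2]
    refine intervalIntegral.integral_congr fun s _ => ?_
    ring
  rw [e4]
  linarith

end ChainRule

/-! ### Integrals carried by atoms -/

theorem hasSum_mul_real_singleton {m : Measure ℝ≥0} {f : ℝ≥0 → ℝ} (hf : Integrable f m)
    {A : Set ℝ≥0} (hA : A.Countable) (h0 : ∀ t ∉ A, f t = 0) :
    HasSum (fun a : A => f a * m.real {(a : ℝ≥0)}) (∫ t, f t ∂m) := by
  have := hA.to_subtype
  have h1 := hasSum_integral_iUnion (μ := m) (f := f) (s := fun a : A => {(a : ℝ≥0)})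
    (fun a => measurableSet_singleton _)
    (fun a b hab => Set.disjoint_singleton.2 fun h => hab (Subtype.ext h)) hf.integrableOn
  rw [iUnion_of_singleton_coe, setIntegral_eq_integral_of_forall_compl_eq_zero h0] at h1
  have h2 : (fun a : A => f a * m.real {(a : ℝ≥0)}) = fun a : A => ∫ t in {(a : ℝ≥0)}, f t ∂m := by
    ext a
    rw [integral_singleton, smul_eq_mul, mul_comm]
  rwa [h2]

/-- A finite variation measure has at most countably many atoms and the integrand vanishes elsewhere
on the set. The Jordan decomposition reduces the claim to positive measures. It is used to absorb
the jump corrections of the cost into an integral. -/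
theorem setIntegral_eq_tsum_atoms (μ : SignedMeasure ℝ≥0) {s : Set ℝ≥0} (hs : MeasurableSet s)
    {f : ℝ≥0 → ℝ} (hf : IntegrableOn f s μ.variation)
    (h0 : ∀ t ∈ s, μ {t} = 0 → f t = 0) :
    ∫ᵛ t in s, f t ∂•μ = ∑' t : s, f t * μ {(t : ℝ≥0)} := by
  set g := s.indicator f with hg
  have hgi : Integrable g μ.variation := hf.integrable_indicator hs
  set A : Set ℝ≥0 := {t | 0 < μ.variation {t}} with hA
  have hAc : A.Countable := Measure.countable_meas_pos_of_disjoint_iUnion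
    (fun t => measurableSet_singleton t) (fun a b hab => Set.disjoint_singleton.2 hab)
  have hμA : ∀ t ∉ A, μ {t} = 0 := by
    intro t ht
    have h1 : μ.variation {t} = 0 := by simpa [hA] using ht
    have h2 := μ.enorm_measure_le_variation {t}
    rw [h1] at h2
    simpa using h2
  have hgA : ∀ t ∉ A, g t = 0 := by
    intro t ht
    by_cases hts : t ∈ s
    · rw [hg, indicator_of_mem hts, h0 t hts (hμA t ht)]
    · rw [hg, indicator_of_notMem hts]
  set p := μ.toJordanDecomposition.posPart with hp
  set n := μ.toJordanDecomposition.negPart with hn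
  have hvar : μ.variation = p + n := (SignedMeasure.totalVariation_eq_variation μ).symm
  have hgp : Integrable g p := hgi.mono_measure (hvar ▸ Measure.le_add_right le_rfl)
  have hgn : Integrable g n := hgi.mono_measure (hvar ▸ Measure.le_add_left le_rfl)
  have hμ : μ = p.toSignedMeasure - n.toSignedMeasure :=
    (SignedMeasure.toSignedMeasure_toJordanDecomposition μ).symm
  -- Multiplication on ℝ is commutative; the flipped pairing is the form in which the integral is
  -- split into ordinary integrals below.
  have hflip : (ContinuousLinearMap.lsmul ℝ ℝ : ℝ →L[ℝ] ℝ →L[ℝ] ℝ) =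
      (ContinuousLinearMap.lsmul ℝ ℝ).flip := by
    ext; simp
  have hint : ∫ᵛ t, g t ∂•μ = ∫ t, g t ∂p - ∫ t, g t ∂n := by
    rw [hflip]
    conv_lhs => rw [hμ]
    rw [VectorMeasure.integral_sub_vectorMeasure, VectorMeasure.integral_toSignedMeasure,
      VectorMeasure.integral_toSignedMeasure]
    · rwa [VectorMeasure.Integrable, Measure.variation_toSignedMeasure]
    · rwa [VectorMeasure.Integrable, Measure.variation_toSignedMeasure]
  have hsum : HasSum (fun a : A => g a * μ {(a : ℝ≥0)}) (∫ᵛ t, g t ∂•μ) := by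
    rw [hint]
    have h2 : (fun a : A => g a * μ {(a : ℝ≥0)}) = fun a : A =>
        g a * p.real {(a : ℝ≥0)} - g a * n.real {(a : ℝ≥0)} := by
      ext a
      rw [← mul_sub]
      congr 1
      conv_lhs => rw [hμ]
      rw [sub_apply, Measure.toSignedMeasure_apply_measurable (measurableSet_singleton _),
        Measure.toSignedMeasure_apply_measurable (measurableSet_singleton _)]
    rw [h2]
    exact (hasSum_mul_real_singleton hgp hAc hgA).sub (hasSum_mul_real_singleton hgn hAc hgA)
  rw [← VectorMeasure.integral_indicator hs, ← hg, ← hsum.tsum_eq,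
    tsum_subtype A fun t => g t * μ {t}, tsum_subtype s fun t => f t * μ {t}]
  refine tsum_congr fun t => ?_
  by_cases htA : t ∈ A <;> by_cases hts : t ∈ s <;> simp [htA, hts, hg, hμA]

/-! ### The cost of a path -/

/-- The density `p ρ w - w'` of the running cost with respect to `|E|^p dt`, for the weight
`w = costWeight γ ∘ lam`. -/
noncomputable def runningWeight (γ : ℝ) (ρ lam lam' : ℝ → ℝ) (t : ℝ) : ℝ :=
  costWeight γ (lam t) * (ρ t * (2 + γ) + lam' t / lam t) / (1 + γ)

/-- The cost of the impact of a path that liquidates `q` shares. -/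
noncomputable def impactCost (γ : ℝ) (ρ lam lam' : ℝ → ℝ) (T : ℝ≥0) (q : ℝ) (e : ℝ → ℝ) : ℝ :=
  costWeight γ (lam T) * |q + ∫ s in (0 : ℝ)..T, ρ s * e s| ^ costExponent γ +
    ∫ s in (0 : ℝ)..T, runningWeight γ ρ lam lam' s * |e s| ^ costExponent γ

/-- Coefficients extended to the whole line: positive and continuous, with `lam'` the continuous
derivative of `lam` on `(0, ∞)`. -/
structure RegularCoefficients (ρ lam lam' : ℝ → ℝ) : Prop where
  rate_pos : ∀ t, 0 < ρ t
  rate_continuous : Continuous ρ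
  depth_pos : ∀ t, 0 < lam t
  depth_continuous : Continuous lam
  deriv_continuous : Continuous lam'
  hasDerivAt : ∀ t, 0 < t → HasDerivAt lam (lam' t) t

section Cost

variable {γ : ℝ} {ρ lam lam' : ℝ → ℝ} {T : ℝ≥0} {q : ℝ} {x : ℝ≥0 → ℝ}

theorem continuous_costWeight (h : RegularCoefficients ρ lam lam') :
    Continuous fun t => costWeight γ (lam t) :=
  continuous_const.mul (h.depth_continuous.rpow_const fun t => Or.inl (h.depth_pos t).ne')

theorem continuous_runningWeight (h : RegularCoefficients ρ lam lam') :
    Continuous (runningWeight γ ρ lam lam') :=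
  ((continuous_costWeight h).mul ((h.rate_continuous.mul_const _).add
    (h.deriv_continuous.div h.depth_continuous fun t => (h.depth_pos t).ne'))).div_const _

theorem hasDerivAt_costWeight (hγ : -1 < γ) (h : RegularCoefficients ρ lam lam') {t : ℝ}
    (ht : 0 < t) :
    HasDerivAt (fun t => costWeight γ (lam t))
      (-(costWeight γ (lam t) * (lam' t / lam t) / (1 + γ))) t := by
  have h1 := ((h.hasDerivAt t ht).rpow_const (p := 1 - costExponent γ)
    (Or.inl (h.depth_pos t).ne')).const_mul ((1 + γ) ^ costExponent γ / (2 + γ))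
  have h2 : 1 - costExponent γ = -(1 + γ)⁻¹ := by rw [← costExponent_sub_one hγ]; ring
  have h3 : -(costWeight γ (lam t) * (lam' t / lam t) / (1 + γ)) =
      (1 + γ) ^ costExponent γ / (2 + γ) *
        (lam' t * (1 - costExponent γ) * lam t ^ (1 - costExponent γ - 1)) := by
    rw [Real.rpow_sub_one (h.depth_pos t).ne', costWeight]
    generalize lam t ^ (1 - costExponent γ) = y
    rw [h2]
    field_simp
  rw [h3]
  exact h1

-- The jump corrections replace the price D by the mean Ψ of the prices met while a block trade
-- walks through the book, so the impact cost is ∫ Ψ dx. The chain rule evaluates this on [0, T),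
-- and the trade at T is added by hand; it replaces E_T by E_{T+}, which liquidation determines.
set_option maxHeartbeats 1000000 in
theorem pathCost_eq (hγ : -1 < γ) (h : RegularCoefficients ρ lam lam') (hT : 0 < T)
    (hx : IsLiquidationPath T q x) {s : ℝ≥0 → ℝ} (hs : Measurable s) {B : ℝ}
    (hB : ∀ t ≤ T, |s t| ≤ B) :
    pathCost (powerLaw γ) ρ lam T s x = (∫ᵛ t in Icc 0 T, s t ∂•(pathMeasure x)) +
      impactCost γ ρ lam lam' T q (fun t => volumeImpact ρ x t.toNNReal) := by
  set p := costExponent γ with hp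
  have hp1 : 1 < p := one_lt_costExponent hγ
  set w : ℝ → ℝ := fun t => costWeight γ (lam t) with hwdef
  set E := volumeImpact ρ x with hE
  set H : ℝ → ℝ := fun e => |e| ^ p with hH
  set d : ℝ → ℝ := fun e => p * signedRPow (p - 1) e with hd
  have hdc : Continuous d := continuous_const.mul (continuous_signedRPow (by linarith))
  have hHd : ∀ e, HasDerivAt H (d e) e := hasDerivAt_abs_rpow_signedRPow hp1
  have hwc : Continuous w := continuous_costWeight h
  have hρ0 : ∀ t, 0 ≤ ρ t := fun t => (h.rate_pos t).le
  have hbv := hx.boundedVariation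
  have hEm : Measurable E := measurable_volumeImpact h.rate_continuous hbv
  have hjm : Measurable (jump x) := measurable_jump hbv
  set Ψ : ℝ≥0 → ℝ := fun t => w t * segmentMean d (E t) (E t + jump x t) with hΨ
  set D : ℝ≥0 → ℝ := fun t => w t * d (E t) with hD
  have hwm : Measurable fun t : ℝ≥0 => w t := hwc.measurable.comp measurable_coe_nnreal_real
  have hΨm : Measurable Ψ := by
    have h1 : Measurable fun t => (E t, E t + jump x t) := hEm.prodMk (hEm.add hjm)
    have h2 : Measurable fun z : ℝ × ℝ => segmentMean d z.1 z.2 :=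
      (continuous_segmentMean hdc).measurable
    have h3 := h2.comp h1
    exact hwm.mul h3
  have hDm : Measurable D := hwm.mul (hdc.measurable.comp hEm)
  obtain ⟨M, hM⟩ := exists_eVariationOn_le hbv
  set C := M * (1 + cumRate ρ T) + 2 * M with hC
  have hEb : ∀ t ≤ T, |E t| ≤ C := fun t ht =>
    (abs_volumeImpact_le h.rate_continuous hρ0 hM ht).trans (by rw [hC]; linarith [M.coe_nonneg])
  have hjb : ∀ t, |jump x t| ≤ M := by
    intro t
    have h1 : Tendsto (fun u => |x u - x t|) (𝓝[>] t) (𝓝 |jump x t|) := by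
      have := ((tendsto_right_jump hbv t).sub_const (x t)).abs
      simpa using this
    exact le_of_tendsto h1 (Eventually.of_forall fun u => abs_sub_le_of_eVariationOn_le hM u t)
  have hEjb : ∀ t ≤ T, |E t + jump x t| ≤ C := fun t ht =>
    (abs_add_le _ _).trans (by
      have h1 := abs_volumeImpact_le h.rate_continuous hρ0 hM ht
      have h2 := hjb t
      rw [hC]; linarith [M.coe_nonneg])
  obtain ⟨Bd, hBd⟩ := exists_bound_segmentMean hdc C
  obtain ⟨Bw, hBw⟩ := (isCompact_Icc (a := (0 : ℝ)) (b := T)).exists_bound_of_continuousOn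
    hwc.continuousOn
  have hBw0 : 0 ≤ Bw := (norm_nonneg _).trans (hBw 0 ⟨le_rfl, T.coe_nonneg⟩)
  have hΨb : ∀ t ∈ Icc 0 T, |Ψ t| ≤ Bw * Bd := by
    intro t ht
    rw [hΨ, abs_mul]
    exact mul_le_mul (hBw t ⟨t.coe_nonneg, NNReal.coe_le_coe.2 ht.2⟩)
      (hBd _ _ (hEb t ht.2) (hEjb t ht.2)) (abs_nonneg _) hBw0
  have hDb : ∀ t ∈ Icc 0 T, |D t| ≤ Bw * Bd := by
    intro t ht
    rw [hD, abs_mul, ← segmentMean_self d (E t)]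
    exact mul_le_mul (hBw t ⟨t.coe_nonneg, NNReal.coe_le_coe.2 ht.2⟩)
      (hBd _ _ (hEb t ht.2) (hEb t ht.2)) (abs_nonneg _) hBw0
  have hint : ∀ {g : ℝ≥0 → ℝ} {b : ℝ}, Measurable g → (∀ t ∈ Icc 0 T, |g t| ≤ b) →
      IntegrableOn g (Icc 0 T) (pathMeasure x).variation := fun hg hb =>
    Measure.integrableOn_of_bounded (by simp) hg.aestronglyMeasurable
      ((ae_restrict_iff' measurableSet_Icc).2 (Eventually.of_forall hb))
  have hsi := hint hs fun t ht => hB t ht.2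
  have hΨi := hint hΨm hΨb
  have hDi := hint hDm hDb
  have hvr : ((pathMeasure x).restrict (Icc 0 T)).variation =
      (pathMeasure x).variation.restrict (Icc 0 T) :=
    VectorMeasure.variation_restrict measurableSet_Icc
  have hDeq : ∀ t, priceImpact (powerLaw γ) ρ lam x t = D t := fun t =>
    antiderivInv_div hγ (h.depth_pos t) (E t)
  -- The correction at t is (Ψ - D) times the mass of {t}, and Ψ = D wherever the path has no jump,
  -- so the sum of the corrections is an integral against dx.
  have hjumpterm : ∀ t : ℝ≥0, lam t *
      (costPotential (powerLaw γ) ((E t + jump x t) / lam t) -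
        costPotential (powerLaw γ) (E t / lam t)) - D t * jump x t =
      (Ψ t - D t) * pathMeasure x {t} := by
    intro t
    rw [mul_sub, mul_costPotential hγ (h.depth_pos t), mul_costPotential hγ (h.depth_pos t),
      pathMeasure_singleton hbv hx.leftContinuous]
    have := segmentMean_mul hHd hdc (E t) (E t + jump x t)
    rw [add_sub_cancel_left] at this
    simp only [hΨ, hwdef]
    linear_combination (-costWeight γ (lam t)) * this
  have hatoms := setIntegral_eq_tsum_atoms (pathMeasure x) (measurableSet_Icc (a := 0) (b := T))
    (hΨi.sub hDi) (fun t _ h0 => by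
      rw [pathMeasure_singleton hbv hx.leftContinuous] at h0
      simp only [hΨ, hD, Pi.sub_apply, h0, add_zero, segmentMean_self, sub_self])
  have hcost : pathCost (powerLaw γ) ρ lam T s x =
      (∫ᵛ t in Icc 0 T, s t ∂•(pathMeasure x)) + ∫ᵛ t in Icc 0 T, Ψ t ∂•(pathMeasure x) := by
    rw [pathCost]
    simp only [hDeq, ← hE, hjumpterm]
    simp only [Pi.sub_apply] at hatoms
    rw [← hatoms, VectorMeasure.integral_fun_add, VectorMeasure.integral_fun_sub]
    · ring
    all_goals rw [VectorMeasure.Integrable, hvr]; assumption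
  have hw'c : Continuous fun t => -(costWeight γ (lam t) * (lam' t / lam t) / (1 + γ)) := by
    have h2 := continuous_costWeight (γ := γ) h
    have h1 : Continuous fun t => lam' t / lam t :=
      h.deriv_continuous.div h.depth_continuous fun t => (h.depth_pos t).ne'
    fun_prop
  have hww' : ∀ t, 0 < t →
      HasDerivAt w (-(costWeight γ (lam t) * (lam' t / lam t) / (1 + γ))) t :=
    fun t ht => hasDerivAt_costWeight hγ h ht
  have hH0 : H 0 = 0 := by simp [hH, Real.zero_rpow (by linarith : p ≠ 0)]
  have hIco := integral_segmentMean_Ico h.rate_continuous hρ0 hbv hx.leftContinuous hT hHd hdc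
    hH0 hwc hw'c hww'
  have hsplit : ∫ᵛ t in Icc 0 T, Ψ t ∂•(pathMeasure x) =
      (∫ᵛ t in Ico 0 T, Ψ t ∂•(pathMeasure x)) + Ψ T * jump x T := by
    rw [← Ico_union_right (zero_le : 0 ≤ T), VectorMeasure.setIntegral_union
      (by simp) measurableSet_Ico (measurableSet_singleton T), VectorMeasure.integral_singleton,
      pathMeasure_singleton hbv hx.leftContinuous]
    · simp
    all_goals
      rw [VectorMeasure.IntegrableOn, VectorMeasure.Integrable,
        VectorMeasure.variation_restrict (by measurability)]
    · exact hΨi.mono_set Ico_subset_Icc_self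
    · exact hΨi.mono_set (by simp)
  -- The path is 0 just after T, so integrating dE = dx - ρ E dt over [0, T] gives the final impact
  -- in terms of q and ∫ ρ E alone.
  have hlast : E T + jump x T = -(q + ∫ s in (0 : ℝ)..T, ρ s * E s.toNNReal) := by
    have h1 := volumeImpact_eq h.rate_continuous.continuousOn hbv T
    have h2 := hx.jump_last
    rw [hx.initial] at h1
    rw [hE, h1]
    linarith
  have hjumpT := segmentMean_mul hHd hdc (E T) (E T + jump x T)
  rw [add_sub_cancel_left] at hjumpT
  have hHlast : H (E T + jump x T) = |q + ∫ s in (0 : ℝ)..T, ρ s * E s.toNNReal| ^ p := by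
    rw [hlast, hH]; simp only [abs_neg]
  rw [hcost, hsplit, hIco, impactCost, ← hp, ← hE, ← hHlast]
  have hΨT : Ψ T * jump x T = w T * (H (E T + jump x T) - H (E T)) := by
    rw [← hjumpT]; simp only [hΨ]; ring
  rw [hΨT]
  -- Euler's identity E H'(E) = p H(E) merges the decay of the impact and the change of the weight
  -- into the single density p ρ w - w'.
  have hrun : ∫ s in (0 : ℝ)..T, (w s * ρ s * (E s.toNNReal * d (E s.toNNReal)) -
      -(costWeight γ (lam s) * (lam' s / lam s) / (1 + γ)) * H (E s.toNNReal)) =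
      ∫ s in (0 : ℝ)..T, runningWeight γ ρ lam lam' s * |E s.toNNReal| ^ p := by
    congr 1
    ext s
    have h1 := mul_signedRPow (s := p - 1) (by linarith) (E s.toNNReal)
    rw [sub_add_cancel] at h1
    have h2 : E s.toNNReal * d (E s.toNNReal) = p * |E s.toNNReal| ^ p := by
      rw [← h1, hd]; ring
    have h3 : (1 + γ) ≠ 0 := by linarith
    simp only [h2, hH, runningWeight, hwdef]
    rw [hp, costExponent]
    field_simp
    ring
  rw [hrun]
  simp only [hwdef]
  ring

end Cost

/-! ### Integrating a strategy against the unaffected price -/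

section Martingale

variable {Ω : Type*} [mΩ : MeasurableSpace Ω] {P : Measure Ω} [IsProbabilityMeasure P]

/-- A sequence that is bounded up to an error which is uniformly small in `L¹` may be integrated
term by term. -/
theorem tendsto_integral_of_bounded_add_small {I : ℕ → Ω → ℝ} {J : Ω → ℝ}
    (hI : ∀ n, Integrable (I n) P)
    (hlim : ∀ᵐ ω ∂P, Tendsto (fun n => I n ω) atTop (𝓝 (J ω)))
    (hsmall : ∀ ε : ℝ, 0 < ε → ∃ K : ℝ≥0, ∀ n, ∃ R : Ω → ℝ, Integrable R P ∧
      ∫ ω, |R ω| ∂P ≤ ε ∧ ∀ᵐ ω ∂P, |I n ω - R ω| ≤ K) :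
    Integrable J P ∧ Tendsto (fun n => ∫ ω, I n ω ∂P) atTop (𝓝 (∫ ω, J ω ∂P)) := by
  have hUI : UniformIntegrable I 1 P := by
    refine uniformIntegrable_of le_rfl (by simp) (fun n => (hI n).aestronglyMeasurable) ?_
    intro ε hε
    obtain ⟨K, hK⟩ := hsmall (ε / 2) (by linarith)
    refine ⟨2 * K, fun n => ?_⟩
    obtain ⟨R, hR, hRε, hIR⟩ := hK n
    have h1 : eLpNorm ({ω | 2 * K ≤ ‖I n ω‖₊}.indicator (I n)) 1 P ≤
        eLpNorm (fun ω => 2 * R ω) 1 P := by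
      refine eLpNorm_mono_ae ?_
      filter_upwards [hIR] with ω hω
      by_cases hmem : ω ∈ {ω | 2 * K ≤ ‖I n ω‖₊}
      · rw [indicator_of_mem hmem]
        have h2 : 2 * (K : ℝ) ≤ |I n ω| := by
          have h3 : 2 * K ≤ ‖I n ω‖₊ := hmem
          rw [← NNReal.coe_le_coe] at h3
          simpa using h3
        rw [Real.norm_eq_abs, Real.norm_eq_abs, abs_mul, abs_two]
        have h4 := abs_sub_abs_le_abs_sub (I n ω) (R ω)
        linarith
      · rw [indicator_of_notMem hmem, norm_zero]; exact norm_nonneg _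
    refine h1.trans ?_
    rw [eLpNorm_one_eq_lintegral_enorm, ← ofReal_integral_norm_eq_lintegral_enorm (hR.const_mul 2)]
    refine ENNReal.ofReal_le_ofReal ?_
    simp only [norm_mul, Real.norm_eq_abs, abs_two]
    rw [integral_const_mul]
    linarith
  have hJ : MemLp J 1 P := hUI.memLp_of_ae_tendsto hlim
  refine ⟨memLp_one_iff_integrable.1 hJ, ?_⟩
  exact tendsto_integral_of_L1' J (memLp_one_iff_integrable.1 hJ).aestronglyMeasurable
    (Eventually.of_forall hI) (tendsto_Lp_finite_of_tendsto_ae le_rfl (by simp) hUI.1 hJ hUI.2.1 hlim)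

theorem integral_condExp_mul {m : MeasurableSpace Ω} (hm : m ≤ mΩ) {Z Y : Ω → ℝ}
    (hZ : Integrable Z P) (hY : StronglyMeasurable[m] Y) {c : ℝ} (hc : ∀ᵐ ω ∂P, |Y ω| ≤ c) :
    Integrable (fun ω => P[Z | m] ω * Y ω) P ∧
      ∫ ω, P[Z | m] ω * Y ω ∂P = ∫ ω, Z ω * Y ω ∂P := by
  refine ⟨integrable_condExp.mul_bdd (hY.mono hm).aestronglyMeasurable hc, ?_⟩
  have h1 := condExp_stronglyMeasurable_mul_of_bound hm hY hZ c hc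
  rw [← integral_condExp hm (f := fun ω => Z ω * Y ω)]
  refine integral_congr_ae ?_
  have h2 : (fun ω => Z ω * Y ω) = Y * Z := by ext ω; simp [mul_comm]
  rw [h2]
  filter_upwards [h1] with ω hω
  rw [hω, Pi.mul_apply, mul_comm]

/-- Martingale transforms with weights of total mass at most `M` are dominated in `L¹` and in
`L^∞` by the terminal value. -/
theorem integral_abs_sum_condExp_mul_le {ι : Type*} (s : Finset ι) {m : ι → MeasurableSpace Ω}
    (hm : ∀ i, m i ≤ mΩ) {Y : ι → Ω → ℝ} (hY : ∀ i ∈ s, StronglyMeasurable[m i] (Y i)) {M : ℝ}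
    (hM : ∀ᵐ ω ∂P, ∑ i ∈ s, |Y i ω| ≤ M) {Z : Ω → ℝ} (hZ : Integrable Z P) :
    Integrable (fun ω => ∑ i ∈ s, P[Z | m i] ω * Y i ω) P ∧
      ∫ ω, |∑ i ∈ s, P[Z | m i] ω * Y i ω| ∂P ≤ M * ∫ ω, |Z ω| ∂P := by
  have hYM : ∀ i ∈ s, ∀ᵐ ω ∂P, |Y i ω| ≤ M := by
    intro i hi
    filter_upwards [hM] with ω hω
    exact (Finset.single_le_sum (f := fun i => |Y i ω|) (fun j _ => abs_nonneg _) hi).trans hω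
  have hYM' : ∀ i ∈ s, ∀ᵐ ω ∂P, |(|Y i ω|)| ≤ M := by
    intro i hi; simpa using hYM i hi
  have hYa : ∀ i ∈ s, StronglyMeasurable[m i] fun ω => |Y i ω| := fun i hi => by
    simpa using! (hY i hi).norm
  have hint : ∀ i ∈ s, Integrable (fun ω => P[Z | m i] ω * Y i ω) P := fun i hi =>
    (integral_condExp_mul (hm i) hZ (hY i hi) (hYM i hi)).1
  have hinta : ∀ i ∈ s, Integrable (fun ω => P[fun ω => |Z ω| | m i] ω * |Y i ω|) P := fun i hi =>
    (integral_condExp_mul (hm i) hZ.abs (hYa i hi) (hYM' i hi)).1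
  have hintz : ∀ i ∈ s, Integrable (fun ω => |Z ω| * |Y i ω|) P := fun i hi =>
    hZ.abs.mul_bdd ((hYa i hi).mono (hm i)).aestronglyMeasurable (hYM' i hi)
  refine ⟨integrable_finsetSum _ hint, ?_⟩
  calc ∫ ω, |∑ i ∈ s, P[Z | m i] ω * Y i ω| ∂P
      ≤ ∫ ω, ∑ i ∈ s, P[fun ω => |Z ω| | m i] ω * |Y i ω| ∂P := by
        refine integral_mono_ae (integrable_finsetSum _ hint).abs (integrable_finsetSum _ hinta) ?_
        have h1 : ∀ᵐ ω ∂P, ∀ i ∈ s, |P[Z | m i] ω| ≤ P[fun ω => |Z ω| | m i] ω :=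
          (Finset.eventually_all s).2 fun i _ => abs_condExp_ae_le_condExp_abs Z
        filter_upwards [h1] with ω hω
        refine (Finset.abs_sum_le_sum_abs _ _).trans (Finset.sum_le_sum fun i hi => ?_)
        rw [abs_mul]
        exact mul_le_mul_of_nonneg_right (hω i hi) (abs_nonneg _)
    _ = ∑ i ∈ s, ∫ ω, |Z ω| * |Y i ω| ∂P := by
        rw [integral_finsetSum _ hinta]
        exact Finset.sum_congr rfl fun i hi =>
          (integral_condExp_mul (hm i) hZ.abs (hYa i hi) (hYM' i hi)).2
    _ = ∫ ω, |Z ω| * ∑ i ∈ s, |Y i ω| ∂P := by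
        rw [← integral_finsetSum _ hintz]
        simp only [Finset.mul_sum]
    _ ≤ ∫ ω, M * |Z ω| ∂P := by
        refine integral_mono_ae ?_ (hZ.abs.const_mul M) ?_
        · simp only [Finset.mul_sum]; exact integrable_finsetSum _ hintz
        · filter_upwards [hM] with ω hω
          rw [mul_comm M]
          exact mul_le_mul_of_nonneg_left hω (abs_nonneg _)
    _ = M * ∫ ω, |Z ω| ∂P := integral_const_mul _ _

omit [IsProbabilityMeasure P] in
theorem abs_sum_condExp_mul_le {ι : Type*} (s : Finset ι) {m : ι → MeasurableSpace Ω}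
    {Y : ι → Ω → ℝ} {M : ℝ} (hM : ∀ᵐ ω ∂P, ∑ i ∈ s, |Y i ω| ≤ M) {Z : Ω → ℝ} {K : ℝ≥0}
    (hZ : ∀ᵐ ω ∂P, |Z ω| ≤ K) :
    ∀ᵐ ω ∂P, |∑ i ∈ s, P[Z | m i] ω * Y i ω| ≤ K * M := by
  have h1 : ∀ᵐ ω ∂P, ∀ i ∈ s, |P[Z | m i] ω| ≤ K :=
    (Finset.eventually_all s).2 fun i _ => ae_bdd_abs_condExp_of_ae_bdd_abs hZ
  filter_upwards [h1, hM] with ω hω hMω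
  calc |∑ i ∈ s, P[Z | m i] ω * Y i ω| ≤ ∑ i ∈ s, K * |Y i ω| := by
        refine (Finset.abs_sum_le_sum_abs _ _).trans (Finset.sum_le_sum fun i hi => ?_)
        rw [abs_mul]
        exact mul_le_mul_of_nonneg_right (hω i hi) (abs_nonneg _)
    _ = K * ∑ i ∈ s, |Y i ω| := by rw [Finset.mul_sum]
    _ ≤ K * M := mul_le_mul_of_nonneg_left hMω K.coe_nonneg

-- Splits the terminal value of the martingale into a bounded part, whose transforms are uniformly
-- bounded, and a part small in L¹, whose transforms are uniformly small in L¹. No moment of S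
-- beyond the first is needed.
omit [IsProbabilityMeasure P] in
theorem exists_bounded_integral_abs_sub_le {Z : Ω → ℝ} (hZ : Integrable Z P) {ε : ℝ}
    (hε : 0 < ε) :
    ∃ (W : Ω → ℝ) (K : ℝ≥0), Integrable W P ∧ (∀ᵐ ω ∂P, |W ω| ≤ K) ∧
      ∫ ω, |Z ω - W ω| ∂P ≤ ε := by
  obtain ⟨g, hg, hgi⟩ := (memLp_one_iff_integrable.2 hZ).exists_simpleFunc_eLpNorm_sub_lt
    (by simp) (ε := ENNReal.ofReal ε) (by simpa using hε)
  obtain ⟨C, hC⟩ := g.exists_forall_norm_le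
  have hgi' := memLp_one_iff_integrable.1 hgi
  refine ⟨g, C.toNNReal, hgi', Eventually.of_forall fun ω => (hC ω).trans (Real.le_coe_toNNReal C),
    ?_⟩
  rw [eLpNorm_one_eq_lintegral_enorm,
    ← ofReal_integral_norm_eq_lintegral_enorm (hZ.sub hgi')] at hg
  exact (ENNReal.ofReal_le_ofReal_iff hε.le).1 hg.le

variable {ℱ : Filtration ℝ≥0 mΩ} {S : ℝ≥0 → Ω → ℝ}

/-- A right-continuous martingale has bounded paths on compact intervals. -/
theorem ae_exists_bound_of_martingale (hS : Martingale S ℱ P)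
    (hSr : ∀ᵐ ω ∂P, ∀ t, ContinuousWithinAt (fun s => S s ω) (Ici t) t) {T : ℝ≥0} (hT : 0 < T) :
    ∀ᵐ ω ∂P, ∃ B : ℝ, ∀ t ≤ T, |S t ω| ≤ B := by
  set A : ℝ≥0 → ℕ → Set Ω := fun ε n => {ω | ∃ k ≤ 2 ^ n, (ε : ℝ) ≤ |S (grid T n k) ω|} with hA
  have hmono : ∀ ε, Monotone (A ε) := by
    intro ε
    refine monotone_nat_of_le_succ fun n ω hω => ?_
    obtain ⟨k, hk, h⟩ := hω
    -- Dyadic grids are nested, so the exceedance sets increase with n.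
    refine ⟨2 * k, by rw [pow_succ]; omega, ?_⟩
    have : grid T (n + 1) (2 * k) = grid T n k := by
      simp only [grid]; push_cast; rw [pow_succ]; field_simp
    rwa [this]
  -- Doob's maximal inequality for |S| along the grid; its right-hand side does not depend on the
  -- grid, since T is the last point of each.
  have hbound : ∀ (ε : ℝ≥0) (n : ℕ), ε * P (A ε n) ≤ ENNReal.ofReal (∫ ω, |S T ω| ∂P) := by
    intro ε n
    let 𝒢 : Filtration ℕ mΩ :=
      ⟨fun k => ℱ (grid T n k), fun i j hij => ℱ.mono (grid_mono T n hij), fun k => ℱ.le _⟩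
    have hG : Martingale (fun k => S (grid T n k)) 𝒢 P :=
      ⟨fun k => hS.stronglyAdapted _, fun i j hij => hS.condExp_ae_eq (grid_mono T n hij)⟩
    have hsub : Submartingale (fun k ω => |S (grid T n k) ω|) 𝒢 P :=
      hG.submartingale.sup hG.neg.submartingale
    have h1 := maximal_ineq hsub (fun k ω => abs_nonneg _) (ε := ε) (2 ^ n)
    have h2 : A ε n = {ω | (ε : ℝ) ≤ (Finset.range (2 ^ n + 1)).sup'
        Finset.nonempty_range_add_one fun k => |S (grid T n k) ω|} := by
      ext ω
      simp only [hA, mem_ofPred_eq, Finset.le_sup'_iff, Finset.mem_range, Nat.lt_succ_iff]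
    rw [← h2, grid_last] at h1
    refine h1.trans (ENNReal.ofReal_le_ofReal ?_)
    exact setIntegral_le_integral (hS.integrable T).abs (Eventually.of_forall fun ω => abs_nonneg _)
  have hbound' : ∀ ε : ℝ≥0, ε * P (⋃ n, A ε n) ≤ ENNReal.ofReal (∫ ω, |S T ω| ∂P) := by
    intro ε
    rw [(hmono ε).measure_iUnion, ENNReal.mul_iSup]
    exact iSup_le fun n => hbound ε n
  have hnull : P (⋂ m : ℕ, ⋃ n, A m n) = 0 := by
    by_contra hne
    have h1 : ∀ m : ℕ, (m : ℝ≥0∞) * P (⋂ m : ℕ, ⋃ n, A m n) ≤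
        ENNReal.ofReal (∫ ω, |S T ω| ∂P) := fun m =>
      le_trans (mul_le_mul' (by simp) (measure_mono (iInter_subset _ m))) (hbound' m)
    have h2 : Tendsto (fun m : ℕ => (m : ℝ≥0∞) * P (⋂ m : ℕ, ⋃ n, A m n)) atTop (𝓝 ∞) := by
      have := ENNReal.Tendsto.mul_const (b := P (⋂ m : ℕ, ⋃ n, A m n))
        ENNReal.tendsto_nat_nhds_top (Or.inl (by simp))
      rwa [ENNReal.top_mul hne] at this
    have h3 := le_of_tendsto' h2 h1
    exact absurd h3 (by simp)
  have hae : ∀ᵐ ω ∂P, ω ∉ ⋂ m : ℕ, ⋃ n, A m n := measure_eq_zero_iff_ae_notMem.1 hnull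
  filter_upwards [hae, hSr] with ω hω hr
  simp only [hA, mem_iInter, mem_iUnion, mem_ofPred_eq, not_forall, not_exists, not_and, not_le]
    at hω
  obtain ⟨m, hm⟩ := hω
  refine ⟨m, fun t ht => ?_⟩
  rcases ht.eq_or_lt with rfl | ht
  · have := hm 0 1 (by simp)
    have h2 : grid t 0 1 = t := by simp [grid]
    rw [h2] at this
    simpa using this.le
  · have h1 : Tendsto (fun n => |S (grid T n (gridIndex T n t + 1)) ω|) atTop (𝓝 |S t ω|) :=
      (((hr t).tendsto.mono_left (nhdsWithin_mono _ Ioi_subset_Ici_self)).comp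
        (tendsto_grid_gridIndex_succ hT t)).abs
    refine le_of_tendsto' h1 fun n => ?_
    simpa using (hm n _ (Nat.succ_le_of_lt (gridIndex_lt hT n ht))).le

/-- `gridIndex` is defined for all times, so horizon 1 merely fixes the mesh 2^{-n} of a grid of the
whole half-line. The function is the limit of its samples at right end points. -/
theorem measurable_of_rightContinuous {s : ℝ≥0 → ℝ}
    (hs : ∀ t, ContinuousWithinAt s (Ici t) t) : Measurable s := by
  refine measurable_of_tendsto_metrizable
    (f := fun n t => s (grid 1 n (gridIndex 1 n t + 1))) (fun n => ?_) ?_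
  · exact (measurable_from_nat (f := fun k => s (grid 1 n (k + 1)))).comp (measurable_gridIndex 1 n)
  · refine tendsto_pi_nhds.2 fun t => ?_
    exact ((hs t).tendsto.mono_left (nhdsWithin_mono _ Ioi_subset_Ici_self)).comp
        (tendsto_grid_gridIndex_succ one_pos t)

variable {T : ℝ≥0} {q : ℝ} {X : ℝ≥0 → Ω → ℝ}

omit [IsProbabilityMeasure P] in
theorem IsAdmissible.ae_isLiquidationPath (hX : IsAdmissible P ℱ T q X) :
    ∀ᵐ ω ∂P, IsLiquidationPath T q fun t => X t ω := by
  obtain ⟨M, hM⟩ := hX.boundedVariation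
  filter_upwards [hX.leftContinuous, hX.initial, hX.terminal, hM] with ω h1 h2 h3 h4
  exact ⟨(h4.trans_lt ENNReal.coe_lt_top).ne, h1, h2, h3⟩

/-- The martingale part of the cost has expectation `-q E[S_0]`. -/
theorem integral_martingale_part (hS : Martingale S ℱ P)
    (hSr : ∀ᵐ ω ∂P, ∀ t, ContinuousWithinAt (fun s => S s ω) (Ici t) t) (hT : 0 < T)
    (hX : IsAdmissible P ℱ T q X) :
    Integrable (fun ω => ∫ᵛ t in Icc 0 T, S t ω ∂•(pathMeasure fun t => X t ω)) P ∧
      ∫ ω, (∫ᵛ t in Icc 0 T, S t ω ∂•(pathMeasure fun t => X t ω)) ∂P =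
        -q * ∫ ω, S 0 ω ∂P := by
  obtain ⟨M, hM⟩ := hX.boundedVariation
  have hpath := hX.ae_isLiquidationPath
  have hXm : ∀ t, StronglyMeasurable (X t) := fun t => (hX.adapted t).mono (ℱ.le t)
  have hXb : ∀ t, ∀ᵐ ω ∂P, |X t ω| ≤ |q| + M := by
    intro t
    filter_upwards [hM, hX.initial] with ω h1 h2
    have h3 := abs_sub_le_of_eVariationOn_le h1 t 0
    rw [h2] at h3
    have h4 := abs_sub_abs_le_abs_sub (X t ω) q
    linarith
  set Y : ℕ → ℕ → Ω → ℝ := fun n k ω => X (grid T n (k + 1)) ω - X (grid T n k) ω with hY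
  have hYm : ∀ n k, StronglyMeasurable[ℱ (grid T n (k + 1))] (Y n k) := fun n k =>
    (hX.adapted _).sub ((hX.adapted _).mono (ℱ.mono (grid_mono T n k.le_succ)))
  have hYM : ∀ n, ∀ᵐ ω ∂P, ∑ k ∈ Finset.range (2 ^ n), |Y n k ω| ≤ M := by
    intro n
    filter_upwards [hM] with ω hω
    have h1 := (eVariationOn.sum_le (f := fun t => X t ω) (s := univ) (n := 2 ^ n)
      (grid_mono T n) (fun i => mem_univ _)).trans hω
    simp only [edist_dist, Real.dist_eq] at h1
    rw [← ENNReal.ofReal_sum_of_nonneg fun _ _ => abs_nonneg _] at h1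
    exact Real.toNNReal_le_iff_le_coe.1 (ENNReal.coe_le_coe.1 h1)
  -- Sampling S at right end points makes the price known together with the increment, so that S may
  -- be replaced by S_T under the expectation; right-continuity identifies the limit.
  set I : ℕ → Ω → ℝ := fun n ω =>
    ∑ k ∈ Finset.range (2 ^ n), S (grid T n (k + 1)) ω * Y n k ω with hI
  have hIcond : ∀ n, I n =ᵐ[P] fun ω =>
      ∑ k ∈ Finset.range (2 ^ n), P[S T | ℱ (grid T n (k + 1))] ω * Y n k ω := by
    intro n
    have h1 : ∀ᵐ ω ∂P, ∀ k ∈ Finset.range (2 ^ n),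
        P[S T | ℱ (grid T n (k + 1))] ω = S (grid T n (k + 1)) ω :=
      (Finset.eventually_all _).2 fun k hk => hS.condExp_ae_eq
        (grid_le (Nat.succ_le_of_lt (Finset.mem_range.1 hk)))
    filter_upwards [h1] with ω hω
    exact Finset.sum_congr rfl fun k hk => by rw [hω k hk]
  have hST := hS.integrable T
  have hIint : ∀ n, Integrable (I n) P := fun n =>
    (integral_abs_sum_condExp_mul_le (Finset.range (2 ^ n)) (fun k => ℱ.le (grid T n (k + 1)))
      (fun k _ => hYm n k) (hYM n) hST).1.congr (hIcond n).symm
  have hmulX : ∀ t, Integrable (fun ω => S T ω * X t ω) P := fun t =>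
    hST.mul_bdd (hXm t).aestronglyMeasurable (hXb t)
  have hYb : ∀ n k, ∀ᵐ ω ∂P, |Y n k ω| ≤ 2 * (|q| + M) := by
    intro n k
    filter_upwards [hXb (grid T n (k + 1)), hXb (grid T n k)] with ω h1 h2
    refine (abs_sub _ _).trans ?_
    linarith
  -- With S_T in place of the sampled prices the sum telescopes, so its expectation is the same for
  -- all grids.
  have hIval : ∀ n, ∫ ω, I n ω ∂P = ∫ ω, S T ω * X T ω ∂P - q * ∫ ω, S T ω ∂P := by
    intro n
    rw [integral_congr_ae (hIcond n), integral_finsetSum _ fun k _ =>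
      (integral_condExp_mul (ℱ.le _) hST (hYm n k) (hYb n k)).1]
    have h1 : ∀ k, ∫ ω, P[S T | ℱ (grid T n (k + 1))] ω * Y n k ω ∂P =
        ∫ ω, S T ω * X (grid T n (k + 1)) ω ∂P - ∫ ω, S T ω * X (grid T n k) ω ∂P := by
      intro k
      rw [(integral_condExp_mul (ℱ.le _) hST (hYm n k) (hYb n k)).2,
        ← integral_sub (hmulX _) (hmulX _)]
      simp only [hY, mul_sub]
    simp only [h1]
    rw [Finset.sum_range_sub (fun k => ∫ ω, S T ω * X (grid T n k) ω ∂P), grid_last, grid_zero]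
    congr 1
    rw [← integral_const_mul]
    refine integral_congr_ae ?_
    filter_upwards [hX.initial] with ω hω
    rw [hω, mul_comm]
  set J : Ω → ℝ := fun ω => ∫ᵛ t in Ico 0 T, S t ω ∂•(pathMeasure fun t => X t ω) with hJ
  have hbdd := ae_exists_bound_of_martingale hS hSr hT
  have hlim : ∀ᵐ ω ∂P, Tendsto (fun n => I n ω) atTop (𝓝 (J ω)) := by
    filter_upwards [hpath, hbdd, hSr] with ω hx hB hr
    obtain ⟨B, hB⟩ := hB
    refine tendsto_sum_grid hx.boundedVariation hx.leftContinuous hT (C := B)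
      (fun n k hk => hB _ (grid_le (Nat.succ_le_of_lt hk))) fun t _ => ?_
    exact ((hr t).tendsto.mono_left (nhdsWithin_mono _ Ioi_subset_Ici_self)).comp
        (tendsto_grid_gridIndex_succ hT t)
  obtain ⟨hJint, hJlim⟩ := tendsto_integral_of_bounded_add_small hIint hlim (by
    intro ε hε
    -- The transforms enlarge an L¹ error by the factor M at most; dividing by M + 1 also covers M =
    -- 0.
    obtain ⟨W, K, hW, hWK, hZW⟩ := exists_bounded_integral_abs_sub_le hST
      (ε := ε / (M + 1)) (by positivity)
    refine ⟨K * M, fun n => ⟨fun ω => ∑ k ∈ Finset.range (2 ^ n),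
      P[fun ω => S T ω - W ω | ℱ (grid T n (k + 1))] ω * Y n k ω, ?_⟩⟩
    obtain ⟨h1, h2⟩ := integral_abs_sum_condExp_mul_le (Finset.range (2 ^ n))
      (fun k => ℱ.le (grid T n (k + 1))) (fun k _ => hYm n k) (hYM n) (hST.sub hW)
    refine ⟨h1, h2.trans ?_, ?_⟩
    · have h3 : (M : ℝ) * ∫ ω, |S T ω - W ω| ∂P ≤ M * (ε / (M + 1)) :=
        mul_le_mul_of_nonneg_left hZW M.coe_nonneg
      refine h3.trans ?_
      rw [mul_div_assoc', div_le_iff₀ (by positivity)]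
      nlinarith [M.coe_nonneg]
    · have h3 := abs_sum_condExp_mul_le (Finset.range (2 ^ n))
        (m := fun k => ℱ (grid T n (k + 1))) (hYM n) hWK
      have h4 : ∀ᵐ ω ∂P, ∀ k ∈ Finset.range (2 ^ n),
          P[fun ω => S T ω - W ω | ℱ (grid T n (k + 1))] ω =
            P[S T | ℱ (grid T n (k + 1))] ω - P[W | ℱ (grid T n (k + 1))] ω :=
        (Finset.eventually_all _).2 fun k _ => condExp_sub hST hW _
      filter_upwards [h3, h4, hIcond n] with ω h5 h6 h7
      rw [h7, ← Finset.sum_sub_distrib]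
      refine le_trans (le_of_eq ?_) (h5.trans (by simp))
      congr 1
      refine Finset.sum_congr rfl fun k hk => ?_
      rw [h6 k hk]; ring)
  simp only [hIval] at hJlim
  have hJval := tendsto_nhds_unique hJlim tendsto_const_nhds
  -- The trade at T sells off X_T at price S_T. In expectation this cancels the term E[S_T X_T] left
  -- by the telescoping sum.
  have hsplit : ∀ᵐ ω ∂P, ∫ᵛ t in Icc 0 T, S t ω ∂•(pathMeasure fun t => X t ω) =
      J ω - S T ω * X T ω := by
    filter_upwards [hpath, hbdd, hSr] with ω hx hB hr
    obtain ⟨B, hB⟩ := hB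
    have hi : IntegrableOn (fun t => S t ω) (Icc 0 T) (pathMeasure fun t => X t ω).variation :=
      Measure.integrableOn_of_bounded (by simp)
        (measurable_of_rightContinuous hr).aestronglyMeasurable
        ((ae_restrict_iff' measurableSet_Icc).2 (Eventually.of_forall fun t ht => hB t ht.2))
    have hj := hx.jump_last
    rw [← Ico_union_right (zero_le : 0 ≤ T), VectorMeasure.setIntegral_union
      (by simp) measurableSet_Ico (measurableSet_singleton T), VectorMeasure.integral_singleton,
      pathMeasure_singleton hx.boundedVariation hx.leftContinuous]
    · have : jump (fun t => X t ω) T = -X T ω := by linarith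
      simp [this, hJ]
      ring
    all_goals
      rw [VectorMeasure.IntegrableOn, VectorMeasure.Integrable,
        VectorMeasure.variation_restrict (by measurability)]
    · exact hi.mono_set Ico_subset_Icc_self
    · exact hi.mono_set (by simp)
  refine ⟨(hJint.sub (hmulX T)).congr (hsplit.mono fun ω h => h.symm), ?_⟩
  rw [integral_congr_ae hsplit, integral_sub hJint (hmulX T), hJval]
  have h0 : ∫ ω, S T ω ∂P = ∫ ω, S 0 ω ∂P := by
    rw [← integral_condExp (ℱ.le 0) (f := S T)]
    exact integral_congr_ae (hS.condExp_ae_eq zero_le)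
  rw [← h0]
  ring

end Martingale

/-! ### The expected cost -/

section ExpectedCost

variable {Ω : Type*} [mΩ : MeasurableSpace Ω] {P : Measure Ω} [IsProbabilityMeasure P]
  {ℱ : Filtration ℝ≥0 mΩ} {S : ℝ≥0 → Ω → ℝ} {γ : ℝ} {ρ lam lam' : ℝ → ℝ} {T : ℝ≥0} {q : ℝ}
  {X : ℝ≥0 → Ω → ℝ}

-- Left-continuity makes the time integral a limit of finite sums over the grid, each measurable in
-- ω, so no joint measurability of the process is required.
omit [IsProbabilityMeasure P] in
theorem aestronglyMeasurable_intervalIntegral_of_leftContinuous {Z : ℝ≥0 → Ω → ℝ}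
    (hZ : ∀ t, AEStronglyMeasurable (Z t) P)
    (hl : ∀ᵐ ω ∂P, ∀ t, ContinuousWithinAt (fun s => Z s ω) (Iic t) t)
    (hb : ∀ᵐ ω ∂P, ∃ C : ℝ, ∀ t ≤ T, |Z t ω| ≤ C) {φ : ℝ → ℝ} (hφ : Continuous φ) :
    AEStronglyMeasurable (fun ω => ∫ s in (0 : ℝ)..T, Z s.toNNReal ω * φ s) P := by
  rcases eq_or_ne T 0 with rfl | hT
  · simp only [NNReal.coe_zero, intervalIntegral.integral_same]
    exact aestronglyMeasurable_const
  have hT : 0 < T := pos_iff_ne_zero.2 hT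
  refine aestronglyMeasurable_of_tendsto_ae atTop (f := fun n ω => ∑ k ∈ Finset.range (2 ^ n),
    Z (grid T n k) ω * ∫ s in (grid T n k : ℝ)..(grid T n (k + 1)), φ s) (fun n => ?_) ?_
  · exact Finset.aestronglyMeasurable_fun_sum _ fun k _ => (hZ _).mul_const _
  · filter_upwards [hl, hb] with ω hω hC
    obtain ⟨C, hC⟩ := hC
    refine tendsto_sum_grid_intervalIntegral hT (a := fun n k => Z (grid T n k) ω)
      (fun n k hk => hC _ (grid_le hk.le)) (hφ.intervalIntegrable _ _)
      (Eventually.of_forall fun t _ => ?_)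
    exact (hω t.toNNReal).tendsto.comp (tendsto_grid_gridIndex hT _)

omit [IsProbabilityMeasure P] in
theorem aestronglyMeasurable_volumeImpact (hρ : Continuous ρ) (hX : IsAdmissible P ℱ T q X)
    (t : ℝ≥0) : AEStronglyMeasurable (fun ω => volumeImpact ρ (fun t => X t ω) t) P := by
  have hXm : ∀ t, AEStronglyMeasurable (X t) P := fun t =>
    ((hX.adapted t).mono (ℱ.le t)).aestronglyMeasurable
  obtain ⟨M, hM⟩ := hX.boundedVariation
  have h1 := aestronglyMeasurable_intervalIntegral_of_leftContinuous (P := P) (T := t)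
    (Z := fun t ω => X t ω - X 0 ω) (φ := fun s => ρ s * Real.exp (cumRate ρ s))
    (fun t => (hXm t).sub (hXm 0)) (by
      filter_upwards [hX.leftContinuous] with ω hω t
      exact (hω t).sub continuousWithinAt_const) (by
      filter_upwards [hM] with ω hω
      exact ⟨M, fun t _ => abs_sub_le_of_eVariationOn_le hω t 0⟩)
    (hρ.mul (Real.continuous_exp.comp (continuous_cumRate hρ)))
  have h2 : (fun ω => volumeImpact ρ (fun t => X t ω) t) = fun ω => (X t ω - X 0 ω) -
      Real.exp (-cumRate ρ t) * ∫ s in (0 : ℝ)..t,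
        (X s.toNNReal ω - X 0 ω) * (ρ s * Real.exp (cumRate ρ s)) := by
    ext ω
    rw [volumeImpact_eq_exp hρ]
    simp only [mul_comm]
  rw [h2]
  exact ((hXm t).sub (hXm 0)).sub (h1.const_mul _)

theorem integrable_impactCost (hγ : -1 < γ) (h : RegularCoefficients ρ lam lam')
    (hX : IsAdmissible P ℱ T q X) :
    Integrable (fun ω => impactCost γ ρ lam lam' T q
      fun t => volumeImpact ρ (fun t => X t ω) t.toNNReal) P := by
  set p := costExponent γ with hp
  have hp1 : 1 < p := one_lt_costExponent hγ
  have hρ0 : ∀ t, 0 ≤ ρ t := fun t => (h.rate_pos t).le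
  have hHc : Continuous fun e : ℝ => |e| ^ p := continuous_abs.rpow_const fun _ => Or.inr (by linarith)
  obtain ⟨M, hM⟩ := hX.boundedVariation
  set C := M * (1 + cumRate ρ T) with hC
  have hEb : ∀ᵐ ω ∂P, ∀ t ≤ T, |volumeImpact ρ (fun t => X t ω) t| ≤ C := by
    filter_upwards [hM] with ω hω t ht
    exact abs_volumeImpact_le h.rate_continuous hρ0 hω ht
  obtain ⟨B, hB⟩ := (isCompact_Icc (a := -C) (b := C)).exists_bound_of_continuousOn hHc.continuousOn
  have hHb : ∀ᵐ ω ∂P, ∀ t ≤ T, |(|volumeImpact ρ (fun t => X t ω) t| ^ p)| ≤ B := by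
    filter_upwards [hEb] with ω hω t ht
    exact hB _ (abs_le.1 (hω t ht))
  have hEm := aestronglyMeasurable_volumeImpact (P := P) h.rate_continuous hX
  have hEl : ∀ᵐ ω ∂P, ∀ t, ContinuousWithinAt
      (fun t => volumeImpact ρ (fun t => X t ω) t) (Iic t) t := by
    filter_upwards [hX.ae_isLiquidationPath] with ω hω t
    exact leftContinuous_volumeImpact h.rate_continuous hω.boundedVariation hω.leftContinuous t
  have m1 := aestronglyMeasurable_intervalIntegral_of_leftContinuous hEm hEl
    (hEb.mono fun ω hω => ⟨C, hω⟩) h.rate_continuous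
  have m2 := aestronglyMeasurable_intervalIntegral_of_leftContinuous
    (Z := fun t ω => |volumeImpact ρ (fun t => X t ω) t| ^ p)
    (fun t => hHc.comp_aestronglyMeasurable (hEm t))
    (hEl.mono fun ω hω t => hHc.continuousAt.comp_continuousWithinAt (hω t))
    (hHb.mono fun ω hω => ⟨B, hω⟩) (continuous_runningWeight (γ := γ) h)
  have bnd : ∀ {f φ : ℝ → ℝ} {b : ℝ}, Continuous φ → (∀ s ∈ Ioc 0 (T : ℝ), |f s| ≤ b) →
      |∫ s in (0 : ℝ)..T, f s * φ s| ≤ ∫ s in (0 : ℝ)..T, b * |φ s| := by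
    intro f φ b hφ hf
    rw [← Real.norm_eq_abs]
    refine intervalIntegral.norm_integral_le_of_norm_le T.coe_nonneg
      (Eventually.of_forall fun s hs => ?_) ((hφ.abs.const_mul b).intervalIntegrable _ _)
    rw [norm_mul, Real.norm_eq_abs, Real.norm_eq_abs]
    exact mul_le_mul_of_nonneg_right (hf s hs) (abs_nonneg _)
  have hmem : ∀ s ∈ Ioc 0 (T : ℝ), s.toNNReal ≤ T := fun s hs => Real.toNNReal_le_iff_le_coe.2 hs.2
  have heq : (fun ω => impactCost γ ρ lam lam' T q
      fun t => volumeImpact ρ (fun t => X t ω) t.toNNReal) = fun ω =>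
      costWeight γ (lam T) * |q + ∫ s in (0 : ℝ)..T,
        volumeImpact ρ (fun t => X t ω) s.toNNReal * ρ s| ^ p +
      ∫ s in (0 : ℝ)..T, |volumeImpact ρ (fun t => X t ω) s.toNNReal| ^ p *
        runningWeight γ ρ lam lam' s := by
    ext ω
    simp only [impactCost, ← hp, mul_comm]
  rw [heq]
  set A := |q| + ∫ s in (0 : ℝ)..T, C * |ρ s| with hA
  obtain ⟨B', hB'⟩ := (isCompact_Icc (a := -A) (b := A)).exists_bound_of_continuousOn
    hHc.continuousOn
  refine Integrable.add (Integrable.const_mul ?_ _) ?_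
  · refine Integrable.of_bound (hHc.comp_aestronglyMeasurable (m1.const_add q)) B' ?_
    filter_upwards [hEb] with ω hω
    refine hB' _ (abs_le.1 ((abs_add_le _ _).trans ?_))
    rw [hA]
    gcongr
    exact bnd h.rate_continuous fun s hs => hω _ (hmem s hs)
  · refine Integrable.of_bound m2 (∫ s in (0 : ℝ)..T, B * |runningWeight γ ρ lam lam' s|) ?_
    filter_upwards [hHb] with ω hω
    exact bnd (continuous_runningWeight h) fun s hs => hω _ (hmem s hs)

theorem expectedCost_eq (hS : Martingale S ℱ P)
    (hSr : ∀ᵐ ω ∂P, ∀ t, ContinuousWithinAt (fun s => S s ω) (Ici t) t)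
    (hγ : -1 < γ) (h : RegularCoefficients ρ lam lam') (hT : 0 < T)
    (hX : IsAdmissible P ℱ T q X) :
    expectedCost P S (powerLaw γ) ρ lam T X = -q * ∫ ω, S 0 ω ∂P +
      ∫ ω, impactCost γ ρ lam lam' T q
        (fun t => volumeImpact ρ (fun t => X t ω) t.toNNReal) ∂P := by
  obtain ⟨h1, h2⟩ := integral_martingale_part hS hSr hT hX
  rw [← h2, ← integral_add h1 (integrable_impactCost hγ h hX), expectedCost]
  refine integral_congr_ae ?_
  filter_upwards [hX.ae_isLiquidationPath, ae_exists_bound_of_martingale hS hSr hT, hSr]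
    with ω hx hB hr
  obtain ⟨B, hB⟩ := hB
  exact pathCost_eq hγ h hT hx (measurable_of_rightContinuous hr) hB

end ExpectedCost

/-! ### Deterministic strategies -/

section Deterministic

variable {Ω : Type*} [mΩ : MeasurableSpace Ω] {P : Measure Ω} {ℱ : Filtration ℝ≥0 mΩ}
  {T : ℝ≥0} {q : ℝ} {x : ℝ≥0 → ℝ}

theorem IsLiquidationPath.isAdmissible (hx : IsLiquidationPath T q x) :
    IsAdmissible P ℱ T q fun t _ => x t where
  adapted _ := stronglyMeasurable_const
  leftContinuous := Eventually.of_forall fun _ => hx.leftContinuous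
  initial := Eventually.of_forall fun _ => hx.initial
  terminal := Eventually.of_forall fun _ => hx.terminal
  boundedVariation := by
    obtain ⟨M, hM⟩ := exists_eVariationOn_le hx.boundedVariation
    exact ⟨M, Eventually.of_forall fun _ => hM⟩

end Deterministic

/-! ### Reduction to deterministic paths -/

/-- The impact part of the cost of a path that liquidates `q` shares. -/
noncomputable def pathImpactCost (γ : ℝ) (ρ lam lam' : ℝ → ℝ) (T : ℝ≥0) (q : ℝ) (x : ℝ≥0 → ℝ) : ℝ :=
  impactCost γ ρ lam lam' T q fun t => volumeImpact ρ x t.toNNReal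

section Reduction

variable {Ω : Type*} [mΩ : MeasurableSpace Ω] {P : Measure Ω} [IsProbabilityMeasure P]
  {ℱ : Filtration ℝ≥0 mΩ} {S : ℝ≥0 → Ω → ℝ} {γ : ℝ} {ρ lam lam' : ℝ → ℝ} {T : ℝ≥0} {q : ℝ}

theorem expectedCost_const (hS : Martingale S ℱ P)
    (hSr : ∀ᵐ ω ∂P, ∀ t, ContinuousWithinAt (fun s => S s ω) (Ici t) t)
    (hγ : -1 < γ) (h : RegularCoefficients ρ lam lam') (hT : 0 < T) {x : ℝ≥0 → ℝ}
    (hx : IsLiquidationPath T q x) :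
    expectedCost P S (powerLaw γ) ρ lam T (fun t _ => x t) =
      -q * ∫ ω, S 0 ω ∂P + pathImpactCost γ ρ lam lam' T q x := by
  rw [expectedCost_eq hS hSr hγ h hT hx.isAdmissible]
  simp [pathImpactCost]

/-- A negative expectation needs paths of negative cost, and any such path is itself a deterministic
admissible strategy. -/
theorem hasPMS_iff (hS : Martingale S ℱ P)
    (hSr : ∀ᵐ ω ∂P, ∀ t, ContinuousWithinAt (fun s => S s ω) (Ici t) t)
    (hγ : -1 < γ) (h : RegularCoefficients ρ lam lam') (hT : 0 < T) :
    HasPMS P ℱ S (powerLaw γ) ρ lam T ↔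
      ∃ x, IsLiquidationPath T 0 x ∧ pathImpactCost γ ρ lam lam' T 0 x < 0 := by
  constructor
  · rintro ⟨X, hX, hneg⟩
    rw [expectedCost_eq hS hSr hγ h hT hX, neg_zero, zero_mul, zero_add] at hneg
    by_contra! hcon
    refine hneg.not_ge (integral_nonneg_of_ae ?_)
    filter_upwards [hX.ae_isLiquidationPath] with ω hω using hcon _ hω
  · rintro ⟨x, hx, hneg⟩
    refine ⟨fun t _ => x t, hx.isAdmissible, ?_⟩
    rw [expectedCost_const hS hSr hγ h hT hx]
    simpa using hneg

/-- The bound m holds path by path, hence survives integration over random monotone strategies. The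
term -q E[S_0] is common to all competitors and drops out. -/
theorem hasTTPM_of_lt (hS : Martingale S ℱ P)
    (hSr : ∀ᵐ ω ∂P, ∀ t, ContinuousWithinAt (fun s => S s ω) (Ici t) t)
    (hγ : -1 < γ) (h : RegularCoefficients ρ lam lam') (hT : 0 < T) {m : ℝ}
    (hm : ∀ y, IsLiquidationPath T q y → (Antitone y ∨ Monotone y) →
      m ≤ pathImpactCost γ ρ lam lam' T q y) {x : ℝ≥0 → ℝ} (hx : IsLiquidationPath T q x)
    (hxm : pathImpactCost γ ρ lam lam' T q x < m) :
    HasTTPM P ℱ S (powerLaw γ) ρ lam T := by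
  refine ⟨q, fun t _ => x t, hx.isAdmissible, ?_⟩
  rw [expectedCost_const hS hSr hγ h hT hx]
  have h1 : (-q * ∫ ω, S 0 ω ∂P) + pathImpactCost γ ρ lam lam' T q x <
      (-q * ∫ ω, S 0 ω ∂P) + m := by linarith
  refine (EReal.coe_lt_coe_iff.2 h1).trans_le (le_sInf ?_)
  rintro c ⟨Y, hY, hmono, rfl⟩
  rw [expectedCost_eq hS hSr hγ h hT hY, EReal.coe_le_coe_iff, add_le_add_iff_left]
  have h2 : ∀ᵐ ω ∂P, m ≤ impactCost γ ρ lam lam' T q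
      fun t => volumeImpact ρ (fun t => Y t ω) t.toNNReal := by
    rcases hmono with hmono | hmono
    · filter_upwards [hY.ae_isLiquidationPath, hmono] with ω hω h3 using hm _ hω (Or.inl h3)
    · filter_upwards [hY.ae_isLiquidationPath, hmono] with ω hω h3 using hm _ hω (Or.inr h3)
  calc m = ∫ _, m ∂P := by simp
    _ ≤ _ := integral_mono_ae (integrable_const m) (integrable_impactCost hγ h hY) h2

theorem not_hasTTPM_of_le (hS : Martingale S ℱ P)
    (hSr : ∀ᵐ ω ∂P, ∀ t, ContinuousWithinAt (fun s => S s ω) (Ici t) t)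
    (hγ : -1 < γ) (h : RegularCoefficients ρ lam lam') (hT : 0 < T)
    (hm : ∀ q, ∃ y, IsLiquidationPath T q y ∧ (Antitone y ∨ Monotone y) ∧
      ∀ x, IsLiquidationPath T q x →
        pathImpactCost γ ρ lam lam' T q y ≤ pathImpactCost γ ρ lam lam' T q x) :
    ¬ HasTTPM P ℱ S (powerLaw γ) ρ lam T := by
  rintro ⟨q, X, hX, hlt⟩
  obtain ⟨y, hy, hmono, hle⟩ := hm q
  have h1 : sInf {c : EReal | ∃ Y, IsAdmissible P ℱ T q Y ∧ IsMonotoneStrategy P Y ∧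
      c = (expectedCost P S (powerLaw γ) ρ lam T Y : EReal)} ≤
      (expectedCost P S (powerLaw γ) ρ lam T (fun t _ => y t) : ℝ) :=
    sInf_le ⟨fun t _ => y t, hy.isAdmissible,
      hmono.imp (fun h => Eventually.of_forall fun _ => h)
        (fun h => Eventually.of_forall fun _ => h), rfl⟩
  have h2 := EReal.coe_lt_coe_iff.1 (hlt.trans_le h1)
  rw [expectedCost_const hS hSr hγ h hT hy, expectedCost_eq hS hSr hγ h hT hX,
    add_lt_add_iff_left] at h2
  refine h2.not_ge ?_
  calc pathImpactCost γ ρ lam lam' T q y = ∫ _, pathImpactCost γ ρ lam lam' T q y ∂P := by simp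
    _ ≤ _ := by
      refine integral_mono_ae (integrable_const _) (integrable_impactCost hγ h hX) ?_
      filter_upwards [hX.ae_isLiquidationPath] with ω hω using hle _ hω

end Reduction

/-! ### Paths with a prescribed impact -/

section Prescribed

variable {ρ : ℝ → ℝ} {T : ℝ≥0} {q : ℝ} {x y : ℝ≥0 → ℝ}

theorem boundedVariationOn_add_smul (hx : BoundedVariationOn x univ)
    (hy : BoundedVariationOn y univ) (c : ℝ) : BoundedVariationOn (x + c • y) univ := by
  have h1 : BoundedVariationOn (c • y) univ := (lipschitzWith_smul c).comp_boundedVariationOn hy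
  refine ne_top_of_le_ne_top (ENNReal.add_ne_top.2 ⟨hx, h1⟩) (iSup_le fun p => ?_)
  refine (Finset.sum_le_sum fun i _ => edist_add_add_le (x (p.2.1 (i + 1)))
    ((c • y) (p.2.1 (i + 1))) (x (p.2.1 i)) ((c • y) (p.2.1 i))).trans ?_
  rw [Finset.sum_add_distrib]
  exact add_le_add (eVariationOn.sum_le p.2.2.1 p.2.2.2) (eVariationOn.sum_le p.2.2.1 p.2.2.2)

theorem IsLiquidationPath.add_smul {q' : ℝ} (hx : IsLiquidationPath T q x)
    (hy : IsLiquidationPath T q' y) (c : ℝ) : IsLiquidationPath T (q + c * q') (x + c • y) where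
  boundedVariation := boundedVariationOn_add_smul hx.boundedVariation hy.boundedVariation c
  leftContinuous t := (hx.leftContinuous t).add ((hy.leftContinuous t).const_smul c)
  initial := by simp [hx.initial, hy.initial]
  terminal t ht := by simp [hx.terminal t ht, hy.terminal t ht]

theorem volumeImpact_add_smul (hρ : Continuous ρ) (hx : BoundedVariationOn x univ)
    (hy : BoundedVariationOn y univ) (c : ℝ) (t : ℝ≥0) :
    volumeImpact ρ (x + c • y) t = volumeImpact ρ x t + c * volumeImpact ρ y t := by
  have hint : ∀ {z : ℝ≥0 → ℝ}, BoundedVariationOn z univ → IntervalIntegrable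
      (fun s : ℝ => ρ s * Real.exp (cumRate ρ s) * (z s.toNNReal - z 0)) volume 0 t := fun hz =>
    ((intervalIntegrable_path hz 0 t).sub intervalIntegrable_const).continuousOn_mul
      (hρ.mul (Real.continuous_exp.comp (continuous_cumRate hρ))).continuousOn
  rw [volumeImpact_eq_exp hρ, volumeImpact_eq_exp hρ, volumeImpact_eq_exp hρ]
  have h1 : ∫ s in (0 : ℝ)..t, ρ s * Real.exp (cumRate ρ s) *
      ((x + c • y) s.toNNReal - (x + c • y) 0) =
      (∫ s in (0 : ℝ)..t, ρ s * Real.exp (cumRate ρ s) * (x s.toNNReal - x 0)) +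
        c * ∫ s in (0 : ℝ)..t, ρ s * Real.exp (cumRate ρ s) * (y s.toNNReal - y 0) := by
    rw [← intervalIntegral.integral_const_mul, ← intervalIntegral.integral_add (hint hx)
      ((hint hy).const_mul c)]
    refine intervalIntegral.integral_congr fun s _ => ?_
    simp only [Pi.add_apply, Pi.smul_apply, smul_eq_mul]
    ring
  rw [h1]
  simp only [Pi.add_apply, Pi.smul_apply, smul_eq_mul]
  ring

/-- The linear equation `d = -∫ ρ d` has only the zero solution. -/
theorem eq_zero_of_eq_neg_integral (hρ : Continuous ρ) {T : ℝ} {d : ℝ → ℝ}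
    (hd : ∀ t ∈ Icc 0 T, d t = -∫ s in (0 : ℝ)..t, ρ s * d s)
    (hi : IntervalIntegrable (fun s => ρ s * d s) volume 0 T) {t : ℝ} (ht : t ∈ Icc 0 T) :
    d t = 0 := by
  have hT : 0 ≤ T := ht.1.trans ht.2
  have hdc : ContinuousOn d (Icc 0 T) := by
    have h1 := intervalIntegral.continuousOn_primitive_interval' hi left_mem_uIcc
    rw [uIcc_of_le hT] at h1
    exact h1.neg.congr hd
  have hderiv : ∀ s ∈ Ioo 0 T, HasDerivAt d (-(ρ s * d s)) s := by
    intro s hs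
    have hc : ContinuousOn (fun s => ρ s * d s) (Ioo 0 T) :=
      hρ.continuousOn.mul (hdc.mono Ioo_subset_Icc_self)
    have h1 : HasDerivAt (fun t => ∫ s in (0 : ℝ)..t, ρ s * d s) (ρ s * d s) s :=
      intervalIntegral.integral_hasDerivAt_right
        (hi.mono_set (by
          rw [uIcc_of_le hs.1.le, uIcc_of_le hT]; exact Icc_subset_Icc_right hs.2.le))
        (hc.stronglyMeasurableAtFilter isOpen_Ioo s hs) (hc.continuousAt (Ioo_mem_nhds hs.1 hs.2))
    refine h1.neg.congr_of_eventuallyEq ?_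
    filter_upwards [Ioo_mem_nhds hs.1 hs.2] with r hr using hd r ⟨hr.1.le, hr.2.le⟩
  have hexp : ∀ s ∈ Ioo 0 T, HasDerivAt (fun s => Real.exp (cumRate ρ s) * d s) 0 s := by
    intro s hs
    have := (hasDerivAt_cumRate hρ s).exp.mul (hderiv s hs)
    rwa [show Real.exp (cumRate ρ s) * ρ s * d s + Real.exp (cumRate ρ s) * -(ρ s * d s) = 0 by
      ring] at this
  have hcont : ContinuousOn (fun s => Real.exp (cumRate ρ s) * d s) (Icc 0 T) :=
    (Real.continuous_exp.comp (continuous_cumRate hρ)).continuousOn.mul hdc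
  have h0 : d 0 = 0 := by simpa using hd 0 ⟨le_rfl, hT⟩
  rcases ht.1.eq_or_lt with rfl | ht0
  · exact h0
  have h2 := intervalIntegral.integral_eq_sub_of_hasDerivAt_of_le ht0.le
    (hcont.mono (Icc_subset_Icc_right ht.2))
    (fun r hr => hexp r ⟨hr.1, hr.2.trans_le ht.2⟩) intervalIntegrable_const
  rw [h0, intervalIntegral.integral_zero] at h2
  have h3 : Real.exp (cumRate ρ t) * d t = 0 := by linarith
  exact (mul_eq_zero.1 h3).resolve_left (Real.exp_pos _).ne'

/-- Identifies the impact by uniqueness: the true impact and the prescribed v satisfy the same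
linear equation, so their difference solves the homogeneous one. -/
theorem volumeImpact_eq_of_path_eq (hρ : Continuous ρ) (hρ0 : ∀ t, 0 ≤ ρ t)
    (hx : BoundedVariationOn x univ) {v : ℝ → ℝ} (hv : IntervalIntegrable v volume 0 T)
    (hxv : ∀ t ≤ T, x t = x 0 + v t + ∫ s in (0 : ℝ)..t, ρ s * v s) {t : ℝ≥0} (ht : t ≤ T) :
    volumeImpact ρ x t = v t := by
  have hE : IntervalIntegrable (fun s : ℝ => volumeImpact ρ x s.toNNReal) volume 0 T :=
    intervalIntegrable_comp_volumeImpact hρ hρ0 hx continuous_id 0 T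
  have hd := hE.sub hv
  have key := eq_zero_of_eq_neg_integral hρ (T := T)
    (d := fun s => volumeImpact ρ x s.toNNReal - v s) (fun s hs => ?_)
    (hd.continuousOn_mul hρ.continuousOn) (t := t) ⟨t.2, ht⟩
  · simp only [Real.toNNReal_coe] at key
    linarith
  · have hs' : s.toNNReal ≤ T := Real.toNNReal_le_iff_le_coe.2 hs.2
    have h1 := volumeImpact_eq hρ.continuousOn hx s.toNNReal
    have h2 := hxv _ hs'
    rw [Real.coe_toNNReal _ hs.1] at h1 h2
    have hsub : uIcc 0 s ⊆ uIcc 0 (T : ℝ) := by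
      rw [uIcc_of_le hs.1, uIcc_of_le T.coe_nonneg]; exact Icc_subset_Icc_right hs.2
    have h3 : ∫ r in (0 : ℝ)..s, ρ r * (volumeImpact ρ x r.toNNReal - v r) =
        (∫ r in (0 : ℝ)..s, ρ r * volumeImpact ρ x r.toNNReal) - ∫ r in (0 : ℝ)..s, ρ r * v r := by
      rw [← intervalIntegral.integral_sub ((hE.mono_set hsub).continuousOn_mul hρ.continuousOn)
        ((hv.mono_set hsub).continuousOn_mul hρ.continuousOn)]
      exact intervalIntegral.integral_congr fun r _ => by simp [mul_sub]
    simp only [h3]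
    linarith

/-! ### Blocks -/

/-- The path with a unit trade at `a`, impact kept constant on `(a, b]`, the reverse unit trade at
`b`, and the remaining shares traded at `T`. -/
noncomputable def blockPath (ρ : ℝ → ℝ) (T a b : ℝ≥0) (t : ℝ≥0) : ℝ :=
  (Ioi a).indicator 1 t - (Ioi b).indicator 1 t +
    (cumRate ρ (max a (min b t) : ℝ≥0) - cumRate ρ a) -
    (cumRate ρ b - cumRate ρ a) * (Ioi T).indicator 1 t

theorem monotone_indicator_Ioi (a : ℝ≥0) : Monotone ((Ioi a).indicator (1 : ℝ≥0 → ℝ)) := by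
  intro s t hst
  by_cases hs : a < s
  · simp [hs, hs.trans_le hst]
  · rw [indicator_of_notMem (by simpa using hs)]
    exact indicator_nonneg (fun _ _ => zero_le_one) _

theorem boundedVariationOn_indicator_Ioi (a : ℝ≥0) :
    BoundedVariationOn ((Ioi a).indicator (1 : ℝ≥0 → ℝ)) univ :=
  (monotoneOn_univ.2 (monotone_indicator_Ioi a)).boundedVariationOn (C := 1) fun t _ => by
    by_cases h : t ∈ Ioi a <;> simp [h]

theorem leftContinuous_indicator_Ioi (a t : ℝ≥0) :
    ContinuousWithinAt ((Ioi a).indicator (1 : ℝ≥0 → ℝ)) (Iic t) t := by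
  by_cases h : a < t
  · refine ContinuousAt.continuousWithinAt (continuousAt_const (y := (1 : ℝ)) |>.congr ?_)
    filter_upwards [Ioi_mem_nhds h] with s hs
    simp [hs]
  · have h1 : ∀ s ≤ t, (Ioi a).indicator (1 : ℝ≥0 → ℝ) s = 0 := fun s hs =>
      indicator_of_notMem (s := Ioi a) (fun h' => h (lt_of_lt_of_le (mem_Ioi.1 h') hs)) _
    exact (continuousWithinAt_const (b := (0 : ℝ))).congr (fun s hs => h1 s hs) (h1 t le_rfl)

theorem isLiquidationPath_blockPath (hρ : Continuous ρ) (hρ0 : ∀ t, 0 ≤ ρ t) {a b : ℝ≥0}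
    (hab : a ≤ b) (hbT : b ≤ T) : IsLiquidationPath T 0 (blockPath ρ T a b) where
  boundedVariation := by
    have hR : Monotone (cumRate ρ) := monotone_of_hasDerivAt_nonneg (hasDerivAt_cumRate hρ) hρ0
    have h1 : BoundedVariationOn (fun t : ℝ≥0 =>
        cumRate ρ (max a (min b t) : ℝ≥0) - cumRate ρ a) univ := by
      refine (monotoneOn_univ.2 fun s t hst => ?_).boundedVariationOn
        (C := cumRate ρ b - cumRate ρ a) fun t _ => ?_
      · exact sub_le_sub_right (hR (NNReal.coe_le_coe.2
          (max_le_max le_rfl (min_le_min le_rfl hst)))) _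
      · rw [abs_of_nonneg (sub_nonneg.2 (hR (NNReal.coe_le_coe.2 (le_max_left _ _))))]
        exact sub_le_sub_right (hR (NNReal.coe_le_coe.2 (max_le hab (min_le_left _ _)))) _
    have h2 := boundedVariationOn_add_smul (boundedVariationOn_add_smul
      (boundedVariationOn_add_smul h1 (boundedVariationOn_indicator_Ioi a) 1)
      (boundedVariationOn_indicator_Ioi b) (-1)) (boundedVariationOn_indicator_Ioi T)
      (-(cumRate ρ b - cumRate ρ a))
    convert h2 using 1
    ext t
    simp only [blockPath, Pi.add_apply, Pi.smul_apply, smul_eq_mul]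
    ring
  leftContinuous t := by
    have h1 : Continuous fun t : ℝ≥0 => cumRate ρ (max a (min b t) : ℝ≥0) - cumRate ρ a :=
      ((continuous_cumRate hρ).comp (NNReal.continuous_coe.comp (by fun_prop))).sub continuous_const
    exact (((leftContinuous_indicator_Ioi a t).sub (leftContinuous_indicator_Ioi b t)).add
      h1.continuousWithinAt).sub ((leftContinuous_indicator_Ioi T t).const_smul
        (cumRate ρ b - cumRate ρ a))
  initial := by
    simp [blockPath]
  terminal t ht := by
    have hb : b < t := hbT.trans_lt ht
    have ha : a < t := hab.trans_lt hb
    simp [blockPath, ht, hb, ha, min_eq_left hb.le, max_eq_right hab]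

theorem integral_mul_indicator_Ioc (φ : ℝ → ℝ) {a b t : ℝ} (ha : 0 ≤ a) (ht : 0 ≤ t) :
    ∫ s in (0 : ℝ)..t, φ s * (Ioc a b).indicator 1 s =
      ∫ s in a..(max a (min b t)), φ s := by
  have h1 : (fun s => φ s * (Ioc a b).indicator 1 s) = (Ioc a b).indicator φ := by
    ext s
    by_cases h : s ∈ Ioc a b <;> simp [h]
  rw [h1, intervalIntegral.integral_of_le ht, intervalIntegral.integral_of_le (le_max_left _ _),
    setIntegral_indicator measurableSet_Ioc]
  congr 2
  ext s
  simp only [mem_inter_iff, mem_Ioc, le_max_iff, le_min_iff]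
  grind

/-- Blocks realize indicators as impacts by round trips, and the impact is linear in the path. They
are the test directions in all necessity arguments. -/
theorem volumeImpact_blockPath (hρ : Continuous ρ) (hρ0 : ∀ t, 0 ≤ ρ t) {a b : ℝ≥0}
    (hab : a ≤ b) (hbT : b ≤ T) {t : ℝ≥0} (ht : t ≤ T) :
    volumeImpact ρ (blockPath ρ T a b) t = (Ioc (a : ℝ) b).indicator 1 (t : ℝ) := by
  have hp := isLiquidationPath_blockPath hρ hρ0 hab hbT
  refine volumeImpact_eq_of_path_eq hρ hρ0 hp.boundedVariation
    (v := (Ioc (a : ℝ) b).indicator 1) ?_ (fun s hs => ?_) ht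
  · rw [intervalIntegrable_iff]
    exact (integrableOn_const (by simp)).indicator measurableSet_Ioc
  · rw [hp.initial, integral_mul_indicator_Ioc _ a.coe_nonneg s.coe_nonneg, integral_eq_cumRate_sub hρ, zero_add]
    have h1 : ((max a (min b s) : ℝ≥0) : ℝ) = max (a : ℝ) (min b s) := by push_cast; rfl
    rw [blockPath, indicator_of_notMem (show s ∉ Ioi T from hs.not_gt), mul_zero, sub_zero, h1]
    congr 1
    by_cases h2 : a < s
    · by_cases h3 : b < s
      · simp [h2, h3]
      · simp [h2, h3, not_lt.1 h3]
    · have h3 : ¬ b < s := fun h => h2 (hab.trans_lt h)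
      simp [h2, h3]

end Prescribed

/-! ### Absence of manipulation -/

section Sufficiency

variable {γ : ℝ} {ρ lam lam' : ℝ → ℝ} {T : ℝ≥0} {q : ℝ} {x y : ℝ≥0 → ℝ}

theorem runningWeight_nonneg_iff (hγ : -1 < γ) (h : RegularCoefficients ρ lam lam') {t : ℝ} :
    0 ≤ runningWeight γ ρ lam lam' t ↔ 0 ≤ ρ t * (2 + γ) + lam' t / lam t := by
  rw [runningWeight, mul_div_assoc, mul_nonneg_iff_of_pos_left (costWeight_pos hγ (h.depth_pos t)),
    div_eq_mul_inv, mul_nonneg_iff_of_pos_right (inv_pos.2 (by linarith))]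

theorem runningWeight_pos_iff (hγ : -1 < γ) (h : RegularCoefficients ρ lam lam') {t : ℝ} :
    0 < runningWeight γ ρ lam lam' t ↔ 0 < ρ t * (2 + γ) + lam' t / lam t := by
  rw [runningWeight, mul_div_assoc, mul_pos_iff_of_pos_left (costWeight_pos hγ (h.depth_pos t)),
    div_pos_iff_of_pos_right (by linarith)]

theorem impactCost_congr {e e' : ℝ → ℝ} (he : ∀ s ∈ Ioc 0 (T : ℝ), e s = e' s) :
    impactCost γ ρ lam lam' T q e = impactCost γ ρ lam lam' T q e' := by
  rw [← uIoc_of_le T.coe_nonneg] at he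
  have h1 : ∫ s in (0 : ℝ)..T, ρ s * e s = ∫ s in (0 : ℝ)..T, ρ s * e' s :=
    intervalIntegral.integral_congr_ae (Eventually.of_forall fun s hs => by simp only [he s hs])
  have h2 : ∫ s in (0 : ℝ)..T, runningWeight γ ρ lam lam' s * |e s| ^ costExponent γ =
      ∫ s in (0 : ℝ)..T, runningWeight γ ρ lam lam' s * |e' s| ^ costExponent γ :=
    intervalIntegral.integral_congr_ae (Eventually.of_forall fun s hs => by simp only [he s hs])
  rw [impactCost, impactCost, h1, h2]

theorem pathImpactCost_nonneg (hγ : -1 < γ) (h : RegularCoefficients ρ lam lam')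
    (hk : ∀ t ∈ Icc (0 : ℝ) T, 0 ≤ runningWeight γ ρ lam lam' t) (q : ℝ) (x : ℝ≥0 → ℝ) :
    0 ≤ pathImpactCost γ ρ lam lam' T q x :=
  add_nonneg (mul_nonneg (costWeight_pos hγ (h.depth_pos _)).le (Real.rpow_nonneg (abs_nonneg _) _))
    (intervalIntegral.integral_nonneg T.coe_nonneg fun s hs =>
      mul_nonneg (hk s hs) (Real.rpow_nonneg (abs_nonneg _) _))

/-! ### The candidate for the optimal impact -/

/-- The ratio `ρ (1 + γ) / (ρ (2 + γ) + η)`. -/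
noncomputable def impactRatio (γ : ℝ) (ρ lam lam' : ℝ → ℝ) (t : ℝ) : ℝ :=
  ρ t * (1 + γ) / (ρ t * (2 + γ) + lam' t / lam t)

/-- The optimal impact, up to a factor. -/
noncomputable def impactProfile (γ : ℝ) (ρ lam lam' : ℝ → ℝ) (t : ℝ) : ℝ :=
  lam t * impactRatio γ ρ lam lam' t ^ (1 + γ)

section Profile

variable {t : ℝ}

theorem impactRatio_pos (hγ : -1 < γ) (h : RegularCoefficients ρ lam lam')
    (hd : 0 < ρ t * (2 + γ) + lam' t / lam t) : 0 < impactRatio γ ρ lam lam' t :=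
  div_pos (mul_pos (h.rate_pos t) (by linarith)) hd

theorem impactProfile_pos (hγ : -1 < γ) (h : RegularCoefficients ρ lam lam')
    (hd : 0 < ρ t * (2 + γ) + lam' t / lam t) : 0 < impactProfile γ ρ lam lam' t :=
  mul_pos (h.depth_pos t) (Real.rpow_pos_of_pos (impactRatio_pos hγ h hd) _)

/-- Expresses both conditions of the theorem through ζ: the first is ζ ≤ 1, the second ζ' + ρ (1 -
ζ) ≥ 0. -/
theorem one_sub_impactRatio (hd : 0 < ρ t * (2 + γ) + lam' t / lam t) :
    1 - impactRatio γ ρ lam lam' t =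
      (ρ t + lam' t / lam t) / (ρ t * (2 + γ) + lam' t / lam t) := by
  rw [impactRatio, eq_div_iff hd.ne', sub_mul, div_mul_cancel₀ _ hd.ne']
  ring

theorem costWeight_mul_rpow {l : ℝ} (hl : 0 < l) :
    costWeight γ l * l ^ (costExponent γ - 1) = costWeight γ 1 := by
  rw [costWeight, costWeight, Real.one_rpow, mul_assoc, ← Real.rpow_add hl]
  simp

/-- The first-order condition: along the profile the marginal running cost is proportional to ρ. By
`costWeight_mul_rpow` the factor is the marginal terminal cost at impact λ_T, so profile and last
trade balance. -/
theorem runningWeight_mul_rpow (hγ : -1 < γ) (h : RegularCoefficients ρ lam lam')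
    (hd : 0 < ρ t * (2 + γ) + lam' t / lam t) :
    runningWeight γ ρ lam lam' t * impactProfile γ ρ lam lam' t ^ (costExponent γ - 1) =
      costWeight γ 1 * ρ t := by
  have hz := impactRatio_pos hγ h hd
  have hg : (0 : ℝ) < 1 + γ := by linarith
  rw [impactProfile, Real.mul_rpow (h.depth_pos t).le (Real.rpow_nonneg hz.le _),
    ← Real.rpow_mul hz.le, costExponent_sub_one hγ, mul_inv_cancel₀ hg.ne', Real.rpow_one,
    ← costExponent_sub_one hγ, ← costWeight_mul_rpow (h.depth_pos t), runningWeight, impactRatio]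
  generalize lam t ^ (costExponent γ - 1) = r
  generalize ρ t * (2 + γ) + lam' t / lam t = d at hd
  field_simp

/-- Eliminating λ' through the definition of ζ shows that g' + ρ g, the rate of trading, has the
sign of ζ' + ρ (1 - ζ). -/
theorem hasDerivAt_impactProfile (hγ : -1 < γ) (h : RegularCoefficients ρ lam lam') (ht : 0 < t)
    (hd : 0 < ρ t * (2 + γ) + lam' t / lam t) {z' : ℝ}
    (hz : HasDerivAt (impactRatio γ ρ lam lam') z' t) :
    HasDerivAt (impactProfile γ ρ lam lam')
      (impactProfile γ ρ lam lam' t * ((1 + γ) / impactRatio γ ρ lam lam' t *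
        (z' + ρ t * (1 - impactRatio γ ρ lam lam' t)) - ρ t)) t := by
  have hzp := impactRatio_pos hγ h hd
  have h1 := (h.hasDerivAt t ht).mul (hz.rpow_const (p := 1 + γ) (Or.inl hzp.ne'))
  have h2 : lam' t = lam t * (ρ t * (1 + γ) / impactRatio γ ρ lam lam' t - ρ t * (2 + γ)) := by
    have h3 : ρ t * (1 + γ) / impactRatio γ ρ lam lam' t = ρ t * (2 + γ) + lam' t / lam t := by
      rw [impactRatio, div_div_cancel₀]
      exact (mul_pos (h.rate_pos t) (by linarith)).ne'
    rw [h3, add_sub_cancel_left, mul_div_cancel₀ _ (h.depth_pos t).ne']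
  refine h1.congr_deriv ?_
  rw [Real.rpow_sub_one hzp.ne', h2, impactProfile]
  generalize impactRatio γ ρ lam lam' t = z at hzp
  generalize z ^ (1 + γ) = r
  field_simp
  ring

theorem continuousOn_impactRatio (h : RegularCoefficients ρ lam lam') {s : Set ℝ}
    (hd : ∀ t ∈ s, 0 < ρ t * (2 + γ) + lam' t / lam t) :
    ContinuousOn (impactRatio γ ρ lam lam') s :=
  (h.rate_continuous.mul_const _).continuousOn.div
    ((h.rate_continuous.mul_const _).add (h.deriv_continuous.div h.depth_continuous
      fun t => (h.depth_pos t).ne')).continuousOn fun t ht => (hd t ht).ne'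

theorem continuousOn_impactProfile (hγ : -1 < γ) (h : RegularCoefficients ρ lam lam') {s : Set ℝ}
    (hd : ∀ t ∈ s, 0 < ρ t * (2 + γ) + lam' t / lam t) :
    ContinuousOn (impactProfile γ ρ lam lam') s :=
  h.depth_continuous.continuousOn.mul ((continuousOn_impactRatio h hd).rpow_const fun _ _ =>
    Or.inr (by linarith))

end Profile

/-! ### Monotone strategies with the optimal impact -/

/-- If `G + ∫ ρ G` is monotone and `G T ≤ l`, any number of shares can be liquidated monotonically
with an impact proportional to `G`. -/
theorem exists_monotone_path (hρ : Continuous ρ) (hρ0 : ∀ t, 0 ≤ ρ t) {G : ℝ → ℝ} {l : ℝ}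
    (hG : Continuous G) (hG0 : 0 < G 0) (hl : G T ≤ l)
    (hmono : MonotoneOn (fun t : ℝ => G t + ∫ s in (0 : ℝ)..t, ρ s * G s) (Icc 0 T)) (q : ℝ) :
    0 < l + ∫ s in (0 : ℝ)..T, ρ s * G s ∧
    ∃ y, IsLiquidationPath T q y ∧ (Antitone y ∨ Monotone y) ∧ ∀ t, 0 < t → t ≤ T →
      volumeImpact ρ y t = -(q / (l + ∫ s in (0 : ℝ)..T, ρ s * G s)) * G t := by
  set φ : ℝ → ℝ := fun t => G t + ∫ s in (0 : ℝ)..t, ρ s * G s with hφ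
  set K := l + ∫ s in (0 : ℝ)..T, ρ s * G s with hK
  have hφ0 : 0 < φ 0 := by simpa [hφ] using hG0
  have hφK : ∀ t ∈ Icc (0 : ℝ) T, φ t ≤ K := fun t ht =>
    (hmono ht ⟨T.coe_nonneg, le_rfl⟩ ht.2).trans (add_le_add_left hl _)
  have hφpos : ∀ t ∈ Icc (0 : ℝ) T, 0 < φ t := fun t ht =>
    hφ0.trans_le (hmono ⟨le_rfl, T.coe_nonneg⟩ ht ht.1)
  have hKpos : 0 < K := hφ0.trans_le (hφK 0 ⟨le_rfl, T.coe_nonneg⟩)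
  refine ⟨hKpos, ?_⟩
  have hφc : Continuous φ := hG.add (intervalIntegral.continuous_primitive
    (fun a b => (hρ.mul hG).intervalIntegrable a b) 0)
  -- M is, up to the factor q/K, the number of shares traded so far: it jumps by G(0) at time 0 and
  -- by l - G(T) at time T, which is where G(0) > 0 and G(T) ≤ l are used.
  set M : ℝ≥0 → ℝ := fun t => if t = 0 then 0 else if t ≤ T then φ t else K with hM
  have hM0 : M 0 = 0 := if_pos rfl
  have hMφ : ∀ t, 0 < t → t ≤ T → M t = φ t := fun t h0 ht => by
    simp only [hM, h0.ne', ht, if_true, if_false]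
  have hMK : ∀ t, T < t → M t = K := fun t ht => by
    simp only [hM, (zero_le.trans_lt ht).ne', ht.not_ge, if_false]
  have hMmono : Monotone M := by
    intro s t hst
    rcases eq_or_ne s 0 with rfl | hs
    · rw [hM0]
      rcases eq_or_ne t 0 with rfl | ht
      · exact hM0.ge
      rcases le_or_gt t T with htT | htT
      · rw [hMφ t (pos_iff_ne_zero.2 ht) htT]; exact (hφpos t ⟨t.2, htT⟩).le
      · rw [hMK t htT]; exact hKpos.le
    have hs := pos_iff_ne_zero.2 hs
    rcases le_or_gt t T with htT | htT
    · rw [hMφ t (hs.trans_le hst) htT, hMφ s hs (hst.trans htT)]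
      exact hmono ⟨s.2, hst.trans htT⟩ ⟨t.2, htT⟩ hst
    · rw [hMK t htT]
      rcases le_or_gt s T with hsT | hsT
      · rw [hMφ s hs hsT]; exact hφK s ⟨s.2, hsT⟩
      · rw [hMK s hsT]
  have hMl : ∀ t, ContinuousWithinAt M (Iic t) t := by
    intro t
    rcases eq_or_ne t 0 with rfl | ht
    · have : Iic (0 : ℝ≥0) = {0} := by ext s; simp
      rw [this]
      exact continuousWithinAt_singleton
    have ht := pos_iff_ne_zero.2 ht
    rcases le_or_gt t T with htT | htT
    · have h1 : ContinuousWithinAt (fun s : ℝ≥0 => φ s) (Iic t) t :=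
        (hφc.comp NNReal.continuous_coe).continuousWithinAt
      refine h1.congr_of_eventuallyEq ?_ (hMφ t ht htT)
      filter_upwards [self_mem_nhdsWithin, mem_nhdsWithin_of_mem_nhds (Ioi_mem_nhds ht)]
        with s hs hs0 using hMφ s hs0 (le_trans hs htT)
    · refine (continuousAt_const (y := K)).continuousWithinAt.congr_of_eventuallyEq ?_ (hMK t htT)
      filter_upwards [mem_nhdsWithin_of_mem_nhds (Ioi_mem_nhds htT)] with s hs using hMK s hs
  have hMbv : BoundedVariationOn M univ := by
    refine (monotoneOn_univ.2 hMmono).boundedVariationOn (C := K) fun t _ => ?_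
    rw [abs_of_nonneg (hM0.ge.trans (hMmono zero_le))]
    exact (hMmono (le_max_left t (T + 1))).trans_eq (hMK _ (lt_max_of_lt_right
      (lt_add_of_pos_right T one_pos)))
  set y : ℝ≥0 → ℝ := fun t => q - q / K * M t with hy
  have hyp : IsLiquidationPath T q y :=
    { boundedVariation := by
        have h1 : BoundedVariationOn (fun _ : ℝ≥0 => q) univ :=
          (monotoneOn_const (c := q)).boundedVariationOn (C := |q|) fun _ _ => le_rfl
        convert boundedVariationOn_add_smul h1 hMbv (-(q / K)) using 1
        ext t
        simp only [hy, Pi.add_apply, Pi.smul_apply, smul_eq_mul]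
        ring
      leftContinuous := fun t => continuousWithinAt_const.sub ((hMl t).const_mul _)
      initial := by simp [hy, hM0]
      terminal := fun t ht => by
        simp only [hy, hMK t ht]
        rw [div_mul_cancel₀ _ hKpos.ne', sub_self] }
  refine ⟨y, hyp, ?_, fun t ht0 htT => ?_⟩
  · rcases le_total 0 q with hq | hq
    · left
      intro s t hst
      exact sub_le_sub_left (mul_le_mul_of_nonneg_left (hMmono hst) (div_nonneg hq hKpos.le)) _
    · right
      intro s t hst
      exact sub_le_sub_left (mul_le_mul_of_nonpos_left (hMmono hst)
        (div_nonpos_of_nonpos_of_nonneg hq hKpos.le)) _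
  -- The impact is 0 at time 0, before the initial trade, so the prescribed function has to be cut
  -- off there.
  · set v : ℝ → ℝ := (Ioi 0).indicator fun s => -(q / K) * G s with hv
    have hvi : ∀ a b : ℝ, IntervalIntegrable v volume a b := by
      intro a b
      rw [intervalIntegrable_iff]
      exact (intervalIntegrable_iff.1 ((hG.const_mul (-(q / K))).intervalIntegrable a b)).indicator
        measurableSet_Ioi
    have hvint : ∀ t : ℝ≥0, ∫ s in (0 : ℝ)..t, ρ s * v s =
        -(q / K) * ∫ s in (0 : ℝ)..t, ρ s * G s := by
      intro t
      rw [← intervalIntegral.integral_const_mul]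
      refine intervalIntegral.integral_congr_ae (Eventually.of_forall fun s hs => ?_)
      rw [uIoc_of_le t.coe_nonneg] at hs
      rw [hv, indicator_of_mem (show s ∈ Ioi 0 from hs.1)]
      ring
    have h1 := volumeImpact_eq_of_path_eq hρ hρ0 hyp.boundedVariation (hvi 0 T)
      (fun s hs => ?_) htT
    · rw [h1, hv, indicator_of_mem (show (t : ℝ) ∈ Ioi 0 from ht0)]
    · rw [hvint, hyp.initial, hy]
      simp only
      rcases eq_or_ne s 0 with rfl | hs0
      · simp [hv, hM0]
      · have hs0 := pos_iff_ne_zero.2 hs0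
        rw [hMφ s hs0 hs, hv, indicator_of_mem (show (s : ℝ) ∈ Ioi 0 from hs0), hφ]
        ring

/-- Convexity: |·|^p lies above its tangents at the candidate, both in the running and in the
terminal term. The first-order terms are the same multiple of ∫ ρ (E - F) with opposite signs, so
they cancel. -/
theorem pathImpactCost_le_of_profile (hγ : -1 < γ) (h : RegularCoefficients ρ lam lam')
    (hk : ∀ t ∈ Icc (0 : ℝ) T, 0 ≤ runningWeight γ ρ lam lam' t) {g : ℝ → ℝ} (hg : Continuous g)
    (hg0 : ∀ t ∈ Icc (0 : ℝ) T, 0 < g t)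
    (hkg : ∀ t ∈ Icc (0 : ℝ) T,
      runningWeight γ ρ lam lam' t * g t ^ (costExponent γ - 1) = costWeight γ 1 * ρ t)
    (hK : 0 < lam T + ∫ s in (0 : ℝ)..T, ρ s * g s)
    (hy : ∀ t, 0 < t → t ≤ T →
      volumeImpact ρ y t = -(q / (lam T + ∫ s in (0 : ℝ)..T, ρ s * g s)) * g t)
    (hx : BoundedVariationOn x univ) :
    pathImpactCost γ ρ lam lam' T q y ≤ pathImpactCost γ ρ lam lam' T q x := by
  set K := lam T + ∫ s in (0 : ℝ)..T, ρ s * g s with hKdef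
  set p := costExponent γ with hp
  have hp1 : 1 < p := one_lt_costExponent hγ
  have hρ0 : ∀ t, 0 ≤ ρ t := fun t => (h.rate_pos t).le
  have hHc : Continuous fun e : ℝ => |e| ^ p := continuous_abs.rpow_const fun _ => Or.inr (by linarith)
  set σ := signedRPow (p - 1) (q / K) with hσ
  set k := runningWeight γ ρ lam lam' with hkdef
  have hkc : Continuous k := continuous_runningWeight h
  set E : ℝ → ℝ := fun s => volumeImpact ρ x s.toNNReal with hE
  set F : ℝ → ℝ := fun s => -(q / K) * g s with hF
  have hFc : Continuous F := hg.const_mul _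
  have hcongr : pathImpactCost γ ρ lam lam' T q y = impactCost γ ρ lam lam' T q F := by
    have h1 : ∀ s ∈ uIoc 0 (T : ℝ), volumeImpact ρ y s.toNNReal = F s := by
      intro s hs
      rw [uIoc_of_le T.coe_nonneg] at hs
      rw [hy _ (Real.toNNReal_pos.2 hs.1) (Real.toNNReal_le_iff_le_coe.2 hs.2),
        Real.coe_toNNReal _ hs.1.le]
    exact impactCost_congr fun s hs => h1 s (by rwa [uIoc_of_le T.coe_nonneg])
  rw [hcongr]
  have hEi : IntervalIntegrable E volume 0 T :=
    intervalIntegrable_comp_volumeImpact h.rate_continuous hρ0 hx continuous_id 0 T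
  have hEp : IntervalIntegrable (fun s => |E s| ^ p) volume 0 T :=
    intervalIntegrable_comp_volumeImpact h.rate_continuous hρ0 hx hHc 0 T
  have hρE := hEi.continuousOn_mul h.rate_continuous.continuousOn
  have hρF := (hFc.intervalIntegrable (μ := volume) 0 T).continuousOn_mul
    h.rate_continuous.continuousOn
  set A := q + ∫ s in (0 : ℝ)..T, ρ s * E s with hA
  set B := q + ∫ s in (0 : ℝ)..T, ρ s * F s with hB
  -- The definition of K is exactly what makes the final impact λ_T times the factor that multiplies
  -- g.
  have hBeq : B = lam T * (q / K) := by
    have h1 : ∫ s in (0 : ℝ)..T, ρ s * F s = -(q / K) * ∫ s in (0 : ℝ)..T, ρ s * g s := by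
      rw [← intervalIntegral.integral_const_mul]
      exact intervalIntegral.integral_congr fun s _ => by simp only [hF]; ring
    have h2 : q = q / K * K := (div_mul_cancel₀ _ hK.ne').symm
    rw [hB, h1]
    nth_rewrite 1 [h2]
    rw [hKdef]
    ring
  have hlast : costWeight γ (lam T) * |B| ^ p + p * costWeight γ 1 * σ * (A - B) ≤
      costWeight γ (lam T) * |A| ^ p := by
    have h1 := mul_le_mul_of_nonneg_left (tangent_le_abs_rpow hp1 B A)
      (costWeight_pos hγ (h.depth_pos T)).le
    refine le_trans (le_of_eq ?_) h1
    rw [show signedRPow (p - 1) B = lam T ^ (p - 1) * σ by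
      rw [hBeq, signedRPow_mul (h.depth_pos T)], ← costWeight_mul_rpow (h.depth_pos T)]
    ring
  have hrun : (∫ s in (0 : ℝ)..T, k s * |F s| ^ p) - p * costWeight γ 1 * σ * (A - B) ≤
      ∫ s in (0 : ℝ)..T, k s * |E s| ^ p := by
    have hkF : IntervalIntegrable (fun s => k s * |F s| ^ p) volume 0 T :=
      (hkc.mul (hHc.comp hFc)).intervalIntegrable _ _
    have h1 : (∫ s in (0 : ℝ)..T, k s * |F s| ^ p) - p * costWeight γ 1 * σ * (A - B) =
        ∫ s in (0 : ℝ)..T, (k s * |F s| ^ p -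
          p * costWeight γ 1 * σ * (ρ s * E s - ρ s * F s)) := by
      rw [intervalIntegral.integral_sub hkF ((hρE.sub hρF).const_mul _),
        intervalIntegral.integral_const_mul, intervalIntegral.integral_sub hρE hρF, hA, hB]
      ring
    rw [h1]
    refine intervalIntegral.integral_mono_on T.coe_nonneg
      (hkF.sub ((hρE.sub hρF).const_mul _)) (hEp.continuousOn_mul hkc.continuousOn)
      fun s hs => ?_
    have h2 := mul_le_mul_of_nonneg_left (tangent_le_abs_rpow hp1 (F s) (E s)) (hk s hs)
    refine le_trans (le_of_eq ?_) h2
    have h3 : signedRPow (p - 1) (F s) = -(g s ^ (p - 1) * σ) := by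
      rw [hF]
      simp only
      rw [show -(q / K) * g s = -(g s * (q / K)) by ring, signedRPow_neg,
        signedRPow_mul (hg0 s hs)]
    rw [h3]
    linear_combination ((p * σ * (E s - F s))) * hkg s hs
  change costWeight γ (lam T) * |B| ^ p + _ ≤ costWeight γ (lam T) * |A| ^ p + _
  linarith

theorem exists_monotone_minimizer (hγ : -1 < γ) (h : RegularCoefficients ρ lam lam')
    (hd : ∀ t ∈ Icc (0 : ℝ) T, 0 < ρ t * (2 + γ) + lam' t / lam t) {z' : ℝ → ℝ}
    (hz : ∀ t ∈ Ioo (0 : ℝ) T, HasDerivAt (impactRatio γ ρ lam lam') (z' t) t)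
    (hz0 : ∀ t ∈ Ioo (0 : ℝ) T, 0 ≤ z' t + ρ t * (1 - impactRatio γ ρ lam lam' t))
    (hlast : impactRatio γ ρ lam lam' T ≤ 1) (q : ℝ) :
    ∃ y, IsLiquidationPath T q y ∧ (Antitone y ∨ Monotone y) ∧
      ∀ x, IsLiquidationPath T q x →
        pathImpactCost γ ρ lam lam' T q y ≤ pathImpactCost γ ρ lam lam' T q x := by
  -- The profile is only controlled on [0, T]; projecting the time extends it to a continuous
  -- function on the line.
  set g : ℝ → ℝ := fun t => impactProfile γ ρ lam lam' (projIcc 0 (T : ℝ) T.coe_nonneg t) with hg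
  have hgeq : ∀ t ∈ Icc (0 : ℝ) T, g t = impactProfile γ ρ lam lam' t := fun t ht => by
    simp only [hg, projIcc_of_mem T.coe_nonneg ht]
  have hgc : Continuous g :=
    (continuousOn_iff_continuous_domRestrict.1 (continuousOn_impactProfile hγ h hd)).comp
      continuous_projIcc
  have hgpos : ∀ t ∈ Icc (0 : ℝ) T, 0 < g t := fun t ht => by
    rw [hgeq t ht]; exact impactProfile_pos hγ h (hd t ht)
  have hT0 : (0 : ℝ) ∈ Icc (0 : ℝ) T := ⟨le_rfl, T.coe_nonneg⟩
  have hTT : (T : ℝ) ∈ Icc (0 : ℝ) T := ⟨T.coe_nonneg, le_rfl⟩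
  have hl : g T ≤ lam T := by
    rw [hgeq _ hTT, impactProfile]
    exact mul_le_of_le_one_right (h.depth_pos T).le
      (Real.rpow_le_one (impactRatio_pos hγ h (hd _ hTT)).le hlast (by linarith))
  have hmono : MonotoneOn (fun t : ℝ => g t + ∫ s in (0 : ℝ)..t, ρ s * g s) (Icc 0 T) := by
    have hρg : Continuous fun s => ρ s * g s := h.rate_continuous.mul hgc
    have hder : ∀ t ∈ Ioo (0 : ℝ) T, HasDerivAt (fun t : ℝ => g t + ∫ s in (0 : ℝ)..t, ρ s * g s)
        (impactProfile γ ρ lam lam' t * ((1 + γ) / impactRatio γ ρ lam lam' t *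
          (z' t + ρ t * (1 - impactRatio γ ρ lam lam' t)))) t := by
      intro t ht
      have ht' := Ioo_subset_Icc_self ht
      have h1 : HasDerivAt g _ t :=
        (hasDerivAt_impactProfile hγ h ht.1 (hd t ht') (hz t ht)).congr_of_eventuallyEq (by
          filter_upwards [Ioo_mem_nhds ht.1 ht.2] with s hs using hgeq s (Ioo_subset_Icc_self hs))
      have h2 := (hρg.integral_hasStrictDerivAt 0 t).hasDerivAt
      refine (h1.add h2).congr_deriv ?_
      rw [hgeq t ht']
      ring
    refine monotoneOn_of_deriv_nonneg (convex_Icc _ _) ?_ ?_ ?_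
    · exact (hgc.add (intervalIntegral.continuous_primitive
        (fun a b => hρg.intervalIntegrable a b) 0)).continuousOn
    · rw [interior_Icc]
      exact fun t ht => (hder t ht).differentiableAt.differentiableWithinAt
    · rw [interior_Icc]
      intro t ht
      rw [(hder t ht).deriv]
      have ht' := Ioo_subset_Icc_self ht
      exact mul_nonneg (impactProfile_pos hγ h (hd t ht')).le (mul_nonneg
        (div_nonneg (by linarith) (impactRatio_pos hγ h (hd t ht')).le) (hz0 t ht))
  obtain ⟨hK, y, hy, hym, hyE⟩ := exists_monotone_path h.rate_continuous
    (fun t => (h.rate_pos t).le) hgc (hgpos 0 hT0) hl hmono q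
  refine ⟨y, hy, hym, fun x hx => ?_⟩
  refine pathImpactCost_le_of_profile hγ h (fun t ht => (runningWeight_nonneg_iff hγ h).2 (hd t ht).le)
    hgc hgpos (fun t ht => ?_) hK hyE hx.boundedVariation
  rw [hgeq t ht]
  exact runningWeight_mul_rpow hγ h (hd t ht)

end Sufficiency

/-! ### Impact of a monotone purchase of one share -/

/-- The properties of the impact `e` of a purchase of one share without sales. -/
structure IsBuyImpact (ρ : ℝ → ℝ) (T : ℝ) (e : ℝ → ℝ) : Prop where
  measurable : Measurable e
  nonneg : ∀ t ∈ Icc 0 T, 0 ≤ e t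
  le_one : ∀ t ∈ Icc 0 T, e t ≤ 1
  monotoneOn : MonotoneOn (fun t => Real.exp (cumRate ρ t) * e t) (Icc 0 T)
  le_last : ∀ t ∈ Icc 0 T, Real.exp (cumRate ρ t) * e t ≤
    Real.exp (cumRate ρ T) * (1 - ∫ s in (0 : ℝ)..T, ρ s * e s)
  last_le_one : 1 - ∫ s in (0 : ℝ)..T, ρ s * e s ≤ 1
  le_exp_mul_last : 1 ≤ Real.exp (cumRate ρ T) * (1 - ∫ s in (0 : ℝ)..T, ρ s * e s)

section BuyImpact

variable {ρ : ℝ → ℝ} {T : ℝ≥0} {x : ℝ≥0 → ℝ}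

theorem integral_rate_mul_exp (hρ : Continuous ρ) (a b : ℝ) :
    ∫ s in a..b, ρ s * Real.exp (cumRate ρ s) =
      Real.exp (cumRate ρ b) - Real.exp (cumRate ρ a) := by
  refine intervalIntegral.integral_eq_sub_of_hasDerivAt (f := fun s => Real.exp (cumRate ρ s))
    (fun s _ => ?_) ?_
  · rw [mul_comm]
    exact (hasDerivAt_cumRate hρ s).exp
  · exact (hρ.mul (Real.continuous_exp.comp (continuous_cumRate hρ))).intervalIntegrable _ _

/-- The quantity e^{∫ρ} E equals ∫ e^{∫ρ} dx, which increases along a purchase; here this is read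
off from its integrated-by-parts form. The recurring 1 - ∫ ρ E is the impact just after the final
trade. -/
theorem IsLiquidationPath.isBuyImpact (hρ : Continuous ρ) (hρ0 : ∀ t, 0 ≤ ρ t)
    (hx : IsLiquidationPath T (-1) x) (hmono : Monotone x) :
    IsBuyImpact ρ T fun t => volumeImpact ρ x t.toNNReal := by
  set z : ℝ → ℝ := fun s => x s.toNNReal - x 0 with hz
  set w : ℝ → ℝ := fun s => ρ s * Real.exp (cumRate ρ s) with hw
  have hwc : Continuous w := hρ.mul (Real.continuous_exp.comp (continuous_cumRate hρ))
  have hw0 : ∀ s, 0 ≤ w s := fun s => mul_nonneg (hρ0 s) (Real.exp_pos _).le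
  have hzm : Monotone z := fun s t hst => sub_le_sub_right (hmono (Real.toNNReal_le_toNNReal hst)) _
  have hz0 : ∀ s, 0 ≤ z s := fun s => sub_nonneg.2 (hmono zero_le)
  have hz1 : ∀ s, z s ≤ 1 := by
    intro s
    have h1 := hmono (le_max_left s.toNNReal (T + 1))
    rw [hx.terminal _ (lt_max_of_lt_right (lt_add_of_pos_right T one_pos))] at h1
    simp only [hz, hx.initial]
    linarith
  have hwz : ∀ a b : ℝ, IntervalIntegrable (fun s => w s * z s) volume a b := fun a b =>
    (hzm.intervalIntegrable).continuousOn_mul hwc.continuousOn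
  set Φ : ℝ → ℝ := fun t => Real.exp (cumRate ρ t) * volumeImpact ρ x t.toNNReal with hΦ
  have hΦeq : ∀ t, 0 ≤ t → Φ t = Real.exp (cumRate ρ t) * z t - ∫ s in (0 : ℝ)..t, w s * z s := by
    intro t ht
    simp only [hΦ, volumeImpact_eq_exp hρ, Real.coe_toNNReal t ht]
    rw [mul_sub, ← mul_assoc (Real.exp (cumRate ρ t)) (Real.exp _), ← Real.exp_add, add_neg_cancel,
      Real.exp_zero, one_mul]
  have hint : ∀ a b : ℝ, a ≤ b → ∫ s in a..b, w s * z s ≤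
      z b * (Real.exp (cumRate ρ b) - Real.exp (cumRate ρ a)) := by
    intro a b hab
    rw [← integral_rate_mul_exp hρ, ← intervalIntegral.integral_const_mul]
    refine intervalIntegral.integral_mono_on hab (hwz a b)
      ((hwc.const_mul _).intervalIntegrable _ _) fun s hs => ?_
    rw [mul_comm]
    exact mul_le_mul_of_nonneg_right (hzm hs.2) (hw0 s)
  have hΦm : MonotoneOn Φ (Icc 0 T) := by
    intro s hs t ht hst
    have h1 : (∫ r in (0 : ℝ)..s, w r * z r) + ∫ r in s..t, w r * z r =
        ∫ r in (0 : ℝ)..t, w r * z r := intervalIntegral.integral_add_adjacent_intervals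
      (hwz _ _) (hwz _ _)
    rw [hΦeq s hs.1, hΦeq t ht.1]
    have h2 := hint s t hst
    have h3 := mul_le_mul_of_nonneg_left (hzm hst) (Real.exp_pos (cumRate ρ s)).le
    linarith
  have hΦ0 : Φ 0 = 0 := by simp [hΦ, volumeImpact_zero]
  have hT0 : (0 : ℝ) ∈ Icc (0 : ℝ) T := ⟨le_rfl, T.coe_nonneg⟩
  have hTT : (T : ℝ) ∈ Icc (0 : ℝ) T := ⟨T.coe_nonneg, le_rfl⟩
  have hnn : ∀ t ∈ Icc (0 : ℝ) T, 0 ≤ volumeImpact ρ x t.toNNReal := by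
    intro t ht
    have h1 := hΦm hT0 ht ht.1
    rw [hΦ0] at h1
    exact nonneg_of_mul_nonneg_right h1 (Real.exp_pos _)
  have hle : ∀ t ∈ Icc (0 : ℝ) T, volumeImpact ρ x t.toNNReal ≤ z t := by
    intro t ht
    have h1 : 0 ≤ ∫ s in (0 : ℝ)..t, w s * z s :=
      intervalIntegral.integral_nonneg ht.1 fun s _ => mul_nonneg (hw0 s) (hz0 s)
    have h2 := hΦeq t ht.1
    refine le_of_mul_le_mul_left ?_ (Real.exp_pos (cumRate ρ t))
    change Φ t ≤ _
    linarith
  have hlast : 1 - ∫ s in (0 : ℝ)..T, ρ s * volumeImpact ρ x s.toNNReal =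
      1 - z T + volumeImpact ρ x T := by
    rw [volumeImpact_eq hρ.continuousOn hx.boundedVariation T]
    simp only [hz, Real.toNNReal_coe]
    ring
  have hΦT : Φ T = Real.exp (cumRate ρ T) * volumeImpact ρ x T := by simp [hΦ]
  have hleT := hle T hTT
  rw [Real.toNNReal_coe] at hleT
  refine ⟨(measurable_volumeImpact hρ hx.boundedVariation).comp measurable_real_toNNReal, hnn,
    fun t ht => (hle t ht).trans (hz1 t), hΦm, fun t ht => ?_, ?_, ?_⟩
  · rw [hlast]
    refine (hΦm ht hTT ht.2).trans ?_
    rw [hΦT]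
    exact mul_le_mul_of_nonneg_left (by linarith [hz1 T]) (Real.exp_pos _).le
  · rw [hlast]
    linarith
  · rw [hlast, mul_add, ← hΦT, hΦeq T T.coe_nonneg]
    have h1 : ∫ s in (0 : ℝ)..T, w s * z s ≤ ∫ s in (0 : ℝ)..T, w s :=
      intervalIntegral.integral_mono_on T.coe_nonneg (hwz _ _) (hwc.intervalIntegrable _ _)
        fun s _ => mul_le_of_le_one_right (hw0 s) (hz1 s)
    rw [integral_rate_mul_exp hρ, show cumRate ρ 0 = 0 by simp [cumRate], Real.exp_zero] at h1
    linarith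

end BuyImpact

/-! ### Descent directions -/

section Descent

variable {γ : ℝ} {ρ lam lam' : ℝ → ℝ} {T : ℝ≥0}

theorem intervalIntegrable_of_abs_le {f : ℝ → ℝ} (hf : Measurable f) {a b C : ℝ} (hab : a ≤ b)
    (hC : ∀ s ∈ Ioc a b, |f s| ≤ C) : IntervalIntegrable f volume a b := by
  rw [intervalIntegrable_iff, uIoc_of_le hab]
  exact Measure.integrableOn_of_bounded (M := C) (by simp) hf.aestronglyMeasurable
    ((ae_restrict_iff' measurableSet_Ioc).2 (Eventually.of_forall hC))

/-- A direction in which the cost has a negative slope decreases it by a uniform amount. -/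
theorem exists_uniform_descent (hγ : -1 < γ) (h : RegularCoefficients ρ lam lam')
    (hk : ∀ t ∈ Icc (0 : ℝ) T, 0 ≤ runningWeight γ ρ lam lam' t) {μ C : ℝ} (hμ : 0 < μ)
    (hC : 0 ≤ C) :
    ∃ θ > 0, ∃ δ > 0, ∀ (q : ℝ) (e v : ℝ → ℝ), Measurable e → Measurable v →
      (∀ s ∈ Ioc (0 : ℝ) T, |e s| ≤ 1) → (∀ s ∈ Ioc (0 : ℝ) T, |v s| ≤ C) →
      |q + ∫ s in (0 : ℝ)..T, ρ s * e s| ≤ 1 →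
      costWeight γ (lam T) * (signedRPow (costExponent γ - 1) (q + ∫ s in (0 : ℝ)..T, ρ s * e s) *
        ∫ s in (0 : ℝ)..T, ρ s * v s) + ∫ s in (0 : ℝ)..T, runningWeight γ ρ lam lam' s *
          (signedRPow (costExponent γ - 1) (e s) * v s) ≤ -μ →
      impactCost γ ρ lam lam' T q (fun s => e s + θ * v s) ≤ impactCost γ ρ lam lam' T q e - δ := by
  set p := costExponent γ with hp
  have hp1 : 1 < p := one_lt_costExponent hγ
  set φ := signedRPow (p - 1) with hφ
  have hφc : Continuous φ := continuous_signedRPow (by linarith)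
  have hHc : Continuous fun e : ℝ => |e| ^ p := continuous_abs.rpow_const fun _ => Or.inr (by linarith)
  set k := runningWeight γ ρ lam lam' with hkdef
  have hkc : Continuous k := continuous_runningWeight h
  set W := costWeight γ (lam T) with hW
  have hW0 : 0 < W := costWeight_pos hγ (h.depth_pos _)
  set R := ∫ s in (0 : ℝ)..T, ρ s with hR
  have hR0 : 0 ≤ R := intervalIntegral.integral_nonneg T.coe_nonneg fun s _ => (h.rate_pos s).le
  set N := ∫ s in (0 : ℝ)..T, k s with hN
  have hN0 : 0 ≤ N := intervalIntegral.integral_nonneg T.coe_nonneg hk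
  -- D bounds the total weight with which the error ε of the slope enters; ε is chosen so that ε D ≤
  -- μ/2, leaving half of the slope.
  set D := W * (C * R) + C * N with hD
  have hD0 : 0 ≤ D := by positivity
  obtain ⟨ν, hν, hunif⟩ := Metric.uniformContinuousOn_iff_le.1
    ((isCompact_Icc (a := (-2 : ℝ)) (b := 2)).uniformContinuousOn_of_continuous hφc.continuousOn)
    (μ / (2 * (D + 1))) (by positivity)
  set ε := μ / (2 * (D + 1)) with hε
  have hε0 : 0 < ε := by positivity
  have hεD : ε * D ≤ μ / 2 := by
    rw [hε, div_mul_eq_mul_div, div_le_div_iff₀ (by positivity) (by positivity)]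
    nlinarith
  -- The step moves both the impact and the terminal term by at most ν, for uniform continuity, and
  -- by at most 1, to stay within [-2, 2].
  set θ := min ν 1 / ((C + 1) * (R + 1)) with hθ
  have hθ0 : 0 < θ := by positivity
  have hθmul : θ * ((C + 1) * (R + 1)) = min ν 1 := div_mul_cancel₀ _ (by positivity)
  -- An upper bound from convexity: the tangent is taken at the perturbed point, and uniform
  -- continuity replaces its slope by the slope at a. No second derivative is used, as p may be
  -- below 2.
  have hstep : ∀ {a r : ℝ}, |a| ≤ 1 → |r| ≤ (C + 1) * (R + 1) →
      |a + θ * r| ^ p ≤ |a| ^ p + p * θ * (φ a * r + ε * |r|) := by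
    intro a r ha hr
    have h1 : |θ * r| ≤ min ν 1 := by
      rw [abs_mul, abs_of_pos hθ0, ← hθmul]
      exact mul_le_mul_of_nonneg_left hr hθ0.le
    have h2 : |a + θ * r| ≤ 2 := (abs_add_le _ _).trans (by linarith [min_le_right ν 1])
    have h3 := hunif (a + θ * r) (abs_le.1 h2) a (abs_le.1 (by linarith)) (by
      rw [Real.dist_eq, add_sub_cancel_left]; exact h1.trans (min_le_left _ _))
    rw [Real.dist_eq] at h3
    have h4 := tangent_le_abs_rpow hp1 (a + θ * r) a
    have h5 : φ (a + θ * r) * r ≤ φ a * r + ε * |r| := by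
      have h6 := (le_abs_self _).trans_eq (abs_mul (φ (a + θ * r) - φ a) r)
      have h7 := mul_le_mul_of_nonneg_right h3 (abs_nonneg r)
      linarith
    have h8 := mul_le_mul_of_nonneg_left h5 (show 0 ≤ p * θ by positivity)
    change _ + p * φ (a + θ * r) * _ ≤ _ at h4
    linarith
  refine ⟨θ, hθ0, p * θ * (μ / 2), by positivity, fun q e v he hv he1 hvC hA hslope => ?_⟩
  have hCR : C ≤ (C + 1) * (R + 1) := by nlinarith
  have hei : IntervalIntegrable e volume 0 T := intervalIntegrable_of_abs_le he T.coe_nonneg he1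
  have hvi : IntervalIntegrable v volume 0 T := intervalIntegrable_of_abs_le hv T.coe_nonneg hvC
  have hρe := hei.continuousOn_mul h.rate_continuous.continuousOn
  have hρv := hvi.continuousOn_mul h.rate_continuous.continuousOn
  obtain ⟨B, hB⟩ := (isCompact_Icc (a := (-1 : ℝ)) (b := 1)).exists_bound_of_continuousOn
    hφc.continuousOn
  have hφv : IntervalIntegrable (fun s => φ (e s) * v s) volume 0 T :=
    intervalIntegrable_of_abs_le ((hφc.measurable.comp he).mul hv) T.coe_nonneg (C := B * C)
      fun s hs => by
        rw [Pi.mul_apply, abs_mul]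
        exact mul_le_mul (hB _ (abs_le.1 (he1 s hs))) (hvC s hs) (abs_nonneg _)
          ((norm_nonneg _).trans (hB _ (abs_le.1 (he1 s hs))))
  obtain ⟨B', hB'⟩ := (isCompact_Icc (a := -(1 + θ * C)) (b := 1 + θ * C)).exists_bound_of_continuousOn
    hHc.continuousOn
  have hHe : IntervalIntegrable (fun s => |e s| ^ p) volume 0 T :=
    intervalIntegrable_of_abs_le (hHc.measurable.comp he) T.coe_nonneg fun s hs =>
      hB' _ (abs_le.1 ((he1 s hs).trans (le_add_of_nonneg_right (by positivity))))
  have hHev : IntervalIntegrable (fun s => |e s + θ * v s| ^ p) volume 0 T :=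
    intervalIntegrable_of_abs_le (hHc.measurable.comp (he.add (hv.const_mul θ))) T.coe_nonneg
      fun s hs => hB' _ (abs_le.1 ((abs_add_le _ _).trans (add_le_add (he1 s hs) (by
        rw [abs_mul, abs_of_pos hθ0]
        exact mul_le_mul_of_nonneg_left (hvC s hs) hθ0.le))))
  set r := ∫ s in (0 : ℝ)..T, ρ s * v s with hr
  have hrC : |r| ≤ C * R := by
    rw [hr, hR, ← Real.norm_eq_abs, ← intervalIntegral.integral_const_mul]
    refine intervalIntegral.norm_integral_le_of_norm_le T.coe_nonneg
      (Eventually.of_forall fun s hs => ?_)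
      ((h.rate_continuous.const_mul C).intervalIntegrable _ _)
    rw [norm_mul, Real.norm_eq_abs, Real.norm_eq_abs, abs_of_pos (h.rate_pos s), mul_comm]
    exact mul_le_mul_of_nonneg_right (hvC s hs) (h.rate_pos s).le
  have hlast := hstep hA (hrC.trans (by nlinarith : C * R ≤ (C + 1) * (R + 1)))
  have hlast' : W * |q + ∫ s in (0 : ℝ)..T, ρ s * (e s + θ * v s)| ^ p ≤
      W * |q + ∫ s in (0 : ℝ)..T, ρ s * e s| ^ p +
        p * θ * (W * (φ (q + ∫ s in (0 : ℝ)..T, ρ s * e s) * r) + ε * (W * (C * R))) := by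
    have h1 : q + ∫ s in (0 : ℝ)..T, ρ s * (e s + θ * v s) =
        q + (∫ s in (0 : ℝ)..T, ρ s * e s) + θ * r := by
      rw [hr, ← intervalIntegral.integral_const_mul, add_assoc,
        ← intervalIntegral.integral_add hρe (hρv.const_mul θ)]
      congr 1
      exact intervalIntegral.integral_congr fun s _ => by ring
    rw [h1]
    have h2 := mul_le_mul_of_nonneg_left hlast hW0.le
    have h3 : p * θ * W * ε * |r| ≤ p * θ * W * ε * (C * R) :=
      mul_le_mul_of_nonneg_left hrC (by positivity)
    linarith
  have hrun : ∫ s in (0 : ℝ)..T, k s * |e s + θ * v s| ^ p ≤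
      (∫ s in (0 : ℝ)..T, k s * |e s| ^ p) +
        p * θ * ((∫ s in (0 : ℝ)..T, k s * (φ (e s) * v s)) + ε * (C * N)) := by
    have i1 := hHe.continuousOn_mul hkc.continuousOn
    have i2 := hφv.continuousOn_mul hkc.continuousOn
    have i3 : IntervalIntegrable (fun s => ε * (C * k s)) volume 0 T :=
      ((hkc.const_mul C).const_mul ε).intervalIntegrable _ _
    have h1 : (∫ s in (0 : ℝ)..T, k s * |e s| ^ p) +
        p * θ * ((∫ s in (0 : ℝ)..T, k s * (φ (e s) * v s)) + ε * (C * N)) =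
        ∫ s in (0 : ℝ)..T, (k s * |e s| ^ p +
          p * θ * (k s * (φ (e s) * v s) + ε * (C * k s))) := by
      rw [intervalIntegral.integral_add i1 ((i2.add i3).const_mul _),
        intervalIntegral.integral_const_mul, intervalIntegral.integral_add i2 i3,
        intervalIntegral.integral_const_mul, intervalIntegral.integral_const_mul]
    rw [h1]
    refine intervalIntegral.integral_mono_on_of_le_Ioo T.coe_nonneg
      (hHev.continuousOn_mul hkc.continuousOn) (i1.add ((i2.add i3).const_mul _)) fun s hs => ?_
    have hs' := Ioo_subset_Ioc_self hs
    have h2 := mul_le_mul_of_nonneg_left (hstep (he1 s hs') ((hvC s hs').trans hCR))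
      (hk s (Ioo_subset_Icc_self hs))
    have h3 : p * θ * k s * ε * |v s| ≤ p * θ * k s * ε * C :=
      mul_le_mul_of_nonneg_left (hvC s hs') (by have := hk s (Ioo_subset_Icc_self hs); positivity)
    linarith
  have h1 := mul_le_mul_of_nonneg_left (show
    (W * (φ (q + ∫ s in (0 : ℝ)..T, ρ s * e s) * r) +
      ∫ s in (0 : ℝ)..T, k s * (φ (e s) * v s)) + ε * D ≤ -(μ / 2) by linarith)
    (show 0 ≤ p * θ by positivity)
  have h2 : ε * D = ε * (W * (C * R)) + ε * (C * N) := by rw [hD]; ring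
  rw [h2] at h1
  change W * _ + _ ≤ W * _ + (∫ s in (0 : ℝ)..T, k s * |e s| ^ p) - _
  linarith

end Descent

/-! ### Existence of manipulation -/

section Necessity

variable {Ω : Type*} [mΩ : MeasurableSpace Ω] {P : Measure Ω} [IsProbabilityMeasure P]
  {ℱ : Filtration ℝ≥0 mΩ} {S : ℝ≥0 → Ω → ℝ} {γ : ℝ} {ρ lam lam' : ℝ → ℝ} {T : ℝ≥0}

theorem exists_Icc_subset_of_mem_nhds {U : Set ℝ} {t : ℝ} (hT : 0 < T) (ht : t ∈ Icc (0 : ℝ) T)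
    (hU : U ∈ 𝓝 t) : ∃ a b : ℝ≥0, a < b ∧ b ≤ T ∧ Icc (a : ℝ) b ⊆ U := by
  obtain ⟨ε, hε, hball⟩ := Metric.mem_nhds_iff.1 hU
  have hT' : (0 : ℝ) < T := hT
  have ha : (0 : ℝ) ≤ max 0 (t - ε / 2) := le_max_left _ _
  have hb : (0 : ℝ) ≤ min (T : ℝ) (t + ε / 2) := le_min T.coe_nonneg (by linarith [ht.1])
  refine ⟨⟨_, ha⟩, ⟨_, hb⟩, ?_, ?_, fun s hs => hball ?_⟩
  · change max 0 (t - ε / 2) < min (T : ℝ) (t + ε / 2)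
    exact max_lt (lt_min hT' (by linarith [ht.1])) (lt_min (by linarith [ht.2]) (by linarith))
  · change min (T : ℝ) (t + ε / 2) ≤ T
    exact min_le_left _ _
  · have h1 : t - ε / 2 ≤ s := (le_max_right _ _).trans hs.1
    have h2 : s ≤ t + ε / 2 := hs.2.trans (min_le_right _ _)
    rw [Metric.mem_ball, Real.dist_eq, abs_lt]
    constructor <;> linarith

theorem integral_mul_indicator_Ioc_of_le (φ : ℝ → ℝ) {a b T : ℝ≥0} (hab : a ≤ b) (hbT : b ≤ T) :
    ∫ s in (0 : ℝ)..T, φ s * (Ioc (a : ℝ) b).indicator 1 s = ∫ s in (a : ℝ)..b, φ s := by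
  rw [integral_mul_indicator_Ioc φ a.coe_nonneg T.coe_nonneg, min_eq_left (NNReal.coe_le_coe.2 hbT),
    max_eq_right (NNReal.coe_le_coe.2 hab)]

theorem intervalIntegrable_mul_indicator_Ioc {φ : ℝ → ℝ} {c d : ℝ}
    (hφ : IntervalIntegrable φ volume c d) (a b : ℝ) :
    IntervalIntegrable (fun s => φ s * (Ioc a b).indicator 1 s) volume c d := by
  have h1 : (fun s => φ s * (Ioc a b).indicator 1 s) = (Ioc a b).indicator φ := by
    ext s
    by_cases h : s ∈ Ioc a b <;> simp [h]
  rw [h1, intervalIntegrable_iff]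
  exact (intervalIntegrable_iff.1 hφ).indicator measurableSet_Ioc

theorem abs_indicator_one_le (A : Set ℝ) (s : ℝ) : |A.indicator (1 : ℝ → ℝ) s| ≤ 1 := by
  by_cases h : s ∈ A <;> simp [h]

theorem integral_rate_pos (h : RegularCoefficients ρ lam lam') {a b : ℝ≥0} (hab : a < b) :
    0 < ∫ s in (a : ℝ)..b, ρ s :=
  intervalIntegral.intervalIntegral_pos_of_pos (h.rate_continuous.intervalIntegrable _ _)
    h.rate_pos hab

/-- The impact cost after adding two blocks to a path. -/
theorem pathImpactCost_add_blocks (h : RegularCoefficients ρ lam lam') {q : ℝ} {y : ℝ≥0 → ℝ}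
    (hy : IsLiquidationPath T q y) {a b a' b' : ℝ≥0} (hab : a ≤ b) (hbT : b ≤ T) (hab' : a' ≤ b')
    (hbT' : b' ≤ T) (c c' : ℝ) :
    ∃ x, IsLiquidationPath T q x ∧ pathImpactCost γ ρ lam lam' T q x =
      impactCost γ ρ lam lam' T q fun s => volumeImpact ρ y s.toNNReal +
        (c * (Ioc (a : ℝ) b).indicator 1 s - c' * (Ioc (a' : ℝ) b').indicator 1 s) := by
  have hρ0 : ∀ t, 0 ≤ ρ t := fun t => (h.rate_pos t).le
  have hB := isLiquidationPath_blockPath h.rate_continuous hρ0 hab hbT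
  have hB' := isLiquidationPath_blockPath h.rate_continuous hρ0 hab' hbT'
  have hx := (hy.add_smul hB c).add_smul hB' (-c')
  simp only [mul_zero, add_zero] at hx
  refine ⟨_, hx, impactCost_congr fun s hs => ?_⟩
  have hs' : s.toNNReal ≤ T := Real.toNNReal_le_iff_le_coe.2 hs.2
  rw [volumeImpact_add_smul h.rate_continuous (hy.add_smul hB c).boundedVariation
      hB'.boundedVariation,
    volumeImpact_add_smul h.rate_continuous hy.boundedVariation hB.boundedVariation,
    volumeImpact_blockPath h.rate_continuous hρ0 hab hbT hs',
    volumeImpact_blockPath h.rate_continuous hρ0 hab' hbT' hs', Real.coe_toNNReal s hs.1.le]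
  ring

theorem isLiquidationPath_zero : IsLiquidationPath T 0 (0 : ℝ≥0 → ℝ) where
  boundedVariation := (monotoneOn_const (c := (0 : ℝ))).boundedVariationOn (C := 0)
    fun _ _ => abs_zero.le
  leftContinuous _ := continuousWithinAt_const
  initial := rfl
  terminal _ _ := rfl

theorem volumeImpact_zero_path (ρ : ℝ → ℝ) (t : ℝ≥0) : volumeImpact ρ 0 t = 0 := by
  simp [volumeImpact]

/-- Impact of one sign followed by impact of the other sign, both inside an interval where k < 0,
costs nothing at T if the two weighted masses cancel. -/
theorem exists_pathImpactCost_neg (hγ : -1 < γ) (h : RegularCoefficients ρ lam lam') (hT : 0 < T)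
    {t : ℝ} (ht : t ∈ Icc (0 : ℝ) T) (hk : runningWeight γ ρ lam lam' t < 0) :
    ∃ x, IsLiquidationPath T 0 x ∧ pathImpactCost γ ρ lam lam' T 0 x < 0 := by
  have hkc : Continuous (runningWeight γ ρ lam lam') := continuous_runningWeight h
  obtain ⟨a, b, hab, hbT, hneg⟩ := exists_Icc_subset_of_mem_nhds hT ht
    ((isOpen_Iio.preimage hkc).mem_nhds hk)
  obtain ⟨m, ham, hmb⟩ := exists_between hab
  set r := ∫ s in (a : ℝ)..m, ρ s with hr
  set r' := ∫ s in (m : ℝ)..b, ρ s with hr'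
  have hr0 : 0 < r := integral_rate_pos h ham
  have hr0' : 0 < r' := integral_rate_pos h hmb
  -- Heights inverse to the ρ-masses of the two halves give ∫ ρ v = 0 once the second block is
  -- subtracted.
  obtain ⟨x, hx, hcost⟩ := pathImpactCost_add_blocks (γ := γ) h (isLiquidationPath_zero (T := T))
    ham.le (hmb.le.trans hbT) hmb.le hbT r⁻¹ r'⁻¹
  refine ⟨x, hx, ?_⟩
  rw [hcost]
  simp only [volumeImpact_zero_path, zero_add]
  set v : ℝ → ℝ := fun s => r⁻¹ * (Ioc (a : ℝ) m).indicator 1 s -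
    r'⁻¹ * (Ioc (m : ℝ) b).indicator 1 s with hv
  have hp : 1 < costExponent γ := one_lt_costExponent hγ
  have h1 : ∫ s in (0 : ℝ)..T, ρ s * v s = 0 := by
    have hi := h.rate_continuous.intervalIntegrable (μ := volume) 0 (T : ℝ)
    have h2 : (fun s => ρ s * v s) = fun s => r⁻¹ * (ρ s * (Ioc (a : ℝ) m).indicator 1 s) -
        r'⁻¹ * (ρ s * (Ioc (m : ℝ) b).indicator 1 s) := by
      ext s; simp only [hv]; ring
    rw [h2, intervalIntegral.integral_sub ((intervalIntegrable_mul_indicator_Ioc hi _ _).const_mul _)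
      ((intervalIntegrable_mul_indicator_Ioc hi _ _).const_mul _),
      intervalIntegral.integral_const_mul, intervalIntegral.integral_const_mul,
      integral_mul_indicator_Ioc_of_le _ ham.le (hmb.le.trans hbT),
      integral_mul_indicator_Ioc_of_le _ hmb.le hbT, ← hr, ← hr', inv_mul_cancel₀ hr0.ne',
      inv_mul_cancel₀ hr0'.ne', sub_self]
  have hvab : ∀ s ∉ Ioc (a : ℝ) b, v s = 0 := by
    intro s hs
    have h2 : s ∉ Ioc (a : ℝ) m := fun hs' => hs ⟨hs'.1, hs'.2.trans hmb.le⟩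
    have h3 : s ∉ Ioc (m : ℝ) b := fun hs' => hs ⟨lt_trans (NNReal.coe_lt_coe.2 ham) hs'.1, hs'.2⟩
    simp [hv, h2, h3]
  have hvne : ∀ s ∈ Ioc (a : ℝ) b, v s ≠ 0 := by
    intro s hs
    rcases le_or_gt s m with hsm | hsm
    · have h2 : s ∈ Ioc (a : ℝ) m := ⟨hs.1, hsm⟩
      have h3 : s ∉ Ioc (m : ℝ) b := fun hs' => hs'.1.not_ge hsm
      simp [hv, h2, h3, hr0.ne']
    · have h2 : s ∉ Ioc (a : ℝ) m := fun hs' => hsm.not_ge hs'.2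
      have h3 : s ∈ Ioc (m : ℝ) b := ⟨hsm, hs.2⟩
      simp [hv, h2, h3, hr0'.ne']
  have hvm : Measurable v := ((measurable_one.indicator measurableSet_Ioc).const_mul _).sub
    ((measurable_one.indicator measurableSet_Ioc).const_mul _)
  have hvb : ∀ s, |v s| ≤ r⁻¹ + r'⁻¹ := by
    intro s
    refine (abs_sub _ _).trans (add_le_add ?_ ?_)
    · rw [abs_mul, abs_of_pos (inv_pos.2 hr0)]
      exact mul_le_of_le_one_right (inv_pos.2 hr0).le (abs_indicator_one_le _ _)
    · rw [abs_mul, abs_of_pos (inv_pos.2 hr0')]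
      exact mul_le_of_le_one_right (inv_pos.2 hr0').le (abs_indicator_one_le _ _)
  have h2 : ∫ s in (0 : ℝ)..T, runningWeight γ ρ lam lam' s * |v s| ^ costExponent γ =
      ∫ s in (a : ℝ)..b, runningWeight γ ρ lam lam' s * |v s| ^ costExponent γ := by
    rw [← integral_mul_indicator_Ioc_of_le _ hab.le hbT]
    refine intervalIntegral.integral_congr fun s _ => ?_
    by_cases hs : s ∈ Ioc (a : ℝ) b
    · simp [hs]
    · simp [hs, hvab s hs, Real.zero_rpow (by linarith : costExponent γ ≠ 0)]
  have h3 : 0 < ∫ s in (a : ℝ)..b, -(runningWeight γ ρ lam lam' s * |v s| ^ costExponent γ) := by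
    refine intervalIntegral.intervalIntegral_pos_of_pos_on ?_ (fun s hs => ?_) hab
    · refine IntervalIntegrable.neg (IntervalIntegrable.continuousOn_mul ?_ hkc.continuousOn)
      refine intervalIntegrable_of_abs_le (hvm.abs.pow_const _) (NNReal.coe_le_coe.2 hab.le)
        (C := (r⁻¹ + r'⁻¹) ^ costExponent γ) fun s _ => ?_
      rw [abs_of_nonneg (Real.rpow_nonneg (abs_nonneg _) _)]
      exact Real.rpow_le_rpow (abs_nonneg _) (hvb s) (by linarith)
    · have h4 : runningWeight γ ρ lam lam' s < 0 := hneg (Ioo_subset_Icc_self hs)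
      have h5 := Real.rpow_pos_of_pos (abs_pos.2 (hvne s (Ioo_subset_Ioc_self hs))) (costExponent γ)
      nlinarith
  rw [intervalIntegral.integral_neg] at h3
  rw [impactCost, h1, h2, add_zero, abs_zero, Real.zero_rpow (by linarith), mul_zero, zero_add]
  linarith

/-- A monotone path from 0 to 0 never trades and costs nothing, so any round trip of negative cost
beats all monotone ones. -/
theorem hasTTPM_of_pathImpactCost_neg (hS : Martingale S ℱ P)
    (hSr : ∀ᵐ ω ∂P, ∀ t, ContinuousWithinAt (fun s => S s ω) (Ici t) t)
    (hγ : -1 < γ) (h : RegularCoefficients ρ lam lam') (hT : 0 < T) {x : ℝ≥0 → ℝ}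
    (hx : IsLiquidationPath T 0 x) (hneg : pathImpactCost γ ρ lam lam' T 0 x < 0) :
    HasTTPM P ℱ S (powerLaw γ) ρ lam T := by
  refine hasTTPM_of_lt hS hSr hγ h hT (m := 0) (fun y hy hmono => ?_) hx hneg
  have hy0 : y = 0 := by
    ext t
    have h1 : y (max t (T + 1)) = 0 :=
      hy.terminal _ (lt_max_of_lt_right (lt_add_of_pos_right T one_pos))
    rcases hmono with hm | hm
    · exact le_antisymm ((hm zero_le).trans_eq hy.initial) (h1.ge.trans (hm (le_max_left _ _)))
    · exact le_antisymm ((hm (le_max_left _ _)).trans_eq h1) (hy.initial.ge.trans (hm zero_le))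
  have hp : 1 < costExponent γ := one_lt_costExponent hγ
  simp only [hy0, pathImpactCost, impactCost, volumeImpact_zero_path, mul_zero, abs_zero,
    intervalIntegral.integral_zero, add_zero, Real.zero_rpow (by linarith : costExponent γ ≠ 0)]
  exact le_rfl

/-- If the impact of every monotone purchase can be lowered by one of two fixed pairs of blocks,
monotone purchases are not optimal. -/
theorem hasTTPM_of_blocks (hS : Martingale S ℱ P)
    (hSr : ∀ᵐ ω ∂P, ∀ t, ContinuousWithinAt (fun s => S s ω) (Ici t) t)
    (hγ : -1 < γ) (h : RegularCoefficients ρ lam lam') (hT : 0 < T)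
    (hk : ∀ t ∈ Icc (0 : ℝ) T, 0 ≤ runningWeight γ ρ lam lam' t)
    {a b a' b' : ℝ≥0} (hab : a < b) (hbT : b ≤ T) (hab' : a' < b') (hbT' : b' ≤ T) {μ : ℝ}
    (hμ : 0 < μ)
    (hdir : ∀ e, IsBuyImpact ρ T e →
      (∀ s ∈ Icc (a : ℝ) b, runningWeight γ ρ lam lam' s * e s ^ (costExponent γ - 1) ≤
        (costWeight γ (lam T) * (1 - ∫ s in (0 : ℝ)..T, ρ s * e s) ^ (costExponent γ - 1) - μ) *
          ρ s) ∨
      ∃ u, (∀ s ∈ Icc (a : ℝ) b,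
          runningWeight γ ρ lam lam' s * e s ^ (costExponent γ - 1) ≤ u * ρ s) ∧
        ∀ s ∈ Icc (a' : ℝ) b',
          (u + μ) * ρ s ≤ runningWeight γ ρ lam lam' s * e s ^ (costExponent γ - 1)) :
    HasTTPM P ℱ S (powerLaw γ) ρ lam T := by
  set p := costExponent γ with hp
  have hp1 : 1 < p := one_lt_costExponent hγ
  set φ := signedRPow (p - 1) with hφ
  have hφc : Continuous φ := continuous_signedRPow (by linarith)
  have hφp : ∀ z, 0 ≤ z → φ z = z ^ (p - 1) := fun z hz =>
    signedRPow_of_nonneg (by linarith) hz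
  set k := runningWeight γ ρ lam lam' with hkdef
  have hkc : Continuous k := continuous_runningWeight h
  have hρ0 : ∀ t, 0 ≤ ρ t := fun t => (h.rate_pos t).le
  set r := ∫ s in (a : ℝ)..b, ρ s with hr
  set r' := ∫ s in (a' : ℝ)..b', ρ s with hr'
  have hr0 : 0 < r := integral_rate_pos h hab
  have hr0' : 0 < r' := integral_rate_pos h hab'
  obtain ⟨θ, hθ, δ, hδ, hdesc⟩ := exists_uniform_descent hγ h hk hμ
    (C := r⁻¹ + r'⁻¹) (by positivity)
  set 𝒞 := {c : ℝ | ∃ y, IsLiquidationPath T (-1) y ∧ (Antitone y ∨ Monotone y) ∧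
    c = pathImpactCost γ ρ lam lam' T (-1) y} with h𝒞
  have hne : 𝒞.Nonempty := by
    have h1 : BoundedVariationOn (fun _ : ℝ≥0 => (-1 : ℝ)) univ :=
      (monotoneOn_const (c := (-1 : ℝ))).boundedVariationOn (C := |-1|) fun _ _ => le_rfl
    refine ⟨_, (fun _ => -1) + (1 : ℝ) • (Ioi T).indicator 1, ⟨boundedVariationOn_add_smul h1
      (boundedVariationOn_indicator_Ioi T) 1, fun t => continuousWithinAt_const.add
        ((leftContinuous_indicator_Ioi T t).const_smul (1 : ℝ)), by simp, fun t ht => by simp [ht]⟩,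
      Or.inr ?_, rfl⟩
    rw [one_smul]
    exact monotone_const.add (monotone_indicator_Ioi T)
  have hbdd : BddBelow 𝒞 := ⟨0, by
    rintro c ⟨y, -, -, rfl⟩
    exact pathImpactCost_nonneg hγ h hk _ _⟩
  -- The gain δ was fixed before choosing y, so a monotone path within δ of the infimum is improved
  -- strictly below it.
  obtain ⟨c, ⟨y, hy, hymono, rfl⟩, hlt⟩ := exists_lt_of_csInf_lt hne
    (lt_add_of_pos_right (sInf 𝒞) hδ)
  suffices hsuff : ∃ x, IsLiquidationPath T (-1) x ∧ pathImpactCost γ ρ lam lam' T (-1) x ≤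
      pathImpactCost γ ρ lam lam' T (-1) y - δ by
    obtain ⟨x, hx, hxy⟩ := hsuff
    refine hasTTPM_of_lt hS hSr hγ h hT (m := sInf 𝒞)
      (fun z hz hzm => csInf_le hbdd ⟨z, hz, hzm, rfl⟩) hx (by linarith)
  have hym : Monotone y := by
    refine hymono.resolve_left fun hanti => ?_
    have h1 := hanti (zero_le : 0 ≤ T + 1)
    rw [hy.initial, hy.terminal _ (lt_add_of_pos_right T one_pos)] at h1
    linarith
  have he := hy.isBuyImpact h.rate_continuous hρ0 hym
  set e : ℝ → ℝ := fun t => volumeImpact ρ y t.toNNReal with hedef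
  have he1 : ∀ s ∈ Ioc (0 : ℝ) T, |e s| ≤ 1 := fun s hs => by
    rw [abs_of_nonneg (he.nonneg s (Ioc_subset_Icc_self hs))]
    exact he.le_one s (Ioc_subset_Icc_self hs)
  set L := 1 - ∫ s in (0 : ℝ)..T, ρ s * e s with hL
  have hL0 : 0 < L := by
    by_contra! hcon
    have h1 := he.le_exp_mul_last
    have h2 := mul_nonpos_of_nonneg_of_nonpos (Real.exp_pos (cumRate ρ T)).le hcon
    linarith
  have hA : -1 + ∫ s in (0 : ℝ)..T, ρ s * e s = -L := by rw [hL]; ring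
  have hφA : φ (-1 + ∫ s in (0 : ℝ)..T, ρ s * e s) = -L ^ (p - 1) := by
    rw [hA, hφ, signedRPow_neg, signedRPow_of_nonneg (by linarith) hL0.le]
  obtain ⟨B, hB⟩ := (isCompact_Icc (a := (-1 : ℝ)) (b := 1)).exists_bound_of_continuousOn
    hφc.continuousOn
  have hkφ : IntervalIntegrable (fun s => k s * φ (e s)) volume 0 T :=
    (intervalIntegrable_of_abs_le (hφc.measurable.comp he.measurable) T.coe_nonneg
      fun s hs => hB _ (abs_le.1 (he1 s hs))).continuousOn_mul hkc.continuousOn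
  have hsplit : ∀ {f : ℝ → ℝ} (c' : ℝ), IntervalIntegrable f volume 0 T →
      ∫ s in (0 : ℝ)..T, f s * (r⁻¹ * (Ioc (a : ℝ) b).indicator 1 s -
        c' * (Ioc (a' : ℝ) b').indicator 1 s) =
      r⁻¹ * (∫ s in (a : ℝ)..b, f s) - c' * ∫ s in (a' : ℝ)..b', f s := by
    intro f c' hf
    have h1 : (fun s => f s * (r⁻¹ * (Ioc (a : ℝ) b).indicator 1 s -
        c' * (Ioc (a' : ℝ) b').indicator 1 s)) = fun s =>
        r⁻¹ * (f s * (Ioc (a : ℝ) b).indicator 1 s) -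
        c' * (f s * (Ioc (a' : ℝ) b').indicator 1 s) := by
      ext s; ring
    rw [h1, intervalIntegral.integral_sub ((intervalIntegrable_mul_indicator_Ioc hf _ _).const_mul _)
      ((intervalIntegrable_mul_indicator_Ioc hf _ _).const_mul _),
      intervalIntegral.integral_const_mul, intervalIntegral.integral_const_mul,
      integral_mul_indicator_Ioc_of_le _ hab.le hbT,
      integral_mul_indicator_Ioc_of_le _ hab'.le hbT']
  -- Taking c' = 0 moves impact from the last trade to [a, b]; taking c' = r'⁻¹ moves it from [a',
  -- b'] to [a, b] and leaves the last trade unchanged.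
  have hmain : ∀ c', 0 ≤ c' → c' ≤ r'⁻¹ →
      -(costWeight γ (lam T) * L ^ (p - 1) * (1 - c' * r')) +
        (r⁻¹ * (∫ s in (a : ℝ)..b, k s * φ (e s)) - c' * ∫ s in (a' : ℝ)..b', k s * φ (e s)) ≤ -μ →
      ∃ x, IsLiquidationPath T (-1) x ∧ pathImpactCost γ ρ lam lam' T (-1) x ≤
        pathImpactCost γ ρ lam lam' T (-1) y - δ := by
    intro c' hc0 hc hslope
    obtain ⟨x, hx, hcost⟩ := pathImpactCost_add_blocks (γ := γ) h hy hab.le hbT hab'.le hbT'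
      (θ * r⁻¹) (θ * c')
    refine ⟨x, hx, ?_⟩
    rw [hcost]
    have h1 := hdesc (-1) e (fun s => r⁻¹ * (Ioc (a : ℝ) b).indicator 1 s -
        c' * (Ioc (a' : ℝ) b').indicator 1 s) he.measurable
      (((measurable_one.indicator measurableSet_Ioc).const_mul _).sub
        ((measurable_one.indicator measurableSet_Ioc).const_mul _)) he1 (fun s _ => ?_) ?_ ?_
    · convert h1 using 3 with s
      · ring
      · rfl
    · refine (abs_sub _ _).trans (add_le_add ?_ ?_)
      · rw [abs_mul, abs_of_pos (inv_pos.2 hr0)]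
        exact mul_le_of_le_one_right (inv_pos.2 hr0).le (abs_indicator_one_le _ _)
      · rw [abs_mul, abs_of_nonneg hc0]
        exact (mul_le_of_le_one_right hc0 (abs_indicator_one_le _ _)).trans hc
    · rw [hA, abs_neg, abs_of_pos hL0]
      exact he.last_le_one
    · have h2 : ∫ s in (0 : ℝ)..T, k s * (φ (e s) * (r⁻¹ * (Ioc (a : ℝ) b).indicator 1 s -
          c' * (Ioc (a' : ℝ) b').indicator 1 s)) = r⁻¹ * (∫ s in (a : ℝ)..b, k s * φ (e s)) -
          c' * ∫ s in (a' : ℝ)..b', k s * φ (e s) := by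
        rw [← hsplit c' hkφ]
        exact intervalIntegral.integral_congr fun s _ => by simp only [mul_assoc]
      rw [h2, hsplit c' (h.rate_continuous.intervalIntegrable _ _), ← hr, ← hr',
        inv_mul_cancel₀ hr0.ne']
      change _ * (φ _ * _) + _ ≤ _
      rw [hφA]
      linarith
  have hsub : ∀ {a b : ℝ≥0}, a < b → b ≤ T → ∀ s ∈ Icc (a : ℝ) b, s ∈ Icc (0 : ℝ) T :=
    fun _ hbT s hs => ⟨(NNReal.coe_nonneg _).trans hs.1, hs.2.trans hbT⟩
  have hint : ∀ {a b : ℝ≥0}, a < b → b ≤ T →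
      IntervalIntegrable (fun s => k s * φ (e s)) volume a b := fun {a b} hab hbT =>
    hkφ.mono_set (by
      rw [uIcc_of_le (NNReal.coe_le_coe.2 hab.le), uIcc_of_le T.coe_nonneg]
      exact hsub hab hbT)
  have hupper : ∀ u, (∀ s ∈ Icc (a : ℝ) b, k s * e s ^ (p - 1) ≤ u * ρ s) →
      r⁻¹ * (∫ s in (a : ℝ)..b, k s * φ (e s)) ≤ u := by
    intro u hu
    rw [inv_mul_le_iff₀ hr0, mul_comm, hr, ← intervalIntegral.integral_const_mul]
    refine intervalIntegral.integral_mono_on (NNReal.coe_le_coe.2 hab.le) (hint hab hbT)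
      ((h.rate_continuous.const_mul u).intervalIntegrable _ _) fun s hs => ?_
    rw [hφp _ (he.nonneg s (hsub hab hbT s hs))]
    exact hu s hs
  rcases hdir e he with hcase | ⟨u, hu, hu'⟩
  · refine hmain 0 le_rfl (inv_pos.2 hr0').le ?_
    have h1 := hupper _ hcase
    linarith
  · refine hmain r'⁻¹ (inv_pos.2 hr0').le le_rfl ?_
    rw [inv_mul_cancel₀ hr0'.ne']
    have h1 := hupper u hu
    have h2 : u + μ ≤ r'⁻¹ * ∫ s in (a' : ℝ)..b', k s * φ (e s) := by
      rw [le_inv_mul_iff₀ hr0', mul_comm, hr', ← intervalIntegral.integral_const_mul]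
      refine intervalIntegral.integral_mono_on (NNReal.coe_le_coe.2 hab'.le)
        ((h.rate_continuous.const_mul _).intervalIntegrable _ _) (hint hab' hbT') fun s hs => ?_
      rw [hφp _ (he.nonneg s (hsub hab' hbT' s hs))]
      exact hu' s hs
    linarith

end Necessity

/-! ### Characterization for a fixed horizon -/

section FixedHorizon

variable {Ω : Type*} [mΩ : MeasurableSpace Ω] {P : Measure Ω} [IsProbabilityMeasure P]
  {ℱ : Filtration ℝ≥0 mΩ} {S : ℝ≥0 → Ω → ℝ} {γ : ℝ} {ρ lam lam' : ℝ → ℝ} {T : ℝ≥0}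

theorem IsBuyImpact.exp_neg_le_last {e : ℝ → ℝ} (he : IsBuyImpact ρ T e) :
    Real.exp (-cumRate ρ T) ≤ 1 - ∫ s in (0 : ℝ)..T, ρ s * e s := by
  have h1 := mul_le_mul_of_nonneg_left he.le_exp_mul_last (Real.exp_pos (-cumRate ρ T)).le
  rwa [mul_one, ← mul_assoc, ← Real.exp_add, neg_add_cancel, Real.exp_zero, one_mul] at h1

/-- For a purchase the impact at s is at most e^{∫_s^T ρ} times the final one, since it can only
decay by resilience. Under the hypothesis, marginal cost near t is then below that of the last
trade, whatever the purchase. This serves both for k(t) = 0 and, at t = T, for ζ(T) > 1. -/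
theorem hasTTPM_of_runningWeight_lt (hS : Martingale S ℱ P)
    (hSr : ∀ᵐ ω ∂P, ∀ t, ContinuousWithinAt (fun s => S s ω) (Ici t) t)
    (hγ : -1 < γ) (h : RegularCoefficients ρ lam lam') (hT : 0 < T)
    (hk : ∀ t ∈ Icc (0 : ℝ) T, 0 ≤ runningWeight γ ρ lam lam' t) {t : ℝ} (ht : t ∈ Icc (0 : ℝ) T)
    (hlt : runningWeight γ ρ lam lam' t *
      Real.exp ((cumRate ρ T - cumRate ρ t) * (costExponent γ - 1)) < costWeight γ (lam T) * ρ t) :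
    HasTTPM P ℱ S (powerLaw γ) ρ lam T := by
  set p := costExponent γ with hp
  have hp1 : 1 < p := one_lt_costExponent hγ
  set k := runningWeight γ ρ lam lam' with hkdef
  have hkc : Continuous k := continuous_runningWeight h
  set W := costWeight γ (lam T) with hW
  set u : ℝ → ℝ := fun s => k s * Real.exp ((cumRate ρ T - cumRate ρ s) * (p - 1)) with hu
  have huc : Continuous u := hkc.mul (Real.continuous_exp.comp
    ((continuous_const.sub (continuous_cumRate h.rate_continuous)).mul_const _))
  obtain ⟨c, hc1, hc2⟩ := exists_between ((div_lt_iff₀ (h.rate_pos t)).2 hlt)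
  rw [div_lt_iff₀ (h.rate_pos t)] at hc1
  obtain ⟨a, b, hab, hbT, hsub⟩ := exists_Icc_subset_of_mem_nhds hT ht
    ((isOpen_lt huc (h.rate_continuous.const_mul c)).mem_nhds hc1)
  have hν : 0 < W - c := by linarith
  refine hasTTPM_of_blocks hS hSr hγ h hT hk hab hbT hab hbT
    -- Uniform because the first share bought leaves at least e^{-∫ρ} of impact after the last
    -- trade.
    (μ := (W - c) * Real.exp (-cumRate ρ T) ^ (p - 1)) (by positivity) fun e he => Or.inl ?_
  set L := 1 - ∫ s in (0 : ℝ)..T, ρ s * e s with hL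
  have hLe : Real.exp (-cumRate ρ T) ≤ L := he.exp_neg_le_last
  have hL0 : 0 < L := (Real.exp_pos _).trans_le hLe
  intro s hs
  have hs' : s ∈ Icc (0 : ℝ) T := ⟨a.coe_nonneg.trans hs.1, hs.2.trans hbT⟩
  have h1 : e s ≤ Real.exp (cumRate ρ T - cumRate ρ s) * L := by
    rw [Real.exp_sub, div_mul_eq_mul_div, le_div_iff₀ (Real.exp_pos _), mul_comm]
    exact he.le_last s hs'
  have h2 : e s ^ (p - 1) ≤ Real.exp ((cumRate ρ T - cumRate ρ s) * (p - 1)) * L ^ (p - 1) := by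
    rw [Real.exp_mul, ← Real.mul_rpow (Real.exp_pos _).le hL0.le]
    exact Real.rpow_le_rpow (he.nonneg s hs') h1 (by linarith)
  have h3 : u s ≤ c * ρ s := le_of_lt (hsub hs)
  have h4 : Real.exp (-cumRate ρ T) ^ (p - 1) ≤ L ^ (p - 1) :=
    Real.rpow_le_rpow (Real.exp_pos _).le hLe (by linarith)
  calc k s * e s ^ (p - 1) ≤ u s * L ^ (p - 1) := by
        rw [hu]
        simp only
        rw [mul_assoc]
        exact mul_le_mul_of_nonneg_left h2 (hk s hs')
    _ ≤ c * ρ s * L ^ (p - 1) := mul_le_mul_of_nonneg_right h3 (Real.rpow_nonneg hL0.le _)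
    _ = (W * L ^ (p - 1) - (W - c) * L ^ (p - 1)) * ρ s := by ring
    _ ≤ _ := by
      refine mul_le_mul_of_nonneg_right (sub_le_sub_left ?_ _) (h.rate_pos s).le
      exact mul_le_mul_of_nonneg_left h4 hν.le

/-- Where the condition fails, N = e^{∫ρ} g strictly decreases, while Φ = e^{∫ρ} e increases for
every purchase. Marginal cost per unit of ρ is a power of Φ/N, so it rises by a fixed factor from an
earlier to a later interval, and shifting impact back in time pays. -/
theorem hasTTPM_of_deriv_impactRatio_lt (hS : Martingale S ℱ P)
    (hSr : ∀ᵐ ω ∂P, ∀ t, ContinuousWithinAt (fun s => S s ω) (Ici t) t)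
    (hγ : -1 < γ) (h : RegularCoefficients ρ lam lam') (hT : 0 < T)
    (hd : ∀ t ∈ Icc (0 : ℝ) T, 0 < ρ t * (2 + γ) + lam' t / lam t) {z' : ℝ → ℝ}
    (hz : ∀ t ∈ Ioo (0 : ℝ) T, HasDerivAt (impactRatio γ ρ lam lam') (z' t) t) {t : ℝ}
    (ht : t ∈ Ioo (0 : ℝ) T) (hzc : ContinuousAt z' t)
    (hlt : z' t + ρ t * (1 - impactRatio γ ρ lam lam' t) < 0) :
    HasTTPM P ℱ S (powerLaw γ) ρ lam T := by
  set p := costExponent γ with hp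
  have hp1 : 1 < p := one_lt_costExponent hγ
  set k := runningWeight γ ρ lam lam' with hkdef
  have hk : ∀ t ∈ Icc (0 : ℝ) T, 0 ≤ k t := fun t ht =>
    (runningWeight_nonneg_iff hγ h).2 (hd t ht).le
  set ζ := impactRatio γ ρ lam lam' with hζ
  set g := impactProfile γ ρ lam lam' with hg
  have hg0 : ∀ t ∈ Icc (0 : ℝ) T, 0 < g t := fun t ht => impactProfile_pos hγ h (hd t ht)
  have hcont : ContinuousAt (fun t => z' t + ρ t * (1 - ζ t)) t :=
    hzc.add (h.rate_continuous.continuousAt.mul (continuousAt_const.sub (hz t ht).continuousAt))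
  obtain ⟨a, d, had, hdT, hsub⟩ := exists_Icc_subset_of_mem_nhds hT (Ioo_subset_Icc_self ht)
    (inter_mem (hcont.preimage_mem_nhds (Iio_mem_nhds hlt)) (Ioo_mem_nhds ht.1 ht.2))
  -- The gap between b and c separates the two blocks [a, b] and [c, d] and makes N b / N c > 1 a
  -- fixed factor.
  obtain ⟨c, hac, hcd⟩ := exists_between had
  obtain ⟨b, hab, hbc⟩ := exists_between hac
  have hIcc : ∀ s ∈ Icc (a : ℝ) d, s ∈ Icc (0 : ℝ) T := fun s hs =>
    ⟨a.coe_nonneg.trans hs.1, hs.2.trans hdT⟩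
  set N : ℝ → ℝ := fun s => Real.exp (cumRate ρ s) * g s with hN
  have hN0 : ∀ s ∈ Icc (0 : ℝ) T, 0 < N s := fun s hs => mul_pos (Real.exp_pos _) (hg0 s hs)
  have hNanti : StrictAntiOn N (Icc (a : ℝ) d) := by
    have hder : ∀ s ∈ Icc (a : ℝ) d, HasDerivAt N
        (Real.exp (cumRate ρ s) * (g s * ((1 + γ) / ζ s * (z' s + ρ s * (1 - ζ s))))) s := by
      intro s hs
      have hs' := (hsub hs).2
      refine ((hasDerivAt_cumRate h.rate_continuous s).exp.mul
        (hasDerivAt_impactProfile hγ h hs'.1 (hd s (hIcc s hs)) (hz s hs'))).congr_deriv ?_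
      ring
    refine strictAntiOn_of_deriv_neg (convex_Icc _ _)
      (fun s hs => (hder s hs).continuousAt.continuousWithinAt) fun s hs => ?_
    rw [interior_Icc] at hs
    have hs' := Ioo_subset_Icc_self hs
    rw [(hder s hs').deriv]
    have hneg : z' s + ρ s * (1 - ζ s) < 0 := (hsub hs').1
    have hpos : 0 < (1 + γ) / ζ s :=
      div_pos (by linarith) (impactRatio_pos hγ h (hd s (hIcc s hs')))
    exact mul_neg_of_pos_of_neg (Real.exp_pos _) (mul_neg_of_pos_of_neg (hg0 s (hIcc s hs'))
      (mul_neg_of_pos_of_neg hpos hneg))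
  have hbmem : (b : ℝ) ∈ Icc (a : ℝ) d := ⟨hab.le, (hbc.trans hcd).le⟩
  have hcmem : (c : ℝ) ∈ Icc (a : ℝ) d := ⟨hac.le, hcd.le⟩
  have hNb := hN0 b (hIcc b hbmem)
  have hNc := hN0 c (hIcc c hcmem)
  have hratio : 1 < (N b / N c) ^ (p - 1) :=
    Real.one_lt_rpow ((one_lt_div hNc).2 (hNanti hbmem hcmem hbc)) (by linarith)
  set ε := (N b / N c) ^ (p - 1) - 1 with hε
  have hε0 : 0 < ε := by linarith
  -- Half of the least possible marginal cost of the last trade, over all purchases of one share.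
  set τ := costWeight γ (lam T) * Real.exp (-cumRate ρ T) ^ (p - 1) / 2 with hτ
  have hτ0 : 0 < τ := div_pos (mul_pos (costWeight_pos hγ (h.depth_pos _))
    (Real.rpow_pos_of_pos (Real.exp_pos _) _)) two_pos
  have hcw : 0 < costWeight γ 1 := costWeight_pos hγ one_pos
  refine hasTTPM_of_blocks hS hSr hγ h hT hk hab ((hbc.trans hcd).le.trans hdT) hcd hdT
    (μ := min τ (ε * τ)) (lt_min hτ0 (mul_pos hε0 hτ0)) fun e he => ?_
  set Φ : ℝ → ℝ := fun s => Real.exp (cumRate ρ s) * e s with hΦ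
  have hke : ∀ s ∈ Icc (0 : ℝ) T,
      k s * e s ^ (p - 1) = costWeight γ 1 * (Φ s / N s) ^ (p - 1) * ρ s := by
    intro s hs
    have h1 : Φ s / N s = e s / g s := mul_div_mul_left _ _ (Real.exp_pos _).ne'
    have h2 := Real.rpow_pos_of_pos (hg0 s hs) (p - 1)
    rw [h1, Real.div_rpow (he.nonneg s hs) (hg0 s hs).le, mul_right_comm,
      ← runningWeight_mul_rpow hγ h (hd s hs)]
    change _ = k s * g s ^ (p - 1) * _
    field_simp
  have hΦ0 : ∀ s ∈ Icc (0 : ℝ) T, 0 ≤ Φ s := fun s hs =>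
    mul_nonneg (Real.exp_pos _).le (he.nonneg s hs)
  set u := costWeight γ 1 * (Φ b / N b) ^ (p - 1) with hu
  have hupper : ∀ s ∈ Icc (a : ℝ) b, k s * e s ^ (p - 1) ≤ u * ρ s := by
    intro s hs
    have hsd : s ∈ Icc (a : ℝ) d := ⟨hs.1, hs.2.trans hbmem.2⟩
    rw [hke s (hIcc s hsd)]
    refine mul_le_mul_of_nonneg_right (mul_le_mul_of_nonneg_left (Real.rpow_le_rpow
      (div_nonneg (hΦ0 s (hIcc s hsd)) (hN0 s (hIcc s hsd)).le) ?_ (by linarith)) hcw.le)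
      (h.rate_pos s).le
    exact div_le_div₀ (hΦ0 b (hIcc b hbmem))
      (he.monotoneOn (hIcc s hsd) (hIcc b hbmem) hs.2) hNb
      (hNanti.antitoneOn hsd hbmem hs.2)
  -- A fixed factor gives a fixed gap only if the marginal cost u on the early block is bounded
  -- below. If u is small, it is compared with the last trade instead.
  rcases le_or_gt u τ with hcase | hcase
  · refine Or.inl fun s hs => (hupper s hs).trans
      (mul_le_mul_of_nonneg_right ?_ (h.rate_pos s).le)
    have h1 : Real.exp (-cumRate ρ T) ^ (p - 1) ≤
        (1 - ∫ s in (0 : ℝ)..T, ρ s * e s) ^ (p - 1) :=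
      Real.rpow_le_rpow (Real.exp_pos _).le he.exp_neg_le_last (by linarith)
    have h2 := mul_le_mul_of_nonneg_left h1 (costWeight_pos hγ (h.depth_pos T)).le
    have h3 := min_le_left τ (ε * τ)
    have h4 : 2 * τ = costWeight γ (lam T) * Real.exp (-cumRate ρ T) ^ (p - 1) := by
      rw [hτ]; ring
    linarith
  · refine Or.inr ⟨u, hupper, fun s hs => ?_⟩
    have hsd : s ∈ Icc (a : ℝ) d := ⟨hcmem.1.trans hs.1, hs.2⟩
    rw [hke s (hIcc s hsd)]
    refine mul_le_mul_of_nonneg_right ?_ (h.rate_pos s).le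
    have h1 : u + min τ (ε * τ) ≤ u * (N b / N c) ^ (p - 1) := by
      have h2 := min_le_right τ (ε * τ)
      have h3 := mul_le_mul_of_nonneg_left hcase.le hε0.le
      have h4 : u * (N b / N c) ^ (p - 1) = u + ε * u := by rw [hε]; ring
      linarith
    refine h1.trans ?_
    rw [hu, mul_assoc, ← Real.mul_rpow (div_nonneg (hΦ0 b (hIcc b hbmem)) hNb.le)
      (div_nonneg hNb.le hNc.le), div_mul_div_cancel₀ hNb.ne']
    refine mul_le_mul_of_nonneg_left (Real.rpow_le_rpow
      (div_nonneg (hΦ0 b (hIcc b hbmem)) hNc.le) ?_ (by linarith)) hcw.le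
    have hbs : (b : ℝ) ≤ s := (NNReal.coe_le_coe.2 hbc.le).trans hs.1
    exact div_le_div₀ (hΦ0 s (hIcc s hsd)) (he.monotoneOn (hIcc b hbmem) (hIcc s hsd) hbs)
      (hN0 s (hIcc s hsd)) (hNanti.antitoneOn hcmem hsd hs.1)

theorem not_hasPMS_iff (hS : Martingale S ℱ P)
    (hSr : ∀ᵐ ω ∂P, ∀ t, ContinuousWithinAt (fun s => S s ω) (Ici t) t)
    (hγ : -1 < γ) (h : RegularCoefficients ρ lam lam') (hT : 0 < T) :
    ¬ HasPMS P ℱ S (powerLaw γ) ρ lam T ↔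
      ∀ t ∈ Icc (0 : ℝ) T, 0 ≤ ρ t * (2 + γ) + lam' t / lam t := by
  rw [hasPMS_iff hS hSr hγ h hT]
  constructor
  · intro hno t ht
    by_contra! hcon
    refine hno (exists_pathImpactCost_neg hγ h hT ht (not_le.1 fun hk => hcon.not_ge ?_))
    exact (runningWeight_nonneg_iff hγ h).1 hk
  · rintro hcond ⟨x, -, hneg⟩
    exact hneg.not_ge (pathImpactCost_nonneg hγ h
      (fun t ht => (runningWeight_nonneg_iff hγ h).2 (hcond t ht)) 0 x)

/-- `e ^ (-∫ ρ) (ζ - 1)` is monotone if `ζ' + ρ (1 - ζ)` is nonnegative. -/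
theorem le_one_of_deriv_nonneg (hρ : Continuous ρ) {T : ℝ} {ζ z' : ℝ → ℝ}
    (hζ : ContinuousOn ζ (Icc 0 T)) (hz : ∀ t ∈ Ioo 0 T, HasDerivAt ζ (z' t) t)
    (hz0 : ∀ t ∈ Ioo 0 T, 0 ≤ z' t + ρ t * (1 - ζ t)) (hlast : ζ T ≤ 1) {t : ℝ}
    (ht : t ∈ Icc 0 T) : ζ t ≤ 1 := by
  have hmono : MonotoneOn (fun t => Real.exp (-cumRate ρ t) * (ζ t - 1)) (Icc 0 T) := by
    have hder : ∀ t ∈ Ioo 0 T, HasDerivAt (fun t => Real.exp (-cumRate ρ t) * (ζ t - 1))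
        (Real.exp (-cumRate ρ t) * (z' t + ρ t * (1 - ζ t))) t := by
      intro t ht
      refine ((hasDerivAt_cumRate hρ t).neg.exp.mul ((hz t ht).sub_const 1)).congr_deriv ?_
      rw [Pi.neg_apply]
      ring
    refine monotoneOn_of_deriv_nonneg (convex_Icc _ _)
      ((Real.continuous_exp.comp (continuous_cumRate hρ).neg).continuousOn.mul
        (hζ.sub continuousOn_const)) ?_ ?_
    · rw [interior_Icc]
      exact fun t ht => (hder t ht).differentiableAt.differentiableWithinAt
    · rw [interior_Icc]
      intro t ht
      rw [(hder t ht).deriv]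
      exact mul_nonneg (Real.exp_pos _).le (hz0 t ht)
  have h1 := hmono ht ⟨ht.1.trans ht.2, le_rfl⟩ ht.2
  have h2 : Real.exp (-cumRate ρ T) * (ζ T - 1) ≤ 0 :=
    mul_nonpos_of_nonneg_of_nonpos (Real.exp_pos _).le (by linarith)
  have h3 := h1.trans h2
  by_contra! hcon
  have h4 := mul_pos (Real.exp_pos (-cumRate ρ t)) (sub_pos.2 hcon)
  simp only at h3
  linarith

/-- The hypothesis on ζ' is conditional because ζ is only known to be differentiable once its
denominator is positive, which is itself deduced from the absence of manipulation. The condition ζ ≤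
1 is obtained at T first and then propagated backwards. -/
theorem not_hasTTPM_iff (hS : Martingale S ℱ P)
    (hSr : ∀ᵐ ω ∂P, ∀ t, ContinuousWithinAt (fun s => S s ω) (Ici t) t)
    (hγ : -1 < γ) (h : RegularCoefficients ρ lam lam') (hT : 0 < T) {z' : ℝ → ℝ}
    (hz : (∀ t ∈ Icc (0 : ℝ) T, 0 < ρ t * (2 + γ) + lam' t / lam t) →
      ContinuousOn z' (Icc 0 T) ∧
        ∀ t ∈ Ioo (0 : ℝ) T, HasDerivAt (impactRatio γ ρ lam lam') (z' t) t) :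
    ¬ HasTTPM P ℱ S (powerLaw γ) ρ lam T ↔
      ∀ t ∈ Icc (0 : ℝ) T, 0 ≤ ρ t + lam' t / lam t ∧
        0 ≤ z' t + ρ t * ((ρ t + lam' t / lam t) / (ρ t * (2 + γ) + lam' t / lam t)) := by
  have hT' : (0 : ℝ) < T := hT
  have hTT : (T : ℝ) ∈ Icc (0 : ℝ) T := ⟨T.coe_nonneg, le_rfl⟩
  have hg : 0 < 1 + γ := by linarith
  constructor
  · intro hno
    have hk : ∀ t ∈ Icc (0 : ℝ) T, 0 ≤ runningWeight γ ρ lam lam' t := by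
      intro t ht
      by_contra! hcon
      obtain ⟨x, hx, hneg⟩ := exists_pathImpactCost_neg hγ h hT ht hcon
      exact hno (hasTTPM_of_pathImpactCost_neg hS hSr hγ h hT hx hneg)
    have hd : ∀ t ∈ Icc (0 : ℝ) T, 0 < ρ t * (2 + γ) + lam' t / lam t := by
      intro t ht
      rw [← runningWeight_pos_iff hγ h]
      refine (hk t ht).lt_of_ne' fun h0 =>
        hno (hasTTPM_of_runningWeight_lt hS hSr hγ h hT hk ht ?_)
      rw [h0, zero_mul]
      exact mul_pos (costWeight_pos hγ (h.depth_pos _)) (h.rate_pos t)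
    have hlast : impactRatio γ ρ lam lam' T ≤ 1 := by
      rw [impactRatio, div_le_one (hd T hTT)]
      by_contra! hcon
      refine hno (hasTTPM_of_runningWeight_lt hS hSr hγ h hT hk hTT ?_)
      rw [sub_self, zero_mul, Real.exp_zero, mul_one, runningWeight, mul_div_assoc]
      exact mul_lt_mul_of_pos_left ((div_lt_iff₀ hg).2 hcon) (costWeight_pos hγ (h.depth_pos _))
    obtain ⟨hzc, hzd⟩ := hz hd
    have hζc := continuousOn_impactRatio h hd
    have hint : ∀ t ∈ Ioo (0 : ℝ) T, 0 ≤ z' t + ρ t * (1 - impactRatio γ ρ lam lam' t) := by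
      intro t ht
      by_contra! hcon
      exact hno (hasTTPM_of_deriv_impactRatio_lt hS hSr hγ h hT hd hzd ht
        (hzc.continuousAt (Icc_mem_nhds ht.1 ht.2)) hcon)
    have hall : ∀ t ∈ Icc (0 : ℝ) T, 0 ≤ z' t + ρ t * (1 - impactRatio γ ρ lam lam' t) := by
      -- The perturbation argument works at interior times; the end points follow by continuity.
      rw [← closure_Ioo hT'.ne] at hzc hζc ⊢
      intro t ht
      exact le_on_closure (f := fun _ => (0 : ℝ)) hint continuousOn_const
        (hzc.add (h.rate_continuous.continuousOn.mul (continuousOn_const.sub hζc))) ht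
    intro t ht
    have h1 := le_one_of_deriv_nonneg h.rate_continuous hζc hzd hint hlast ht
    refine ⟨?_, ?_⟩
    · rw [impactRatio, div_le_one (hd t ht)] at h1
      linarith
    · rw [← one_sub_impactRatio (hd t ht)]
      exact hall t ht
  · intro hcond
    have hd : ∀ t ∈ Icc (0 : ℝ) T, 0 < ρ t * (2 + γ) + lam' t / lam t := by
      intro t ht
      have h1 := (hcond t ht).1
      have h2 := mul_pos (h.rate_pos t) hg
      linarith
    have hzd := (hz hd).2
    refine not_hasTTPM_of_le hS hSr hγ h hT (exists_monotone_minimizer hγ h hd hzd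
      (fun t ht => ?_) ?_)
    · rw [one_sub_impactRatio (hd t (Ioo_subset_Icc_self ht))]
      exact (hcond t (Ioo_subset_Icc_self ht)).2
    · rw [impactRatio, div_le_one (hd T hTT)]
      have h1 := (hcond T hTT).1
      linarith

end FixedHorizon

/-! ### Coefficients on the half-line -/

section HalfLine

variable {Ω : Type*} [mΩ : MeasurableSpace Ω] {P : Measure Ω} {ℱ : Filtration ℝ≥0 mΩ}
  {S : ℝ≥0 → Ω → ℝ} {f ρ ρ' lam lam' : ℝ → ℝ} {T : ℝ≥0}

theorem volumeImpact_congr (hρ : EqOn ρ ρ' (Ici 0)) (x : ℝ≥0 → ℝ) (t : ℝ≥0) :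
    volumeImpact ρ x t = volumeImpact ρ' x t := by
  unfold volumeImpact
  congr 1
  refine intervalIntegral.integral_congr fun s hs => ?_
  rw [uIcc_of_le t.coe_nonneg] at hs
  have h1 : ∫ u in s..t, ρ u = ∫ u in s..t, ρ' u :=
    intervalIntegral.integral_congr fun u hu => by
      rw [uIcc_of_le hs.2] at hu
      exact hρ (hs.1.trans hu.1)
  simp only [hρ (show s ∈ Ici 0 from hs.1), h1]

theorem expectedCost_congr (hρ : EqOn ρ ρ' (Ici 0)) (hlam : EqOn lam lam' (Ici 0))
    (X : ℝ≥0 → Ω → ℝ) : expectedCost P S f ρ lam T X = expectedCost P S f ρ' lam' T X := by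
  have h1 : ∀ t : ℝ≥0, lam t = lam' t := fun t => hlam t.coe_nonneg
  simp only [expectedCost, pathCost, priceImpact, volumeImpact_congr hρ, h1]

theorem hasPMS_congr (hρ : EqOn ρ ρ' (Ici 0)) (hlam : EqOn lam lam' (Ici 0)) :
    HasPMS P ℱ S f ρ lam T ↔ HasPMS P ℱ S f ρ' lam' T := by
  simp only [HasPMS, expectedCost_congr hρ hlam]

theorem hasTTPM_congr (hρ : EqOn ρ ρ' (Ici 0)) (hlam : EqOn lam lam' (Ici 0)) :
    HasTTPM P ℱ S f ρ lam T ↔ HasTTPM P ℱ S f ρ' lam' T := by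
  simp only [HasTTPM, expectedCost_congr hρ hlam]

theorem eqOn_max_zero (φ : ℝ → ℝ) : EqOn φ (fun t => φ (max 0 t)) (Ici 0) := fun t ht => by
  simp only [max_eq_right (mem_Ici.1 ht)]

theorem continuous_comp_max_zero {φ : ℝ → ℝ} (hφ : ContinuousOn φ (Ici 0)) :
    Continuous fun t => φ (max 0 t) :=
  hφ.comp_continuous (continuous_const.max continuous_id) fun t => le_max_left 0 t

/-- Freezing the coefficients at their value at 0 for negative times changes no cost and gives
globally continuous functions. The derivative is only claimed for t > 0, where the one-sided
derivative is two-sided. -/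
theorem regularCoefficients_max_zero (hρpos : ∀ t, 0 ≤ t → 0 < ρ t) (hρ : ContDiffOn ℝ 1 ρ (Ici 0))
    (hlampos : ∀ t, 0 ≤ t → 0 < lam t) (hlam : ContDiffOn ℝ 2 lam (Ici 0)) :
    RegularCoefficients (fun t => ρ (max 0 t)) (fun t => lam (max 0 t))
      (fun t => derivWithin lam (Ici 0) (max 0 t)) where
  rate_pos t := hρpos _ (le_max_left _ _)
  rate_continuous := continuous_comp_max_zero hρ.continuousOn
  depth_pos t := hlampos _ (le_max_left _ _)
  depth_continuous := continuous_comp_max_zero hlam.continuousOn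
  deriv_continuous := continuous_comp_max_zero
    (hlam.continuousOn_derivWithin (uniqueDiffOn_Ici 0) (by norm_num))
  hasDerivAt t ht := by
    have h1 := ((hlam.differentiableOn (by norm_num)) t ht.le).hasDerivWithinAt.hasDerivAt
      (Ici_mem_nhds ht)
    simp only [max_eq_right ht.le]
    refine h1.congr_of_eventuallyEq ?_
    filter_upwards [Ioi_mem_nhds ht] with s hs using (eqOn_max_zero lam (mem_Ici.2 (le_of_lt hs))).symm

theorem derivWithin_impactRatio {γ : ℝ} {η : ℝ → ℝ} (hρ : ContDiffOn ℝ 1 ρ (Ici 0))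
    (hlampos : ∀ t, 0 ≤ t → 0 < lam t) (hlam : ContDiffOn ℝ 2 lam (Ici 0))
    (hη : ∀ t, 0 ≤ t → η t = derivWithin lam (Ici 0) t / lam t)
    (hd : ∀ t ∈ Icc (0 : ℝ) T, 0 < ρ t * (2 + γ) + η t) :
    ContinuousOn (derivWithin (fun s => ρ s * (1 + γ) / (ρ s * (2 + γ) + η s)) (Ici 0)) (Icc 0 T) ∧
      ∀ t ∈ Ioo (0 : ℝ) T, HasDerivAt (impactRatio γ (fun t => ρ (max 0 t)) (fun t => lam (max 0 t))
        (fun t => derivWithin lam (Ici 0) (max 0 t)))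
        (derivWithin (fun s => ρ s * (1 + γ) / (ρ s * (2 + γ) + η s)) (Ici 0) t) t := by
  have hu : UniqueDiffOn ℝ (Ici (0 : ℝ)) := uniqueDiffOn_Ici 0
  have hηd : ContDiffOn ℝ 1 η (Ici 0) :=
    ((hlam.derivWithin hu (m := 1) (by norm_num)).div (hlam.of_le (by norm_num))
      fun t ht => (hlampos t ht).ne').congr hη
  have hdn : ContDiffOn ℝ 1 (fun s => ρ s * (2 + γ) + η s) (Ici 0) :=
    (hρ.mul contDiffOn_const).add hηd
  have hnm : ContDiffOn ℝ 1 (fun s => ρ s * (1 + γ)) (Ici 0) := hρ.mul contDiffOn_const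
  have hder : ∀ t ∈ Icc (0 : ℝ) T, HasDerivWithinAt
      (fun s => ρ s * (1 + γ) / (ρ s * (2 + γ) + η s)) _ (Ici 0) t := fun t ht =>
    ((hnm.differentiableOn (by norm_num)) t ht.1).hasDerivWithinAt.fun_div
      ((hdn.differentiableOn (by norm_num)) t ht.1).hasDerivWithinAt (hd t ht).ne'
  have hsub : Icc (0 : ℝ) T ⊆ Ici 0 := Icc_subset_Ici_self
  refine ⟨?_, fun t ht => ?_⟩
  · refine ContinuousOn.congr ?_ fun t ht => (hder t ht).derivWithin (hu t ht.1)
    have c1 := (hnm.continuousOn_derivWithin hu le_rfl).mono hsub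
    have c2 := (hdn.continuousOn_derivWithin hu le_rfl).mono hsub
    exact ((c1.mul (hdn.continuousOn.mono hsub)).sub ((hnm.continuousOn.mono hsub).mul c2)).div
      ((hdn.continuousOn.mono hsub).pow 2) fun t ht => (pow_pos (hd t ht) 2).ne'
  · have h1 := ((hder t (Ioo_subset_Icc_self ht)).differentiableWithinAt.hasDerivWithinAt).hasDerivAt
      (Ici_mem_nhds ht.1)
    refine h1.congr_of_eventuallyEq ?_
    filter_upwards [Ioi_mem_nhds ht.1] with s hs
    have hs' : (0 : ℝ) < s := hs
    simp only [impactRatio, max_eq_right hs'.le, hη s hs'.le]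

end HalfLine

end OrderBook

/-! ### The characterization for coefficients on the half-line -/

theorem mainTheorem12 {Ω : Type*} [mΩ : MeasurableSpace Ω] (P : Measure Ω)
    [IsProbabilityMeasure P] (ℱ : Filtration ℝ≥0 mΩ) (S : ℝ≥0 → Ω → ℝ)
    (hS : Martingale S ℱ P)
    (hSright : ∀ᵐ ω ∂P, ∀ t, ContinuousWithinAt (fun s => S s ω) (Ici t) t)
    (γ : ℝ) (hγ : -1 < γ) (ρ lam η : ℝ → ℝ)
    (hρpos : ∀ t, 0 ≤ t → 0 < ρ t) (hρ : ContDiffOn ℝ 1 ρ (Ici 0))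
    (hlampos : ∀ t, 0 ≤ t → 0 < lam t) (hlam : ContDiffOn ℝ 2 lam (Ici 0))
    (hη : ∀ t, 0 ≤ t → η t = derivWithin lam (Ici 0) t / lam t) :
    -- all horizons together
    ((∀ T : ℝ≥0, 0 < T → ¬ OrderBook.HasPMS P ℱ S (OrderBook.powerLaw γ) ρ lam T) ↔
      ∀ t : ℝ, 0 ≤ t → 0 ≤ ρ t * (2 + γ) + η t) ∧
    ((∀ T : ℝ≥0, 0 < T → ¬ OrderBook.HasTTPM P ℱ S (OrderBook.powerLaw γ) ρ lam T) ↔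
      ∀ t : ℝ, 0 ≤ t → 0 ≤ ρ t + η t ∧
        0 ≤ derivWithin (fun s => ρ s * (1 + γ) / (ρ s * (2 + γ) + η s)) (Ici 0) t +
          ρ t * ((ρ t + η t) / (ρ t * (2 + γ) + η t))) ∧
    -- each fixed horizon
    (∀ T : ℝ≥0, 0 < T →
      (¬ OrderBook.HasPMS P ℱ S (OrderBook.powerLaw γ) ρ lam T ↔
        ∀ t ∈ Icc (0 : ℝ) T, 0 ≤ ρ t * (2 + γ) + η t) ∧
      (¬ OrderBook.HasTTPM P ℱ S (OrderBook.powerLaw γ) ρ lam T ↔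
        ∀ t ∈ Icc (0 : ℝ) T, 0 ≤ ρ t + η t ∧
          0 ≤ derivWithin (fun s => ρ s * (1 + γ) / (ρ s * (2 + γ) + η s)) (Ici 0) t +
            ρ t * ((ρ t + η t) / (ρ t * (2 + γ) + η t)))) := by
  have hreg := OrderBook.regularCoefficients_max_zero hρpos hρ hlampos hlam
  have hPMS : ∀ T : ℝ≥0, 0 < T →
      (¬ OrderBook.HasPMS P ℱ S (OrderBook.powerLaw γ) ρ lam T ↔
        ∀ t ∈ Icc (0 : ℝ) T, 0 ≤ ρ t * (2 + γ) + η t) := by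
    intro T hT
    rw [OrderBook.hasPMS_congr (OrderBook.eqOn_max_zero ρ) (OrderBook.eqOn_max_zero lam),
      OrderBook.not_hasPMS_iff hS hSright hγ hreg hT]
    refine forall₂_congr fun t ht => ?_
    simp only [max_eq_right ht.1, hη t ht.1]
  have hTTPM : ∀ T : ℝ≥0, 0 < T →
      (¬ OrderBook.HasTTPM P ℱ S (OrderBook.powerLaw γ) ρ lam T ↔
        ∀ t ∈ Icc (0 : ℝ) T, 0 ≤ ρ t + η t ∧
          0 ≤ derivWithin (fun s => ρ s * (1 + γ) / (ρ s * (2 + γ) + η s)) (Ici 0) t +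
            ρ t * ((ρ t + η t) / (ρ t * (2 + γ) + η t))) := by
    intro T hT
    rw [OrderBook.hasTTPM_congr (OrderBook.eqOn_max_zero ρ) (OrderBook.eqOn_max_zero lam),
      OrderBook.not_hasTTPM_iff hS hSright hγ hreg hT fun hd =>
        OrderBook.derivWithin_impactRatio hρ hlampos hlam hη fun t ht => ?_]
    · refine forall₂_congr fun t ht => ?_
      simp only [max_eq_right ht.1, hη t ht.1]
    · simpa only [max_eq_right ht.1, hη t ht.1] using hd t ht
  -- The horizon t + 1 contains t and is positive even for t = 0.
  have hall : ∀ {A : ℝ → Prop}, (∀ T : ℝ≥0, 0 < T → ∀ t ∈ Icc (0 : ℝ) T, A t) ↔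
      ∀ t, 0 ≤ t → A t := fun {A} =>
    ⟨fun hA t ht => hA (t.toNNReal + 1) (by positivity) t
      ⟨ht, by rw [NNReal.coe_add, Real.coe_toNNReal t ht, NNReal.coe_one]; linarith⟩,
      fun hA T _ t ht => hA t ht.1⟩
  refine ⟨?_, ?_, fun T hT => ⟨hPMS T hT, hTTPM T hT⟩⟩
  · rw [← hall]
    exact forall₂_congr hPMS
  · rw [← hall]
    exact forall₂_congr hTTPM
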